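/- **Setting.** Let $(Y_i,X_i)$, $1\le i\le n$, be independent centered Gaussian vectors of $\mathbb R^q\times\mathbb R^p$ with positive definite covariance $\Sigma^*$ (blocks $\Sigma^*_{yy},\Sigma^*_{yx},\Sigma^*_{xx}$), let $\Omega^*=(\Sigma^*)^{-1}$ (blocks $\Omega^*_{yy},\Omega^*_{yx},\Omega^*_{xx}$) and $\theta^*=(\Omega^*_{yy},\Omega^*_{yx})$, and let $|S|$ be the number of non-zero entries of $\theta^*$. Let $S^{(n)}_{yy}=\frac1n\sum Y_iY_i^t$, $S^{(n)}_{yx}=\frac1n\sum Y_iX_i^t$, $S^{(n)}_{xx}=\frac1n\sum X_iX_i^t$. Write $|\cdot|_1$, $|\cdot|_\infty$ for the elementwise norms, $|\cdot|_1^-$ for $|\cdot|_1$ deprived of the diagonal, $\langle\!\langle A,B\rangle\!\rangle=\mathrm{tr}(A^tB)$, $\|\cdot\|_F$ and $\|\cdot\|_2$ for the Frobenius and spectral norms. Let $L\in\mathbb R^{p\times p}$ be symmetric positive definite and $\beta\ge1$. Assume (H$_1$) $\Sigma^*_{xx}$ and $\Omega^*_{yy}$ are positive definite, $\Omega^*_{yx}\ne0$,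 and $\Omega^*_{yx}L\Omega^{*t}_{yx}$ is positive definite. For $\lambda,\mu,\eta\geq 0$ let $\widehat\theta=(\widehat\Omega_{yy},\widehat\Omega_{yx})$ denote a global minimizer, over symmetric positive definite $\Omega_{yy}\in\mathbb R^{q\times q}$ and $\Omega_{yx}\in\mathbb R^{q\times p}$, of $$-\ln\det\Omega_{yy}+\langle\!\langle S^{(n)}_{yy},\Omega_{yy}\rangle\!\rangle+2\langle\!\langle S^{(n)}_{yx},\Omega_{yx}\rangle\!\rangle+\langle\!\langle S^{(n)}_{xx},\Omega_{yx}^t\Omega_{yy}^{-1}\Omega_{yx}\rangle\!\rangle+\eta\langle\!\langle L,\Omega_{yx}^t\Omega_{yy}^{-1}\Omega_{yx}\rangle\!\rangle^\beta+\lambda|\Omega_{yy}|_1^-+\mu|\Omega_{yx}|_1 .$$ Let $h_a=|A_n|_\infty$ and $h_b=|B_n|_\infty$, where $$A_n=(S^{(n)}_{yy}-\Sigma^*_{yy})-\Omega_{yy}^{*-1}\Omega^*_{yx}(S^{(n)}_{xx}-\Sigma^*_{xx})\Omega_{yx}^{*t}\Omega_{yy}^{*-1},\qquad B_n=2\big((S^{(n)}_{yx}-\Sigma^*_{yx})+\Omega_{yy}^{*-1}\Omega^*_{yx}(S^{(n)}_{xx}-\Sigma^*_{xx})\big).$$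 **Constants.** Fix $d_\lambda>c_\lambda>1$, $d_\mu>c_\mu>1$, $e_\lambda,e_\mu>0$ and put $$s_L=\langle\!\langle L,\Omega_{yx}^{*t}\Omega_{yy}^{*-1}\Omega^*_{yx}\rangle\!\rangle,\quad \ell_a=|\Omega_{yy}^{*-1}\Omega^*_{yx}L\Omega_{yx}^{*t}\Omega_{yy}^{*-1}|_\infty,\quad \ell_b=2|\Omega_{yy}^{*-1}\Omega^*_{yx}L|_\infty,\quad \kappa=\eta\beta s_L^{\beta-1},$$ $$\overline\eta=\frac{1}{\beta s_L^{\beta-1}}\min\Big\{\tfrac{(c_\lambda-1)\lambda}{c_\lambda\ell_a},\tfrac{(c_\mu-1)\mu}{c_\mu\ell_b},\tfrac{e_\lambda h_a}{\ell_a},\tfrac{e_\mu h_b}{\ell_b}\Big\},\qquad \Lambda=\{(\lambda,\mu,\eta):c_\lambda h_a\le\lambda\le d_\lambda h_a,\ c_\mu h_b\le\mu\le d_\mu h_b,\ 0\le\eta\le\overline\eta\},$$ $$\alpha=\frac{\max\{\frac{(c_\lambda+1)\lambda}{c_\lambda}+\kappa\ell_a,\ \frac{(c_\mu+1)\mu}{c_\mu}+\kappa\ell_b\}}{\min\{\frac{(c_\lambda-1)\lambda}{c_\lambda}-\kappa\ell_a,\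 \frac{(c_\mu-1)\mu}{c_\mu}-\kappa\ell_b\}},\qquad s_\alpha=|S|\Big[1+\frac{12\alpha^2\lambda_{\max}(\Sigma^*_{xx})}{\lambda_{\min}(\Sigma^*_{xx})}\Big],$$ $$\underline\omega_L=\frac{\lambda_{\min}(\Omega^*_{yx}L\Omega^{*t}_{yx})}{4\lambda_{\max}(\Omega^*_{yy})},\quad \overline\omega_L=\frac{4\lambda_{\max}(\Omega^*_{yx}L\Omega^{*t}_{yx})}{\lambda_{\min}(\Omega^*_{yy})},\quad \overline\omega_S=\frac{4\lambda_{\max}(\Omega^*_{yx}\Sigma^*_{xx}\Omega^{*t}_{yx})}{\lambda_{\min}(\Omega^*_{yy})},$$ $$r^*=\min\Big\{\frac{\lambda_{\min}(\Omega^*_{yy})}2,\ \frac{\frac{\sqrt{10}-\sqrt7}{\sqrt5}\sqrt{\lambda_{\max}(\Omega^*_{yx}\Sigma^*_{xx}\Omega^{*t}_{yx})}}{\frac{3\sqrt3}{2\sqrt2}\sqrt{\lambda_{\max}(\Sigma^*_{xx})}},\ \frac{\lambda_{\min}(\Omega^*_{yx}L\Omega^{*t}_{yx})}{4\|L\Omega^{*t}_{yx}\|_2},\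 \frac{(\sqrt2-1)\sqrt{\lambda_{\max}(\Omega^*_{yx}L\Omega^{*t}_{yx})}}{\sqrt{\lambda_{\max}(L)}}\Big\},$$ $$c_{\lambda,\mu}=\max\Big\{\frac{(c_\lambda+1)d_\lambda}{c_\lambda}+e_\lambda,\ \frac{(c_\mu+1)d_\mu}{c_\mu}+e_\mu\Big\},\qquad m^*=|\mathrm{diag}(\Sigma^*)|_\infty+|\mathrm{diag}(\Omega_{yy}^{*-1}\Omega^*_{yx}\Sigma^*_{xx}\Omega_{yx}^{*t}\Omega_{yy}^{*-1})|_\infty .$$ For $\epsilon_S,\epsilon_L>0$ with $\epsilon_S\overline\omega_S+\eta\beta p^{\beta-1}\overline\omega_L^{\,\beta}\epsilon_L<1$ let $a_1=1-\epsilon_S\overline\omega_S-\eta\beta p^{\beta-1}\overline\omega_L^{\,\beta}\epsilon_L$, $a_2=\frac{2\epsilon_S}{2+\epsilon_S}$, $a_3=\eta\beta(q\,\underline\omega_L)^{\beta-1}\frac{2\epsilon_L}{2+\epsilon_L}$ and $$\gamma=\min\Big\{\frac{a_1}{8\lambda_{\max}^2(\Omega^*_{yy})},\ \frac{a_2\lambda_{\min}(\Sigma^*_{xx})}{40\lambda_{\max}(\Omega^*_{yy})}+\frac{a_3\lambda_{\min}(L)}{4\lambda_{\max}(\Omega^*_{yy})}\Big\}.$$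 **Theorem.** There are absolute constants $b_1,b_2>0$ such that, in the above setting, for all $0<b_3<1$, the following holds with probability at least $1-e^{-b_2n}-b_3$: for all $(\lambda,\mu,\eta)\in\Lambda$ for which the denominator of $\alpha$ is positive (it is always non-negative on $\Lambda$; when it is $0$, $\alpha=n_0=+\infty$ and nothing is claimed) and all admissible $\epsilon_S,\epsilon_L$ as above, if $n>n_0$, where $$n_0=\max\Big\{\frac{(\ln(10(p+q)^2)-\ln b_3)\,c_{\lambda,\mu}^2\,|S|\,(16m^*)^2}{r^{*2}\gamma^2},\ b_1(q+\lceil s_\alpha\rceil\ln(p+q)),\ \ln(10(p+q)^2)-\ln b_3\Big\},$$ then a minimizer $\widehat\theta$ exists, and every minimizer satisfies $$\|\widehat\theta-\theta^*\|_F\le\frac{16\,m^*\,c_{\lambda,\mu}\sqrt{|S|}}{\gamma}\sqrt{\frac{\ln(10(p+q)^2)-\ln b_3}{n}} .$$ -/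

import Mathlib

open Matrix MeasureTheory ProbabilityTheory

noncomputable section

namespace PGGM

/-! ### Matrix notation -/

/-- Largest eigenvalue (used for symmetric matrices only). -/
def lamMax {d : ℕ} (A : Matrix (Fin d) (Fin d) ℝ) : ℝ := sSup (spectrum ℝ A)

/-- Smallest eigenvalue (used for symmetric matrices only). -/
def lamMin {d : ℕ} (A : Matrix (Fin d) (Fin d) ℝ) : ℝ := sInf (spectrum ℝ A)

open scoped Matrix.Norms.L2Operator in
/-- Spectral norm, i.e. the operator norm between Euclidean spaces. -/
def specNorm {k l : ℕ} (A : Matrix (Fin k) (Fin l) ℝ) : ℝ := ‖A‖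

/-- Frobenius inner product `tr (Aᵗ B)`. -/
def frobInner {k l : ℕ} (A B : Matrix (Fin k) (Fin l) ℝ) : ℝ := (Aᵀ * B).trace

/-- Elementwise sup norm. -/
def maxNorm {k l : ℕ} (A : Matrix (Fin k) (Fin l) ℝ) : ℝ := ⨆ ij : Fin k × Fin l, |A ij.1 ij.2|

/-- Sup norm of the diagonal. -/
def diagMax {ι : Type*} (A : Matrix ι ι ℝ) : ℝ := ⨆ i, |A i i|

/-- Elementwise `ℓ¹` norm. -/
def l1Norm {k l : ℕ} (A : Matrix (Fin k) (Fin l) ℝ) : ℝ := ∑ i, ∑ j, |A i j|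

/-- Elementwise `ℓ¹` norm deprived of the diagonal terms. -/
def l1NormOff {k : ℕ} (A : Matrix (Fin k) (Fin k) ℝ) : ℝ :=
  ∑ i, ∑ j, if i = j then 0 else |A i j|

/-! ### The model

The coordinates `Fin q ⊕ Fin p` of an observation are those of the response `Y`, then those of the
predictor `X`. -/

/-- Covariance `Sig` of `(Y, X)`, structure matrix `L` and shape `β` of the prior. -/
structure Model (p q : ℕ) where
  Sig : Matrix (Fin q ⊕ Fin p) (Fin q ⊕ Fin p) ℝ
  L : Matrix (Fin p) (Fin p) ℝ
  β : ℝ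

/-- The constants `c_λ, d_λ, e_λ, c_μ, d_μ, e_μ`. -/
structure Tuning where
  cl : ℝ
  dl : ℝ
  el : ℝ
  cm : ℝ
  dm : ℝ
  em : ℝ

/-- The regularization parameters `(λ, μ, η)`. -/
structure Reg where
  lam : ℝ
  mu : ℝ
  eta : ℝ

/-- `1 < c_λ < d_λ`, `1 < c_μ < d_μ`, `e_λ > 0`, `e_μ > 0`. -/
structure Tuning.Valid (T : Tuning) : Prop where
  one_lt_cl : 1 < T.cl
  cl_lt_dl : T.cl < T.dl
  el_pos : 0 < T.el
  one_lt_cm : 1 < T.cm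
  cm_lt_dm : T.cm < T.dm
  em_pos : 0 < T.em

/-- A parameter `θ = (Ω_yy, Ω_yx)`. -/
abbrev Param (p q : ℕ) : Type := Matrix (Fin q) (Fin q) ℝ × Matrix (Fin q) (Fin p) ℝ

/-- Frobenius distance of two parameters, seen as `q × (q + p)` matrices. -/
def frobDist {p q : ℕ} (θ θ' : Param p q) : ℝ :=
  √((∑ i, ∑ j, (θ.1 i j - θ'.1 i j) ^ 2) + ∑ i, ∑ j, (θ.2 i j - θ'.2 i j) ^ 2)

namespace Model

variable {p q : ℕ} (M : Model p q)

/-- `Σ*_yy`. -/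
def Syy : Matrix (Fin q) (Fin q) ℝ := M.Sig.toBlocks₁₁

/-- `Σ*_yx`. -/
def Syx : Matrix (Fin q) (Fin p) ℝ := M.Sig.toBlocks₁₂

/-- `Σ*_xx`. -/
def Sxx : Matrix (Fin p) (Fin p) ℝ := M.Sig.toBlocks₂₂

/-- `Ω*_yy`, a block of the precision matrix. -/
def Oyy : Matrix (Fin q) (Fin q) ℝ := (M.Sig⁻¹).toBlocks₁₁

/-- `Ω*_yx`, a block of the precision matrix. -/
def Oyx : Matrix (Fin q) (Fin p) ℝ := (M.Sig⁻¹).toBlocks₁₂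

/-- The true parameter `θ*`. -/
def theta : Param p q := (M.Oyy, M.Oyx)

/-- Hypothesis (H₁). -/
structure H1 : Prop where
  Sxx_posDef : M.Sxx.PosDef
  Oyy_posDef : M.Oyy.PosDef
  Oyx_ne_zero : M.Oyx ≠ 0
  OLO_posDef : (M.Oyx * M.L * M.Oyxᵀ).PosDef

/-- `|S|`, the number of non-zero entries of `θ* = (Ω*_yy, Ω*_yx)`. -/
def cardS : ℕ :=
  {ij : Fin q × Fin q | M.Oyy ij.1 ij.2 ≠ 0}.ncard +
    {ij : Fin q × Fin p | M.Oyx ij.1 ij.2 ≠ 0}.ncard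

/-- The penalized likelihood at `θ`, as a function of the sample covariance `S`. -/
def objective (R : Reg) (S : Matrix (Fin q ⊕ Fin p) (Fin q ⊕ Fin p) ℝ) (θ : Param p q) : ℝ :=
  -Real.log θ.1.det + frobInner S.toBlocks₁₁ θ.1 + 2 * frobInner S.toBlocks₁₂ θ.2
    + frobInner S.toBlocks₂₂ (θ.2ᵀ * θ.1⁻¹ * θ.2)
    + R.eta * frobInner M.L (θ.2ᵀ * θ.1⁻¹ * θ.2) ^ M.β
    + R.lam * l1NormOff θ.1 + R.mu * l1Norm θ.2

/-- `θ` is a global minimizer of the penalized likelihood over `Θ = 𝕊₊₊^q × ℝ^{q × p}`. -/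
def IsEstimator (R : Reg) (S : Matrix (Fin q ⊕ Fin p) (Fin q ⊕ Fin p) ℝ) (θ : Param p q) : Prop :=
  θ.1.PosDef ∧ ∀ θ' : Param p q, θ'.1.PosDef → M.objective R S θ ≤ M.objective R S θ'

/-! ### The random quantities `h_a`, `h_b`, as functions of the sample covariance -/

/-- The matrix `A_n`. -/
def matA (S : Matrix (Fin q ⊕ Fin p) (Fin q ⊕ Fin p) ℝ) : Matrix (Fin q) (Fin q) ℝ :=
  (S.toBlocks₁₁ - M.Syy) - M.Oyy⁻¹ * M.Oyx * (S.toBlocks₂₂ - M.Sxx) * M.Oyxᵀ * M.Oyy⁻¹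

/-- The matrix `B_n`. -/
def matB (S : Matrix (Fin q ⊕ Fin p) (Fin q ⊕ Fin p) ℝ) : Matrix (Fin q) (Fin p) ℝ :=
  (2 : ℝ) • ((S.toBlocks₁₂ - M.Syx) + M.Oyy⁻¹ * M.Oyx * (S.toBlocks₂₂ - M.Sxx))

/-- `h_a`. -/
def ha (S : Matrix (Fin q ⊕ Fin p) (Fin q ⊕ Fin p) ℝ) : ℝ := maxNorm (M.matA S)

/-- `h_b`. -/
def hb (S : Matrix (Fin q ⊕ Fin p) (Fin q ⊕ Fin p) ℝ) : ℝ := maxNorm (M.matB S)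

/-! ### Constants -/

/-- `\underline{ω}_L`. -/
def omegaLLow : ℝ := lamMin (M.Oyx * M.L * M.Oyxᵀ) / (4 * lamMax M.Oyy)

/-- `\overline{ω}_L`. -/
def omegaLUp : ℝ := 4 * lamMax (M.Oyx * M.L * M.Oyxᵀ) / lamMin M.Oyy

/-- `\overline{ω}_S`. -/
def omegaSUp : ℝ := 4 * lamMax (M.Oyx * M.Sxx * M.Oyxᵀ) / lamMin M.Oyy

/-- `s_L`. -/
def sL : ℝ := frobInner M.L (M.Oyxᵀ * M.Oyy⁻¹ * M.Oyx)

/-- `ℓ_a`. -/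
def ella : ℝ := maxNorm (M.Oyy⁻¹ * M.Oyx * M.L * M.Oyxᵀ * M.Oyy⁻¹)

/-- `ℓ_b`. -/
def ellb : ℝ := 2 * maxNorm (M.Oyy⁻¹ * M.Oyx * M.L)

/-- `\overline{η}`, the upper bound of the band for `η`. -/
def etaBar (T : Tuning) (R : Reg) (S : Matrix (Fin q ⊕ Fin p) (Fin q ⊕ Fin p) ℝ) : ℝ :=
  min (min ((T.cl - 1) * R.lam / (T.cl * M.ella)) ((T.cm - 1) * R.mu / (T.cm * M.ellb)))
      (min (T.el * M.ha S / M.ella) (T.em * M.hb S / M.ellb))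
    / (M.β * M.sL ^ (M.β - 1))

/-- `(λ, μ, η) ∈ Λ`. -/
structure InBand (T : Tuning) (R : Reg) (S : Matrix (Fin q ⊕ Fin p) (Fin q ⊕ Fin p) ℝ) :
    Prop where
  lam_mem : R.lam ∈ Set.Icc (T.cl * M.ha S) (T.dl * M.ha S)
  mu_mem : R.mu ∈ Set.Icc (T.cm * M.hb S) (T.dm * M.hb S)
  eta_mem : R.eta ∈ Set.Icc 0 (M.etaBar T R S)

/-- The numerator of `α`. -/
def alphaNum (T : Tuning) (R : Reg) : ℝ :=
  max ((T.cl + 1) * R.lam / T.cl + R.eta * M.β * M.sL ^ (M.β - 1) * M.ella)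
    ((T.cm + 1) * R.mu / T.cm + R.eta * M.β * M.sL ^ (M.β - 1) * M.ellb)

/-- The denominator of `α`; it is non-negative for `(λ, μ, η) ∈ Λ`. -/
def alphaDen (T : Tuning) (R : Reg) : ℝ :=
  min ((T.cl - 1) * R.lam / T.cl - R.eta * M.β * M.sL ^ (M.β - 1) * M.ella)
    ((T.cm - 1) * R.mu / T.cm - R.eta * M.β * M.sL ^ (M.β - 1) * M.ellb)

/-- `α`. -/
def alpha (T : Tuning) (R : Reg) : ℝ := M.alphaNum T R / M.alphaDen T R

/-- `s_α`. -/
def sAlpha (T : Tuning) (R : Reg) : ℝ :=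
  M.cardS * (1 + 12 * M.alpha T R ^ 2 * lamMax M.Sxx / lamMin M.Sxx)

/-- `r₁*`. -/
def r1 : ℝ := lamMin M.Oyy / 2

/-- `r₂*`. -/
def r2 : ℝ :=
  ((√10 - √7) / √5 * √(lamMax (M.Oyx * M.Sxx * M.Oyxᵀ))) / (3 * √3 / (2 * √2) * √(lamMax M.Sxx))

/-- `r₃*`. -/
def r3 : ℝ := lamMin (M.Oyx * M.L * M.Oyxᵀ) / (4 * specNorm (M.L * M.Oyxᵀ))

/-- `r₄*`. -/
def r4 : ℝ := (√2 - 1) * √(lamMax (M.Oyx * M.L * M.Oyxᵀ)) / √(lamMax M.L)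

/-- `r*`. -/
def rStar : ℝ := min (min M.r1 M.r2) (min M.r3 M.r4)

/-- `a₁`. -/
def a1 (R : Reg) (εS εL : ℝ) : ℝ :=
  1 - εS * M.omegaSUp - R.eta * M.β * (p : ℝ) ^ (M.β - 1) * M.omegaLUp ^ M.β * εL

/-- `a₂`. -/
def a2 (εS : ℝ) : ℝ := 2 * εS / (2 + εS)

/-- `a₃`; the factor `q` is the size of the matrix `Ω_yy⁻¹ Ω_yx L Ω_yxᵗ`, whose trace is at least
`q` times its smallest eigenvalue. -/
def a3 (R : Reg) (εL : ℝ) : ℝ :=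
  R.eta * M.β * ((q : ℝ) * M.omegaLLow) ^ (M.β - 1) * (2 * εL / (2 + εL))

/-- `γ`, the constant of strong local convexity. -/
def gam (R : Reg) (εS εL : ℝ) : ℝ :=
  min (M.a1 R εS εL / (8 * lamMax M.Oyy ^ 2))
    (a2 εS * lamMin M.Sxx / (40 * lamMax M.Oyy) + M.a3 R εL * lamMin M.L / (4 * lamMax M.Oyy))

/-- `m*`, with the diagonal of the covariance matrix of the whole vector `(Y, X)`. -/
def mStar : ℝ :=
  diagMax M.Sig + diagMax (M.Oyy⁻¹ * M.Oyx * M.Sxx * M.Oyxᵀ * M.Oyy⁻¹)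

end Model

/-- `c_{λ,μ}`. -/
def Tuning.cLamMu (T : Tuning) : ℝ :=
  max ((T.cl + 1) * T.dl / T.cl + T.el) ((T.cm + 1) * T.dm / T.cm + T.em)

/-- `ln (10 (p + q)²) - ln b₃`. -/
def logTerm (p q : ℕ) (b₃ : ℝ) : ℝ := Real.log (10 * ((p : ℝ) + q) ^ 2) - Real.log b₃

/-- The minimal number of observations `n₀`. -/
def Model.nZero {p q : ℕ} (M : Model p q) (T : Tuning) (R : Reg) (εS εL b₁ b₃ : ℝ) : ℝ :=
  max (logTerm p q b₃ * T.cLamMu ^ 2 * M.cardS * (16 * M.mStar) ^ 2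
      / (M.rStar ^ 2 * M.gam R εS εL ^ 2))
    (max (b₁ * (q + ⌈M.sAlpha T R⌉₊ * Real.log ((p : ℝ) + q))) (logTerm p q b₃))

/-- The upper bound of the estimation error. -/
def Model.errorBound {p q : ℕ} (M : Model p q) (T : Tuning) (R : Reg) (εS εL b₃ : ℝ) (n : ℕ) : ℝ :=
  16 * M.mStar * T.cLamMu * √(M.cardS) / M.gam R εS εL * √(logTerm p q b₃ / n)

/-- Sample covariance `(1/n) ∑ zᵢ zᵢᵗ` of the observations `zᵢ = (yᵢ, xᵢ)`; its blocks are
`S_yy`, `S_yx` and `S_xx`. -/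
def sampleCov {p q n : ℕ} (z : Fin n → EuclideanSpace ℝ (Fin q ⊕ Fin p)) :
    Matrix (Fin q ⊕ Fin p) (Fin q ⊕ Fin p) ℝ :=
  Matrix.of fun a b => (1 / (n : ℝ)) * ∑ i, z i a * z i b

end PGGM

end

/-!
The objective is convex, so it suffices to show that it exceeds its value at `θ*` on the part of
the domain where `‖θ - θ*‖_F` lies between the announced error bound and `r*`: along segments
issued from `θ*` this propagates outwards, and it confines the sublevel set to a bounded region, on
which a minimizer exists.

Let `θ* + Δ` be at such a distance. The entries of the gradient of the smooth part at `θ*` are at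
most `h_a + κ ℓ_a` and `h_b + κ ℓ_b`, so on the band `Λ` the penalties dominate the linear term off
the support `S` of `θ*`. Hence either the penalties alone make the objective increase, or `Δ`
belongs to the cone `|Δ|₁ ≤ (1 + α) |Δ_S|₁`. On this cone the smooth part is strongly convex with
constant `γ`: the log-determinant controls `Δ_yy`, and `Δ_yx` is controlled by the quadratic form of
`S_xx`, which is bounded below on the vectors that are nearly `s_α`-sparse. A linear term of order
`λ √|S| ‖Δ‖_F` cannot compensate `γ ‖Δ‖_F²` beyond the error bound.

The sample enters through three properties. The comparison of `S_xx` with `Σ*_xx` on the range of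
`Ω*_yxᵗ` and on all sparse coordinate subspaces follows from `χ²` tail bounds on a net of each of
these subspaces, and Maurey's empirical method extends the latter to all vectors, at the cost of an
`ℓ¹` term. The bounds of `h_a` and `h_b` are `χ²` tail bounds for each of the entries.
-/

namespace PGGM

open scoped MatrixOrder

/-! ### The Loewner order -/

section Loewner

variable {m n : Type*} [Fintype n] {A B : Matrix n n ℝ}

lemma conj_le_conj [Finite m] (h : A ≤ B) (X : Matrix m n ℝ) : X * A * Xᵀ ≤ X * B * Xᵀ := by
  have := (le_iff.1 h).mul_mul_conjTranspose_same X
  rwa [Matrix.mul_sub, Matrix.sub_mul, conjTranspose_eq_transpose_of_trivial] at this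

lemma posSemidef_conj [Finite m] (hA : A.PosSemidef) (X : Matrix m n ℝ) :
    (X * A * Xᵀ).PosSemidef := by
  simpa using hA.mul_mul_conjTranspose_same X

lemma posSemidef_conj' [Finite m] (hA : A.PosSemidef) (X : Matrix n m ℝ) :
    (Xᵀ * A * X).PosSemidef := by
  simpa using posSemidef_conj hA Xᵀ

lemma trace_mul_nonneg (hA : A.PosSemidef) (hB : B.PosSemidef) : 0 ≤ (A * B).trace := by
  classical
  obtain ⟨C, rfl⟩ := CStarAlgebra.nonneg_iff_eq_star_mul_self.1 hB.nonneg
  rw [← Matrix.mul_assoc, trace_mul_comm, ← Matrix.mul_assoc]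
  exact (hA.mul_mul_conjTranspose_same C).trace_nonneg

lemma trace_mul_le_trace_mul {C : Matrix n n ℝ} (h : A ≤ B) (hC : C.PosSemidef) :
    (A * C).trace ≤ (B * C).trace := by
  rw [← sub_nonneg, ← trace_sub, ← Matrix.sub_mul]
  exact trace_mul_nonneg h hC

lemma quad_nonneg (hA : A.PosSemidef) (x : n → ℝ) : 0 ≤ x ⬝ᵥ A *ᵥ x := by
  simpa using hA.dotProduct_mulVec_nonneg x

lemma quad_le_quad (h : A ≤ B) (x : n → ℝ) : x ⬝ᵥ A *ᵥ x ≤ x ⬝ᵥ B *ᵥ x := by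
  rw [← sub_nonneg, ← dotProduct_sub, ← sub_mulVec]
  exact quad_nonneg h x

lemma quad_smul_one [DecidableEq n] (c : ℝ) (x : n → ℝ) :
    x ⬝ᵥ (c • (1 : Matrix n n ℝ)) *ᵥ x = c * (x ⬝ᵥ x) := by
  rw [smul_mulVec, one_mulVec, dotProduct_smul, smul_eq_mul]

lemma inv_smul_one_le_inv [DecidableEq n] (hA : A.PosDef) {c : ℝ}
    (h : A ≤ c • (1 : Matrix n n ℝ)) : c⁻¹ • (1 : Matrix n n ℝ) ≤ A⁻¹ := by
  rw [← Algebra.algebraMap_eq_smul_one,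
    le_algebraMap_iff_spectrum_le (ha := hA.isHermitian)] at h
  rw [← Algebra.algebraMap_eq_smul_one,
    algebraMap_le_iff_le_spectrum (ha := hA.inv.isHermitian)]
  intro x hx
  have hx0 : 0 < x := by
    rw [hA.inv.isHermitian.spectrum_real_eq_range_eigenvalues] at hx
    obtain ⟨i, rfl⟩ := hx
    exact hA.inv.eigenvalues_pos i
  refine inv_le_of_inv_le₀ hx0 (h _ ?_)
  obtain ⟨u, rfl⟩ := hA.isUnit
  rwa [← coe_units_inv, ← inv_inv x, spectrum.inv₀_mem_inv_iff] at hx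

end Loewner

/-! ### Extreme eigenvalues -/

section Eigen

variable {d : ℕ} {A : Matrix (Fin d) (Fin d) ℝ}

lemma le_lamMax_smul_one (hA : A.IsHermitian) : A ≤ lamMax A • (1 : Matrix (Fin d) (Fin d) ℝ) := by
  rw [← Algebra.algebraMap_eq_smul_one, le_algebraMap_iff_spectrum_le (ha := hA)]
  exact fun x hx => le_csSup finite_real_spectrum.bddAbove hx

lemma lamMin_smul_one_le (hA : A.IsHermitian) : lamMin A • (1 : Matrix (Fin d) (Fin d) ℝ) ≤ A := by
  rw [← Algebra.algebraMap_eq_smul_one, algebraMap_le_iff_le_spectrum (ha := hA)]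
  exact fun x hx => csInf_le finite_real_spectrum.bddBelow hx

lemma quad_le_lamMax (hA : A.IsHermitian) (x : Fin d → ℝ) :
    x ⬝ᵥ A *ᵥ x ≤ lamMax A * (x ⬝ᵥ x) :=
  (quad_le_quad (le_lamMax_smul_one hA) x).trans_eq (quad_smul_one _ x)

lemma lamMin_le_quad (hA : A.IsHermitian) (x : Fin d → ℝ) :
    lamMin A * (x ⬝ᵥ x) ≤ x ⬝ᵥ A *ᵥ x :=
  (quad_smul_one _ x).symm.trans_le (quad_le_quad (lamMin_smul_one_le hA) x)

lemma diag_le_lamMax (hA : A.IsHermitian) (j : Fin d) : A j j ≤ lamMax A := by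
  simpa using quad_le_lamMax hA (Pi.single j 1)

lemma lamMin_le_diag (hA : A.IsHermitian) (j : Fin d) : lamMin A ≤ A j j := by
  simpa using lamMin_le_quad hA (Pi.single j 1)

lemma exists_lamMin_eq_eigenvalues (hA : A.IsHermitian) (hd : 0 < d) :
    ∃ i, hA.eigenvalues i = lamMin A := by
  have hne : (spectrum ℝ A).Nonempty := ⟨_, hA.eigenvalues_mem_spectrum_real ⟨0, hd⟩⟩
  have : lamMin A ∈ spectrum ℝ A := hne.csInf_mem finite_real_spectrum
  rwa [hA.spectrum_real_eq_range_eigenvalues] at this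

lemma lamMin_pos (hA : A.PosDef) (hd : 0 < d) : 0 < lamMin A := by
  obtain ⟨i, hi⟩ := exists_lamMin_eq_eigenvalues hA.isHermitian hd
  exact hi ▸ hA.eigenvalues_pos i

lemma lamMin_nonneg (hA : A.PosSemidef) : 0 ≤ lamMin A :=
  Real.sInf_nonneg fun _ hx => (posSemidef_iff_isHermitian_and_spectrum_nonneg.1 hA).2 hx

lemma lamMin_le_lamMax (hA : A.IsHermitian) (hd : 0 < d) : lamMin A ≤ lamMax A :=
  (lamMin_le_diag hA ⟨0, hd⟩).trans (diag_le_lamMax hA ⟨0, hd⟩)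

lemma lamMax_pos (hA : A.PosDef) (hd : 0 < d) : 0 < lamMax A :=
  (lamMin_pos hA hd).trans_le (lamMin_le_lamMax hA.isHermitian hd)

end Eigen

/-! ### Simultaneous diagonalization -/

section Diagonalization

variable {n : Type*} [Fintype n] [DecidableEq n]

/-- The invertible matrix `K` carries, by congruence, the identity to `A` and the diagonal matrix
of `ν` to `U`. The `ν i` are the eigenvalues of the symmetric matrix `U` relative to `A`. -/
structure SimulDiag (A U K : Matrix n n ℝ) (ν : n → ℝ) : Prop where
  isUnit : IsUnit K
  left_eq : A = Kᵀ * 1 * K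
  right_eq : U = Kᵀ * diagonal ν * K

lemma exists_isUnit_eq_transpose_mul_self {A : Matrix n n ℝ} (hA : A.PosDef) :
    ∃ C : Matrix n n ℝ, IsUnit C ∧ A = Cᵀ * C := by
  obtain ⟨C, hC⟩ := CStarAlgebra.nonneg_iff_eq_star_mul_self.1 hA.posSemidef.nonneg
  have hAu := hA.isUnit
  rw [hC] at hAu
  exact ⟨C, isUnit_of_mul_isUnit_right hAu,
    by rw [hC, star_eq_conjTranspose, conjTranspose_eq_transpose_of_trivial]⟩

lemma exists_orthogonal_diagonal {U : Matrix n n ℝ} (hU : U.IsHermitian) :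
    ∃ (O : Matrix n n ℝ) (ν : n → ℝ), O * Oᵀ = 1 ∧ U = O * diagonal ν * Oᵀ := by
  have hstar (O : Matrix n n ℝ) : star O = Oᵀ := by
    rw [star_eq_conjTranspose, conjTranspose_eq_transpose_of_trivial]
  refine ⟨hU.eigenvectorUnitary, hU.eigenvalues, ?_, ?_⟩
  · rw [← hstar]
    exact Unitary.coe_mul_star_self _
  · have := hU.spectral_theorem
    rw [Unitary.conjStarAlgAut_apply, hstar] at this
    exact this

lemma exists_simulDiag {A U : Matrix n n ℝ} (hA : A.PosDef) (hU : U.IsHermitian) :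
    ∃ K ν, SimulDiag A U K ν := by
  obtain ⟨C, hC, rfl⟩ := exists_isUnit_eq_transpose_mul_self hA
  have hCd := (isUnit_iff_isUnit_det C).1 hC
  have hN : ((C⁻¹)ᵀ * U * C⁻¹).IsHermitian := by
    simpa using isHermitian_conjTranspose_mul_mul C⁻¹ hU
  obtain ⟨O, ν, hO, hNO⟩ := exists_orthogonal_diagonal hN
  refine ⟨Oᵀ * C, ν, ?_, ?_, ?_⟩
  · exact (IsUnit.of_mul_eq_one O (mul_eq_one_comm.1 hO)).mul hC
  · rw [Matrix.mul_one, transpose_mul, transpose_transpose, Matrix.mul_assoc,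
      ← Matrix.mul_assoc O, hO, Matrix.one_mul]
  · have hinv : Cᵀ * (C⁻¹)ᵀ = 1 := by rw [← transpose_mul, nonsing_inv_mul _ hCd, transpose_one]
    calc U = (Cᵀ * (C⁻¹)ᵀ) * U * (C⁻¹ * C) := by
          rw [hinv, nonsing_inv_mul _ hCd, Matrix.one_mul, Matrix.mul_one]
      _ = Cᵀ * ((C⁻¹)ᵀ * U * C⁻¹) * C := by simp only [Matrix.mul_assoc]
      _ = (Oᵀ * C)ᵀ * diagonal ν * (Oᵀ * C) := by
          rw [hNO, transpose_mul, transpose_transpose]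
          simp only [Matrix.mul_assoc]

namespace SimulDiag

variable {A U K : Matrix n n ℝ} {ν : n → ℝ}

lemma add_eq (h : SimulDiag A U K ν) : A + U = Kᵀ * diagonal (fun i => 1 + ν i) * K := by
  rw [h.left_eq, h.right_eq, ← Matrix.add_mul, ← Matrix.mul_add, ← diagonal_one, diagonal_add]

lemma one_add_pos (h : SimulDiag A U K ν) (hAU : (A + U).PosDef) (i : n) : 0 < 1 + ν i := by
  rw [h.add_eq, ← conjTranspose_eq_transpose_of_trivial, ← star_eq_conjTranspose,
    h.isUnit.posDef_star_left_conjugate_iff, posDef_diagonal_iff] at hAU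
  exact hAU i

lemma le_of_smul_le (h : SimulDiag A U K ν) {c : ℝ} (hc : c • A ≤ U) (i : n) : c ≤ ν i := by
  have hsub : U - c • A = Kᵀ * diagonal (fun i => ν i - c) * K := by
    rw [h.left_eq, h.right_eq, ← Matrix.smul_mul, ← Matrix.mul_smul, ← Matrix.sub_mul,
      ← Matrix.mul_sub, smul_one_eq_diagonal, diagonal_sub]
  rw [le_iff, hsub, ← conjTranspose_eq_transpose_of_trivial, ← star_eq_conjTranspose,
    h.isUnit.posSemidef_star_left_conjugate_iff, posSemidef_diagonal_iff] at hc
  exact sub_nonneg.1 (hc i)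

lemma det_add (h : SimulDiag A U K ν) : (A + U).det = A.det * ∏ i, (1 + ν i) := by
  rw [h.add_eq, h.left_eq, det_mul, det_mul, det_mul, det_mul, det_diagonal, det_one]
  ring

lemma inv_mul_eq (h : SimulDiag A U K ν) : A⁻¹ * U = K⁻¹ * diagonal ν * K := by
  have hK : IsUnit (Kᵀ).det := by
    rw [det_transpose]; exact (isUnit_iff_isUnit_det K).1 h.isUnit
  rw [h.left_eq, h.right_eq, Matrix.mul_one, Matrix.mul_inv_rev, Matrix.mul_assoc, Matrix.mul_assoc,
    nonsing_inv_mul_cancel_left _ _ hK, ← Matrix.mul_assoc]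

lemma inv_add_mul_eq (h : SimulDiag A U K ν) (hAU : (A + U).PosDef) :
    (A + U)⁻¹ * U = K⁻¹ * diagonal (fun i => ν i / (1 + ν i)) * K := by
  have hdiag : diagonal ν = diagonal (fun i => 1 + ν i) * diagonal (fun i => ν i / (1 + ν i)) := by
    rw [diagonal_mul_diagonal]
    congr! 2 with i
    exact (mul_div_cancel₀ _ (h.one_add_pos hAU i).ne').symm
  have hU : U = (A + U) * (K⁻¹ * diagonal (fun i => ν i / (1 + ν i)) * K) := by
    rw [h.add_eq, h.right_eq, hdiag]
    simp only [Matrix.mul_assoc,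
      mul_nonsing_inv_cancel_left _ _ ((isUnit_iff_isUnit_det K).1 h.isUnit)]
  exact (congrArg _ hU).trans
    (nonsing_inv_mul_cancel_left _ _ ((isUnit_iff_isUnit_det _).1 hAU.isUnit))

lemma trace_inv_mul (h : SimulDiag A U K ν) : (A⁻¹ * U).trace = ∑ i, ν i := by
  rw [h.inv_mul_eq, trace_conj' h.isUnit, trace_diagonal]

lemma trace_inv_mul_mul_inv_add_mul (h : SimulDiag A U K ν) (hAU : (A + U).PosDef) :
    (A⁻¹ * U * ((A + U)⁻¹ * U)).trace = ∑ i, ν i ^ 2 / (1 + ν i) := by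
  have hKd := (isUnit_iff_isUnit_det K).1 h.isUnit
  have hprod : A⁻¹ * U * ((A + U)⁻¹ * U) = K⁻¹ * diagonal (fun i => ν i ^ 2 / (1 + ν i)) * K := by
    rw [h.inv_mul_eq, h.inv_add_mul_eq hAU]
    simp only [Matrix.mul_assoc, mul_nonsing_inv_cancel_left _ _ hKd]
    rw [← Matrix.mul_assoc (diagonal _), diagonal_mul_diagonal]
    congr! 4 with i
    ring
  rw [hprod, trace_conj' h.isUnit, trace_diagonal]

end SimulDiag

end Diagonalization

/-! ### The Frobenius inner product -/

section Frobenius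

variable {k l m : ℕ}

lemma frobInner_eq_sum (A B : Matrix (Fin k) (Fin l) ℝ) :
    frobInner A B = ∑ i, ∑ j, A i j * B i j := by
  rw [frobInner, trace, Finset.sum_comm]
  simp [mul_apply]

lemma frobInner_add_right (A B C : Matrix (Fin k) (Fin l) ℝ) :
    frobInner A (B + C) = frobInner A B + frobInner A C := by
  simp [frobInner, Matrix.mul_add]

lemma frobInner_sub_right (A B C : Matrix (Fin k) (Fin l) ℝ) :
    frobInner A (B - C) = frobInner A B - frobInner A C := by
  simp [frobInner, Matrix.mul_sub]

lemma frobInner_smul_right (c : ℝ) (A B : Matrix (Fin k) (Fin l) ℝ) :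
    frobInner A (c • B) = c * frobInner A B := by
  simp [frobInner]

lemma frobInner_add_left (A B C : Matrix (Fin k) (Fin l) ℝ) :
    frobInner (A + B) C = frobInner A C + frobInner B C := by
  simp [frobInner, Matrix.add_mul]

lemma frobInner_sub_left (A B C : Matrix (Fin k) (Fin l) ℝ) :
    frobInner (A - B) C = frobInner A C - frobInner B C := by
  simp [frobInner, Matrix.sub_mul]

lemma frobInner_smul_left (c : ℝ) (A B : Matrix (Fin k) (Fin l) ℝ) :
    frobInner (c • A) B = c * frobInner A B := by
  simp [frobInner]

lemma frobInner_transpose (A B : Matrix (Fin k) (Fin l) ℝ) :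
    frobInner Aᵀ Bᵀ = frobInner A B := by
  simp only [frobInner_eq_sum, transpose_apply]
  exact Finset.sum_comm

lemma frobInner_transpose_mul (S : Matrix (Fin l) (Fin m) ℝ) (X : Matrix (Fin k) (Fin l) ℝ)
    (V : Matrix (Fin k) (Fin m) ℝ) : frobInner S (Xᵀ * V) = frobInner (X * S) V := by
  rw [frobInner, frobInner, transpose_mul, Matrix.mul_assoc]

lemma frobInner_mul (S : Matrix (Fin l) (Fin m) ℝ) (V : Matrix (Fin l) (Fin k) ℝ)
    (X : Matrix (Fin k) (Fin m) ℝ) : frobInner S (V * X) = frobInner (S * Xᵀ) V := by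
  rw [frobInner, frobInner, transpose_mul, transpose_transpose, ← Matrix.mul_assoc, trace_mul_comm,
    Matrix.mul_assoc]

lemma frobInner_transpose_mul_comm {S : Matrix (Fin l) (Fin l) ℝ} (hS : S.IsSymm)
    (X Y : Matrix (Fin k) (Fin l) ℝ) : frobInner S (Yᵀ * X) = frobInner S (Xᵀ * Y) := by
  rw [← frobInner_transpose, transpose_mul, transpose_transpose, hS.eq]

variable {S : Matrix (Fin l) (Fin l) ℝ} {H : Matrix (Fin k) (Fin k) ℝ}

lemma frobInner_conj_nonneg (hS : S.PosSemidef) (hH : H.PosSemidef)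
    (X : Matrix (Fin k) (Fin l) ℝ) : 0 ≤ frobInner S (Xᵀ * H * X) :=
  trace_mul_nonneg hS.transpose (posSemidef_conj' hH X)

lemma frobInner_conj_smul_sub_smul (hS : S.IsSymm) (hH : H.IsSymm) (a b : ℝ)
    (X Y : Matrix (Fin k) (Fin l) ℝ) :
    frobInner S ((a • X - b • Y)ᵀ * H * (a • X - b • Y)) =
      a ^ 2 * frobInner S (Xᵀ * H * X) - 2 * a * b * frobInner S (Xᵀ * H * Y)
        + b ^ 2 * frobInner S (Yᵀ * H * Y) := by
  have hcomm : frobInner S (Yᵀ * H * X) = frobInner S (Xᵀ * H * Y) := by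
    rw [Matrix.mul_assoc, Matrix.mul_assoc, ← frobInner_transpose, transpose_mul, transpose_mul,
      transpose_transpose, hS.eq, hH.eq, Matrix.mul_assoc]
  simp only [transpose_sub, transpose_smul, Matrix.sub_mul, Matrix.mul_sub, Matrix.smul_mul,
    Matrix.mul_smul, frobInner_sub_right, frobInner_smul_right, hcomm]
  ring

lemma young_frobInner_conj (hS : S.PosSemidef) (hH : H.PosSemidef)
    (V Y : Matrix (Fin k) (Fin l) ℝ) {ε : ℝ} (hε : 0 < ε) :
    (2 * ε / (2 + ε) * frobInner S (Vᵀ * H * V) - ε * frobInner S (Yᵀ * H * Y)) / 2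
      ≤ frobInner S ((V - Y)ᵀ * H * (V - Y)) := by
  have hS' := isHermitian_iff_isSymm.1 hS.isHermitian
  have hH' := isHermitian_iff_isSymm.1 hH.isHermitian
  -- The difference of the two sides is the form at `2 V - (2 + ε) Y`, up to a positive factor.
  have hnonneg := frobInner_conj_nonneg hS hH ((2 : ℝ) • V - (2 + ε) • Y)
  have hdiff := frobInner_conj_smul_sub_smul hS' hH' 1 1 V Y
  rw [frobInner_conj_smul_sub_smul hS' hH'] at hnonneg
  simp only [one_smul] at hdiff
  rw [hdiff, ← sub_nonneg]
  refine (div_nonneg hnonneg (by positivity : 0 ≤ 2 * (2 + ε))).trans_eq ?_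
  field_simp
  ring

end Frobenius

/-! ### The matrix fractional function -/

section MatFrac

variable {p q : ℕ} {S : Matrix (Fin p) (Fin p) ℝ} {θ Δ : Param p q}

/-- The matrix fractional function `⟪S, Bᵗ A⁻¹ B⟫` of `θ = (A, B)`, common to the likelihood
(`S = S_xx`) and to the structural penalty (`S = L`). -/
noncomputable def matFrac (S : Matrix (Fin p) (Fin p) ℝ) (θ : Param p q) : ℝ :=
  frobInner S (θ.2ᵀ * θ.1⁻¹ * θ.2)

/-- The differential of `matFrac S` at `θ`, in the direction `Δ`. -/
noncomputable def matFracDeriv (S : Matrix (Fin p) (Fin p) ℝ) (θ Δ : Param p q) : ℝ :=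
  2 * frobInner (θ.1⁻¹ * θ.2 * S) Δ.2 - frobInner (θ.1⁻¹ * θ.2 * S * θ.2ᵀ * θ.1⁻¹) Δ.1

/-- The Bregman divergence of `matFrac S` between `θ + Δ` and `θ`. -/
noncomputable def matFracRem (S : Matrix (Fin p) (Fin p) ℝ) (θ Δ : Param p q) : ℝ :=
  frobInner S ((Δ.2 - Δ.1 * θ.1⁻¹ * θ.2)ᵀ * (θ.1 + Δ.1)⁻¹ * (Δ.2 - Δ.1 * θ.1⁻¹ * θ.2))

lemma transpose_mul_inv_mul_add {G : Matrix (Fin q) (Fin q) ℝ} (hG : G.PosDef)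
    (X W : Matrix (Fin q) (Fin p) ℝ) :
    (G * X + W)ᵀ * G⁻¹ * (G * X + W)
      = Xᵀ * G * X + Xᵀ * W + Wᵀ * X + Wᵀ * G⁻¹ * W := by
  have hGd := (isUnit_iff_isUnit_det G).1 hG.isUnit
  rw [transpose_add, transpose_mul, isHermitian_iff_isSymm.1 hG.isHermitian]
  simp only [Matrix.add_mul, Matrix.mul_add, Matrix.mul_assoc, mul_nonsing_inv_cancel_left _ _ hGd,
    nonsing_inv_mul_cancel_left _ _ hGd]
  abel

lemma matFrac_add (hS : S.IsSymm) (h : θ.1.PosDef) (h' : (θ.1 + Δ.1).PosDef) :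
    matFrac S (θ + Δ) = matFrac S θ + matFracDeriv S θ Δ + matFracRem S θ Δ := by
  have hd := (isUnit_iff_isUnit_det θ.1).1 h.isUnit
  have hinvt : (θ.1⁻¹)ᵀ = θ.1⁻¹ := isHermitian_iff_isSymm.1 h.inv.isHermitian
  set X := θ.1⁻¹ * θ.2 with hX
  set W := Δ.2 - Δ.1 * X with hW
  have hcancel : θ.1 * X = θ.2 := mul_nonsing_inv_cancel_left _ _ hd
  have hsplit : (θ + Δ).2 = (θ.1 + Δ.1) * X + W := by
    rw [Prod.snd_add, Matrix.add_mul, hcancel, hW]; abel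
  have hfrac : matFrac S θ = frobInner S (Xᵀ * θ.1 * X) := by
    rw [matFrac, Matrix.mul_assoc Xᵀ, hcancel, Matrix.mul_assoc, ← hX,
      frobInner_transpose_mul_comm hS]
  have hcross : frobInner S (Xᵀ * Δ.1 * X) = frobInner (X * S * θ.2ᵀ * θ.1⁻¹) Δ.1 := by
    rw [Matrix.mul_assoc, frobInner_transpose_mul, frobInner_mul (X * S), hX, transpose_mul, hinvt,
      ← Matrix.mul_assoc (_ * S)]
  have hderiv : matFracDeriv S θ Δ = 2 * frobInner S (Xᵀ * Δ.2) - frobInner S (Xᵀ * Δ.1 * X) := by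
    rw [matFracDeriv, hcross, frobInner_transpose_mul]
  have hrem : matFracRem S θ Δ = frobInner S (Wᵀ * (θ.1 + Δ.1)⁻¹ * W) := by
    rw [matFracRem, Matrix.mul_assoc Δ.1, ← hX]
  rw [matFrac, hsplit, Prod.fst_add, transpose_mul_inv_mul_add h', frobInner_add_right,
    frobInner_add_right, frobInner_add_right, frobInner_transpose_mul_comm hS X W, hfrac, hderiv,
    hrem, hW, Matrix.mul_add, Matrix.add_mul, frobInner_add_right, Matrix.mul_sub Xᵀ,
    ← Matrix.mul_assoc Xᵀ, frobInner_sub_right]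
  ring

lemma matFrac_nonneg (hS : S.PosSemidef) (h : θ.1.PosDef) : 0 ≤ matFrac S θ :=
  frobInner_conj_nonneg hS h.inv.posSemidef _

lemma matFracRem_nonneg (hS : S.PosSemidef) (h : (θ.1 + Δ.1).PosDef) : 0 ≤ matFracRem S θ Δ :=
  frobInner_conj_nonneg hS h.inv.posSemidef _

lemma matFracDeriv_smul (c : ℝ) : matFracDeriv S θ (c • Δ) = c * matFracDeriv S θ Δ := by
  rw [matFracDeriv, matFracDeriv, Prod.smul_fst, Prod.smul_snd, frobInner_smul_right,
    frobInner_smul_right]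
  ring

end MatFrac

/-! ### The log-determinant -/

lemma log_le_half_sub_inv {t : ℝ} (ht : 1 ≤ t) : Real.log t ≤ (t - t⁻¹) / 2 := by
  have h := Real.self_le_sinh_iff.2 (Real.log_nonneg ht)
  rwa [Real.sinh_log (by linarith)] at h

lemma log_one_add_le_of_nonpos {x : ℝ} (hx : -1 < x) (hx0 : x ≤ 0) :
    Real.log (1 + x) ≤ 2 * x / (2 + x) := by
  have hpos : 0 < 1 + x := by linarith
  have h := Real.le_log_one_add_of_nonneg (x := (1 + x)⁻¹ - 1)
    (sub_nonneg.2 ((one_le_inv₀ hpos).2 (by linarith)))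
  have heq : 2 * ((1 + x)⁻¹ - 1) / ((1 + x)⁻¹ - 1 + 2) = -(2 * x / (2 + x)) := by
    have h2 : 0 < 2 + x := by linarith
    rw [show (1 + x)⁻¹ - 1 + 2 = (2 + x) / (1 + x) by field_simp; ring]
    field_simp
    ring
  rw [add_sub_cancel, Real.log_inv, heq] at h
  exact neg_le_neg_iff.1 h

lemma sq_div_one_add_le_sub_log {x : ℝ} (hx : -(1 / 2) ≤ x) :
    x ^ 2 / (1 + x) / 3 ≤ x - Real.log (1 + x) := by
  have hpos : 0 < 1 + x := by linarith
  rcases le_total 0 x with h0 | h0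
  · have hlog := log_le_half_sub_inv (t := 1 + x) (by linarith)
    have hgap : x - ((1 + x) - (1 + x)⁻¹) / 2 - x ^ 2 / (1 + x) / 3 = x ^ 2 / (6 * (1 + x)) := by
      field_simp; ring
    have : 0 ≤ x ^ 2 / (6 * (1 + x)) := by positivity
    linarith
  · have hlog := log_one_add_le_of_nonpos (by linarith : -1 < x) h0
    have h2 : 0 < 2 + x := by linarith
    have hgap : x - 2 * x / (2 + x) - x ^ 2 / (1 + x) / 3
        = x ^ 2 * (1 + 2 * x) / (3 * (1 + x) * (2 + x)) := by
      field_simp; ring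
    have h3 : 0 ≤ 1 + 2 * x := by linarith
    have : 0 ≤ x ^ 2 * (1 + 2 * x) / (3 * (1 + x) * (2 + x)) := by positivity
    linarith

section LogDet

variable {n : Type*} [Fintype n] [DecidableEq n] {A U : Matrix n n ℝ}

/-- The Bregman divergence of `-log det` between `A + U` and `A`. -/
noncomputable def logDetRem (A U : Matrix n n ℝ) : ℝ :=
  -Real.log (A + U).det + Real.log A.det + (A⁻¹ * U).trace

lemma SimulDiag.logDetRem_eq {K : Matrix n n ℝ} {ν : n → ℝ} (h : SimulDiag A U K ν)
    (hA : A.PosDef) (hAU : (A + U).PosDef) :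
    logDetRem A U = ∑ i, (ν i - Real.log (1 + ν i)) := by
  have hne i := (h.one_add_pos hAU i).ne'
  rw [logDetRem, h.det_add, h.trace_inv_mul, Finset.sum_sub_distrib,
    Real.log_mul hA.det_pos.ne' (Finset.prod_ne_zero_iff.2 fun i _ => hne i),
    Real.log_prod fun i _ => hne i]
  ring

lemma logDetRem_nonneg (hA : A.PosDef) (hAU : (A + U).PosDef) : 0 ≤ logDetRem A U := by
  have hU : U.IsHermitian := by simpa using hAU.1.sub hA.1
  obtain ⟨K, ν, h⟩ := exists_simulDiag hA hU
  rw [h.logDetRem_eq hA hAU]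
  refine Finset.sum_nonneg fun i _ => ?_
  linarith [Real.log_le_sub_one_of_pos (h.one_add_pos hAU i)]

/-- The trace of `A⁻¹ U (A + U)⁻¹ U`, which measures the square of `U` relatively to `A` and
`A + U`. -/
noncomputable def relTraceSq (A U : Matrix n n ℝ) : ℝ := (A⁻¹ * U * ((A + U)⁻¹ * U)).trace

lemma relTraceSq_div_three_le_logDetRem (hA : A.PosDef) (hAU : (A + U).PosDef)
    (hU : (-(1 / 2) : ℝ) • A ≤ U) : relTraceSq A U / 3 ≤ logDetRem A U := by
  have hUh : U.IsHermitian := by simpa using hAU.1.sub hA.1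
  obtain ⟨K, ν, h⟩ := exists_simulDiag hA hUh
  rw [relTraceSq, h.logDetRem_eq hA hAU, h.trace_inv_mul_mul_inv_add_mul hAU, Finset.sum_div]
  exact Finset.sum_le_sum fun i _ => sq_div_one_add_le_sub_log (h.le_of_smul_le hU i)

end LogDet

/-! ### Elementwise norms -/

section Norms

variable {k l : ℕ}

lemma abs_le_maxNorm (A : Matrix (Fin k) (Fin l) ℝ) (i : Fin k) (j : Fin l) :
    |A i j| ≤ maxNorm A :=
  le_ciSup (f := fun ij : Fin k × Fin l => |A ij.1 ij.2|) (Set.finite_range _).bddAbove (i, j)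

lemma maxNorm_nonneg (A : Matrix (Fin k) (Fin l) ℝ) : 0 ≤ maxNorm A :=
  Real.iSup_nonneg fun _ => abs_nonneg _

lemma maxNorm_le {A : Matrix (Fin k) (Fin l) ℝ} {c : ℝ} (hc : 0 ≤ c) (h : ∀ i j, |A i j| ≤ c) :
    maxNorm A ≤ c :=
  Real.iSup_le (fun ij => h ij.1 ij.2) hc

lemma abs_le_diagMax {ι : Type*} [Finite ι] (A : Matrix ι ι ℝ) (i : ι) : |A i i| ≤ diagMax A :=
  le_ciSup (f := fun i => |A i i|) (Set.finite_range _).bddAbove i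

lemma diagMax_nonneg {ι : Type*} (A : Matrix ι ι ℝ) : 0 ≤ diagMax A :=
  Real.iSup_nonneg fun _ => abs_nonneg _

lemma abs_frobInner_le (A B : Matrix (Fin k) (Fin l) ℝ) :
    |frobInner A B| ≤ maxNorm A * l1Norm B := by
  simp only [frobInner_eq_sum, l1Norm, Finset.mul_sum, ← Fintype.sum_prod_type']
  refine (Finset.abs_sum_le_sum_abs _ _).trans (Finset.sum_le_sum fun x _ => ?_)
  rw [abs_mul]
  exact mul_le_mul_of_nonneg_right (abs_le_maxNorm A x.1 x.2) (abs_nonneg _)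

lemma frobInner_self_nonneg (A : Matrix (Fin k) (Fin l) ℝ) : 0 ≤ frobInner A A := by
  rw [frobInner_eq_sum]
  exact Finset.sum_nonneg fun i _ => Finset.sum_nonneg fun j _ => mul_self_nonneg _

end Norms

/-! ### Parameters as families of entries -/

/-- The positions of the entries of a parameter, seen as a `q × (q + p)` matrix. -/
abbrev Index (p q : ℕ) : Type := (Fin q × Fin q) ⊕ (Fin q × Fin p)

section Entries

variable {p q : ℕ}

/-- The entries of a parameter, as a vector. -/
def entry (θ : Param p q) : Index p q → ℝ :=
  Sum.elim (fun ij => θ.1 ij.1 ij.2) fun ij => θ.2 ij.1 ij.2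

lemma entry_add (θ θ' : Param p q) : entry (θ + θ') = entry θ + entry θ' := by
  ext (x | x) <;> rfl

lemma entry_smul (c : ℝ) (θ : Param p q) : entry (c • θ) = c • entry θ := by
  ext (x | x) <;> rfl

/-- The squared Frobenius norm of a parameter. -/
noncomputable def normSq (Δ : Param p q) : ℝ := frobInner Δ.1 Δ.1 + frobInner Δ.2 Δ.2

lemma normSq_eq_sum (Δ : Param p q) : normSq Δ = ∑ x, entry Δ x ^ 2 := by
  simp [normSq, frobInner_eq_sum, entry, Fintype.sum_prod_type, sq]

lemma normSq_nonneg (Δ : Param p q) : 0 ≤ normSq Δ :=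
  add_nonneg (frobInner_self_nonneg _) (frobInner_self_nonneg _)

lemma normSq_smul (c : ℝ) (Δ : Param p q) : normSq (c • Δ) = c ^ 2 * normSq Δ := by
  simp only [normSq, Prod.smul_fst, Prod.smul_snd, frobInner_smul_left, frobInner_smul_right]
  ring

lemma frobDist_eq (θ θ' : Param p q) : frobDist θ θ' = √(normSq (θ - θ')) := by
  simp [frobDist, normSq, frobInner_eq_sum, sq]

end Entries

namespace Model

variable {p q : ℕ} (M : Model p q) (Δ : Param p q)

open Classical in
/-- The support of `θ*`. -/
noncomputable def supp : Finset (Index p q) := {x | entry M.theta x ≠ 0}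

lemma mem_supp {x : Index p q} : x ∈ M.supp ↔ entry M.theta x ≠ 0 := by
  simp [supp]

lemma cardS_eq_card_supp : M.cardS = M.supp.card := by
  classical
  have hncard {α : Type} [Fintype α] (P : α → Prop) :
      {x | P x}.ncard = ({x | P x} : Finset α).card := by
    rw [← Set.ncard_coe_finset, Finset.coe_filter_univ]
  rw [cardS, hncard, hncard, ← Finset.card_disjSum]
  congr 1
  ext (x | x) <;> simp [mem_supp, entry, theta]

/-- The `ℓ¹` norm on the support of `θ*`. -/
noncomputable def l1On : ℝ := ∑ x ∈ M.supp, |entry Δ x|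

/-- The `ℓ¹` norm off the support of `θ*`. -/
noncomputable def l1Compl : ℝ := ∑ x ∈ M.suppᶜ, |entry Δ x|

lemma l1On_nonneg : 0 ≤ M.l1On Δ :=
  Finset.sum_nonneg fun _ _ => abs_nonneg _

lemma l1Compl_nonneg : 0 ≤ M.l1Compl Δ :=
  Finset.sum_nonneg fun _ _ => abs_nonneg _

lemma l1On_add_l1Compl : M.l1On Δ + M.l1Compl Δ = ∑ x, |entry Δ x| :=
  Finset.sum_add_sum_compl _ _

lemma l1On_sq_le : M.l1On Δ ^ 2 ≤ M.cardS * normSq Δ := by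
  rw [l1On, M.cardS_eq_card_supp, normSq_eq_sum]
  refine sq_sum_le_card_mul_sum_sq.trans (mul_le_mul_of_nonneg_left ?_ (Nat.cast_nonneg _))
  simp only [sq_abs]
  exact Finset.sum_le_univ_sum_of_nonneg fun _ => sq_nonneg _

end Model

/-! ### Convexity of the objective -/

lemma rpow_add_mul_sub_le_rpow {x y β : ℝ} (hx : 0 ≤ x) (hy : 0 ≤ y) (hβ : 1 ≤ β) :
    y ^ β + β * y ^ (β - 1) * (x - y) ≤ x ^ β := by
  rcases hy.eq_or_lt with rfl | hy
  · rw [Real.zero_rpow (by linarith)]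
    rcases hβ.eq_or_lt with rfl | hβ
    · simp
    · rw [Real.zero_rpow (by linarith)]
      simpa using Real.rpow_nonneg hx β
  · have hdiv : 0 ≤ x / y := by positivity
    have h := one_add_mul_self_le_rpow_one_add (s := x / y - 1) (by linarith) hβ
    rw [add_sub_cancel, Real.div_rpow hx hy.le, le_div_iff₀ (Real.rpow_pos_of_pos hy _)] at h
    refine le_of_eq_of_le ?_ h
    rw [Real.rpow_sub_one hy.ne']
    field_simp

lemma convexOn_of_subgradient {E : Type*} [AddCommGroup E] [Module ℝ E] {s : Set E} {f : E → ℝ}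
    {D : E → E → ℝ} (hs : Convex ℝ s) (hD : ∀ (c : ℝ) x v, D x (c • v) = c * D x v)
    (hf : ∀ x ∈ s, ∀ v, x + v ∈ s → f x + D x v ≤ f (x + v)) : ConvexOn ℝ s f := by
  refine ⟨hs, fun x hx y hy a b ha hb hab => ?_⟩
  obtain rfl : b = 1 - a := by linarith
  set z := a • x + (1 - a) • y with hz
  have hzx : z + (1 - a) • (x - y) = x := by rw [hz]; module
  have hzy : z + (-a) • (x - y) = y := by rw [hz]; module
  have hx' := hf z (hs hx hy ha hb hab) ((1 - a) • (x - y)) (by rwa [hzx])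
  have hy' := hf z (hs hx hy ha hb hab) ((-a) • (x - y)) (by rwa [hzy])
  rw [hzx, hD] at hx'
  rw [hzy, hD] at hy'
  have := mul_le_mul_of_nonneg_left hx' ha
  have := mul_le_mul_of_nonneg_left hy' hb
  simp only [smul_eq_mul]
  linarith

lemma convex_setOf_posDef {n : Type*} : Convex ℝ {A : Matrix n n ℝ | A.PosDef} := by
  intro A hA B hB a b ha hb hab
  rcases ha.eq_or_lt with rfl | ha
  · obtain rfl : b = 1 := by linarith
    simpa using hB
  · exact (PosDef.smul hA ha).add_posSemidef (PosSemidef.smul (PosDef.posSemidef hB) hb)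

/-- The weights of the entries in the `ℓ¹` penalty of the objective. -/
def penWeight {p q : ℕ} (R : Reg) : Index p q → ℝ :=
  Sum.elim (fun ij => if ij.1 = ij.2 then 0 else R.lam) fun _ => R.mu

lemma penWeight_nonneg {p q : ℕ} {R : Reg} (hlam : 0 ≤ R.lam) (hmu : 0 ≤ R.mu) (x : Index p q) :
    0 ≤ penWeight R x := by
  rcases x with x | _
  · simp only [penWeight, Sum.elim_inl]
    split_ifs <;> simp [hlam]
  · exact hmu

namespace Model

variable {p q : ℕ} {M : Model p q} {R : Reg}
  {S : Matrix (Fin q ⊕ Fin p) (Fin q ⊕ Fin p) ℝ} {θ Δ : Param p q}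

/-- The objective without its `ℓ¹` penalties. -/
noncomputable def smoothPart (M : Model p q) (R : Reg)
    (S : Matrix (Fin q ⊕ Fin p) (Fin q ⊕ Fin p) ℝ) (θ : Param p q) : ℝ :=
  -Real.log θ.1.det + frobInner S.toBlocks₁₁ θ.1 + 2 * frobInner S.toBlocks₁₂ θ.2
    + matFrac S.toBlocks₂₂ θ + R.eta * matFrac M.L θ ^ M.β

/-- The differential of `smoothPart` at `θ`, in the direction `Δ`. -/
noncomputable def smoothDeriv (M : Model p q) (R : Reg)
    (S : Matrix (Fin q ⊕ Fin p) (Fin q ⊕ Fin p) ℝ) (θ Δ : Param p q) : ℝ :=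
  -(θ.1⁻¹ * Δ.1).trace + frobInner S.toBlocks₁₁ Δ.1 + 2 * frobInner S.toBlocks₁₂ Δ.2
    + matFracDeriv S.toBlocks₂₂ θ Δ
    + R.eta * (M.β * matFrac M.L θ ^ (M.β - 1)) * matFracDeriv M.L θ Δ

/-- A lower bound for the Bregman divergence of `smoothPart` between `θ + Δ` and `θ`: the term
coming from the convexity of `x ↦ x ^ β` is left out. -/
noncomputable def smoothRem (M : Model p q) (R : Reg)
    (S : Matrix (Fin q ⊕ Fin p) (Fin q ⊕ Fin p) ℝ) (θ Δ : Param p q) : ℝ :=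
  logDetRem θ.1 Δ.1 + matFracRem S.toBlocks₂₂ θ Δ
    + R.eta * (M.β * matFrac M.L θ ^ (M.β - 1)) * matFracRem M.L θ Δ

lemma objective_eq_smoothPart_add : M.objective R S θ =
    M.smoothPart R S θ + ∑ x, penWeight R x * |entry θ x| := by
  have hoff : R.lam * l1NormOff θ.1 =
      ∑ ij : Fin q × Fin q, (if ij.1 = ij.2 then 0 else R.lam) * |θ.1 ij.1 ij.2| := by
    simp only [l1NormOff, Finset.mul_sum, Fintype.sum_prod_type, mul_ite, ite_mul, mul_zero,
      zero_mul]
  have hl1 : R.mu * l1Norm θ.2 = ∑ ij : Fin q × Fin p, R.mu * |θ.2 ij.1 ij.2| := by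
    simp only [l1Norm, Finset.mul_sum, Fintype.sum_prod_type]
  simp only [Fintype.sum_sum_type, penWeight, entry, Sum.elim_inl, Sum.elim_inr]
  rw [objective, smoothPart, matFrac, matFrac, hoff, hl1]
  ring

lemma smoothDeriv_smul (c : ℝ) (θ Δ : Param p q) :
    M.smoothDeriv R S θ (c • Δ) = c * M.smoothDeriv R S θ Δ := by
  rw [smoothDeriv, smoothDeriv, matFracDeriv_smul, matFracDeriv_smul, Prod.smul_fst,
    Prod.smul_snd, frobInner_smul_right, frobInner_smul_right, Matrix.mul_smul, trace_smul,
    smul_eq_mul]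
  ring

lemma le_smoothPart_add (hS : S.toBlocks₂₂.PosSemidef) (hL : M.L.PosSemidef) (hβ : 1 ≤ M.β)
    (hη : 0 ≤ R.eta) (h : θ.1.PosDef) (h' : (θ.1 + Δ.1).PosDef) :
    M.smoothPart R S θ + M.smoothDeriv R S θ Δ + M.smoothRem R S θ Δ
      ≤ M.smoothPart R S (θ + Δ) := by
  have hLadd := matFrac_add (isHermitian_iff_isSymm.1 hL.isHermitian) h h'
  have htangent := mul_le_mul_of_nonneg_left
    (rpow_add_mul_sub_le_rpow (matFrac_nonneg (θ := θ + Δ) hL h') (matFrac_nonneg hL h) hβ) hη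
  rw [smoothPart, smoothPart, smoothDeriv, smoothRem, logDetRem,
    matFrac_add (isHermitian_iff_isSymm.1 hS.isHermitian) h h', Prod.fst_add, Prod.snd_add,
    frobInner_add_right, frobInner_add_right]
  rw [hLadd] at htangent ⊢
  linarith

lemma smoothRem_nonneg (hS : S.toBlocks₂₂.PosSemidef) (hL : M.L.PosSemidef) (hβ : 1 ≤ M.β)
    (hη : 0 ≤ R.eta) (h : θ.1.PosDef) (h' : (θ.1 + Δ.1).PosDef) : 0 ≤ M.smoothRem R S θ Δ := by
  have := logDetRem_nonneg h h'
  have := matFracRem_nonneg (θ := θ) hS h'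
  have := matFracRem_nonneg (θ := θ) hL h'
  have := matFrac_nonneg hL h
  rw [smoothRem]
  positivity

lemma convexOn_objective (hS : S.toBlocks₂₂.PosSemidef) (hL : M.L.PosSemidef) (hβ : 1 ≤ M.β)
    (hlam : 0 ≤ R.lam) (hmu : 0 ≤ R.mu) (hη : 0 ≤ R.eta) :
    ConvexOn ℝ {θ : Param p q | θ.1.PosDef} (M.objective R S) := by
  have hconv : Convex ℝ {θ : Param p q | θ.1.PosDef} :=
    convex_setOf_posDef.linear_preimage (LinearMap.fst ℝ _ _)
  have hsmooth : ConvexOn ℝ {θ : Param p q | θ.1.PosDef} (M.smoothPart R S) :=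
    convexOn_of_subgradient hconv smoothDeriv_smul fun θ hθ Δ hΔ => by
      linarith [le_smoothPart_add hS hL hβ hη hθ hΔ, smoothRem_nonneg hS hL hβ hη hθ hΔ]
  have hpen : ConvexOn ℝ {θ : Param p q | θ.1.PosDef}
      fun θ => ∑ x, penWeight R x * |entry θ x| := by
    refine ⟨hconv, fun θ _ θ' _ a b ha hb _ => ?_⟩
    simp only [smul_eq_mul, Finset.mul_sum, ← Finset.sum_add_distrib, entry_add, entry_smul,
      Pi.add_apply, Pi.smul_apply]
    refine Finset.sum_le_sum fun x _ => ?_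
    have habs := abs_add_le (a * entry θ x) (b * entry θ' x)
    rw [abs_mul, abs_mul, abs_of_nonneg ha, abs_of_nonneg hb] at habs
    have := mul_le_mul_of_nonneg_left habs (penWeight_nonneg hlam hmu x)
    linarith
  refine (hsmooth.add hpen).congr fun θ _ => ?_
  exact objective_eq_smoothPart_add.symm

end Model

/-! ### The score and the penalties at the true parameter -/

/-- Decomposability of the weighted `ℓ¹` norm: the increment of the penalty from a vector `a`
supported in `s`, minus a bound `g` on the entries of the gradient. -/
lemma mul_sum_compl_sub_le_sum_weight {ι : Type*} [Fintype ι] [DecidableEq ι] {s : Finset ι}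
    {a w g : ι → ℝ} {c C : ℝ} (ha : ∀ x ∉ s, a x = 0) (hw : ∀ x, 0 ≤ w x)
    (hon : ∀ x ∈ s, w x + g x ≤ C) (hoff : ∀ x ∉ s, c ≤ w x - g x) (u : ι → ℝ) :
    c * ∑ x ∈ sᶜ, |u x| - C * ∑ x ∈ s, |u x|
      ≤ ∑ x, w x * |a x + u x| - ∑ x, w x * |a x| - ∑ x, g x * |u x| := by
  simp only [← Finset.sum_sub_distrib]
  rw [Finset.mul_sum, Finset.mul_sum, ← Finset.sum_compl_add_sum s, sub_eq_add_neg,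
    ← Finset.sum_neg_distrib]
  refine add_le_add (Finset.sum_le_sum fun x hx => ?_) (Finset.sum_le_sum fun x hx => ?_)
  · have hxs := Finset.mem_compl.1 hx
    have := mul_le_mul_of_nonneg_right (hoff x hxs) (abs_nonneg (u x))
    rw [ha x hxs, zero_add, abs_zero]
    linarith
  · have htri := abs_sub_abs_le_abs_sub (a x) (a x + u x)
    rw [sub_add_cancel_left, abs_neg] at htri
    have := mul_le_mul_of_nonneg_left htri (hw x)
    have := mul_le_mul_of_nonneg_right (hon x hx) (abs_nonneg (u x))
    linarith

namespace Model

variable {p q : ℕ} {M : Model p q} {T : Tuning} {R : Reg}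
  {S : Matrix (Fin q ⊕ Fin p) (Fin q ⊕ Fin p) ℝ} {Δ : Param p q}

lemma H1.q_pos (h : M.H1) : 0 < q :=
  Nat.pos_of_ne_zero fun hq => h.Oyx_ne_zero (Matrix.ext fun i => (hq ▸ i).elim0)

lemma H1.p_pos (h : M.H1) : 0 < p :=
  Nat.pos_of_ne_zero fun hp => h.Oyx_ne_zero (Matrix.ext fun _ j => (hp ▸ j).elim0)

lemma precision_mul_covariance (hSig : M.Sig.PosDef) :
    M.Oyy * M.Syy + M.Oyx * M.Syxᵀ = 1 ∧ M.Oyy * M.Syx + M.Oyx * M.Sxx = 0 := by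
  have h21 : M.Sig.toBlocks₂₁ = M.Syxᵀ := by
    ext i j
    exact (hSig.isHermitian.apply (Sum.inr i) (Sum.inl j)).symm
  have hmul : fromBlocks M.Oyy M.Oyx M.Sig⁻¹.toBlocks₂₁ M.Sig⁻¹.toBlocks₂₂
      * fromBlocks M.Syy M.Syx M.Syxᵀ M.Sxx = 1 := by
    rw [← h21]
    exact (congrArg₂ (· * ·) (fromBlocks_toBlocks _) (fromBlocks_toBlocks _)).trans
      (nonsing_inv_mul _ ((isUnit_iff_isUnit_det _).1 hSig.isUnit))
  rw [fromBlocks_multiply, ← fromBlocks_one, fromBlocks_inj] at hmul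
  exact ⟨hmul.1, hmul.2.1⟩

lemma Sxx_isHermitian (hSig : M.Sig.IsHermitian) : M.Sxx.IsHermitian := by
  ext i j
  exact hSig.apply (Sum.inr i) (Sum.inr j)

lemma Syx_eq (hSig : M.Sig.PosDef) (h : M.Oyy.PosDef) : M.Syx = -(M.Oyy⁻¹ * M.Oyx * M.Sxx) := by
  have hd : IsUnit M.Oyy.det := (isUnit_iff_isUnit_det _).1 h.isUnit
  rw [← nonsing_inv_mul_cancel_left _ M.Syx hd,
    eq_neg_of_add_eq_zero_left (precision_mul_covariance hSig).2, Matrix.mul_neg, Matrix.mul_assoc]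

lemma Syy_eq (hSig : M.Sig.PosDef) (h : M.Oyy.PosDef) :
    M.Syy = M.Oyy⁻¹ + M.Oyy⁻¹ * M.Oyx * M.Sxx * M.Oyxᵀ * M.Oyy⁻¹ := by
  have hd : IsUnit M.Oyy.det := (isUnit_iff_isUnit_det _).1 h.isUnit
  have hSyxt : M.Syxᵀ = -(M.Sxx * M.Oyxᵀ * M.Oyy⁻¹) := by
    rw [Syx_eq hSig h, transpose_neg, transpose_mul, transpose_mul,
      isHermitian_iff_isSymm.1 h.inv.1, isHermitian_iff_isSymm.1 (Sxx_isHermitian hSig.1),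
      Matrix.mul_assoc]
  rw [← nonsing_inv_mul_cancel_left _ M.Syy hd,
    eq_sub_of_add_eq (precision_mul_covariance hSig).1, hSyxt]
  simp only [Matrix.mul_assoc, Matrix.mul_add, Matrix.mul_neg, Matrix.mul_one, sub_neg_eq_add]

lemma matA_eq (hSig : M.Sig.PosDef) (h : M.Oyy.PosDef) :
    M.matA S = S.toBlocks₁₁ - M.Oyy⁻¹ - M.Oyy⁻¹ * M.Oyx * S.toBlocks₂₂ * M.Oyxᵀ * M.Oyy⁻¹ := by
  rw [matA, Syy_eq hSig h]
  simp only [Matrix.mul_sub, Matrix.sub_mul]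
  abel

lemma matB_eq (hSig : M.Sig.PosDef) (h : M.Oyy.PosDef) :
    M.matB S = (2 : ℝ) • (S.toBlocks₁₂ + M.Oyy⁻¹ * M.Oyx * S.toBlocks₂₂) := by
  rw [matB, Syx_eq hSig h, Matrix.mul_sub]
  congr 1
  abel

/-- The constant `κ = η β s_L ^ (β - 1)`, the weight of `matFracDeriv M.L` in the gradient at
`θ*`. -/
noncomputable def kap (M : Model p q) (R : Reg) : ℝ := R.eta * M.β * M.sL ^ (M.β - 1)

lemma sL_nonneg (hL : M.L.PosSemidef) (h : M.Oyy.PosDef) : 0 ≤ M.sL :=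
  matFrac_nonneg (θ := M.theta) hL h

lemma kap_nonneg (hsL : 0 ≤ M.sL) (hβ : 1 ≤ M.β) (hη : 0 ≤ R.eta) : 0 ≤ M.kap R := by
  rw [kap]; positivity

lemma eta_mul_matFrac_theta : R.eta * (M.β * matFrac M.L M.theta ^ (M.β - 1)) = M.kap R :=
  (mul_assoc _ _ _).symm

lemma smoothDeriv_theta (hSig : M.Sig.PosDef) (h : M.Oyy.PosDef) :
    M.smoothDeriv R S M.theta Δ = frobInner (M.matA S) Δ.1 + frobInner (M.matB S) Δ.2
      + M.kap R * matFracDeriv M.L M.theta Δ := by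
  have htrace : (M.Oyy⁻¹ * Δ.1).trace = frobInner M.Oyy⁻¹ Δ.1 := by
    rw [frobInner, isHermitian_iff_isSymm.1 h.inv.1]
  rw [smoothDeriv, matA_eq hSig h, matB_eq hSig h, eta_mul_matFrac_theta, matFracDeriv]
  simp only [theta, frobInner_sub_left, frobInner_smul_left, frobInner_add_left, htrace]
  ring

lemma abs_matFracDeriv_theta_le (M : Model p q) (Δ : Param p q) :
    |matFracDeriv M.L M.theta Δ| ≤ M.ella * l1Norm Δ.1 + M.ellb * l1Norm Δ.2 := by
  have h1 := abs_frobInner_le (M.Oyy⁻¹ * M.Oyx * M.L * M.Oyxᵀ * M.Oyy⁻¹) Δ.1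
  have h2 := abs_frobInner_le (M.Oyy⁻¹ * M.Oyx * M.L) Δ.2
  refine (abs_sub _ _).trans ?_
  rw [abs_mul, abs_two, ella, ellb, mul_assoc, add_comm]
  exact add_le_add h1 (mul_le_mul_of_nonneg_left h2 zero_le_two)

/-- Bounds for the entries of the gradient of `smoothPart` at `θ*`. -/
noncomputable def scoreBound (M : Model p q) (R : Reg)
    (S : Matrix (Fin q ⊕ Fin p) (Fin q ⊕ Fin p) ℝ) : Index p q → ℝ :=
  Sum.elim (fun _ => M.ha S + M.kap R * M.ella) fun _ => M.hb S + M.kap R * M.ellb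

lemma neg_sum_scoreBound_le_smoothDeriv (hSig : M.Sig.PosDef) (h : M.Oyy.PosDef)
    (hk : 0 ≤ M.kap R) :
    -∑ x, M.scoreBound R S x * |entry Δ x| ≤ M.smoothDeriv R S M.theta Δ := by
  have hsum : ∑ x, M.scoreBound R S x * |entry Δ x|
      = (M.ha S + M.kap R * M.ella) * l1Norm Δ.1 + (M.hb S + M.kap R * M.ellb) * l1Norm Δ.2 := by
    simp [scoreBound, entry, Fintype.sum_prod_type, l1Norm, Finset.mul_sum]
  have hA := (abs_le.1 (abs_frobInner_le (M.matA S) Δ.1)).1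
  have hB := (abs_le.1 (abs_frobInner_le (M.matB S) Δ.2)).1
  have hL := mul_le_mul_of_nonneg_left (abs_le.1 (M.abs_matFracDeriv_theta_le Δ)).1 hk
  rw [smoothDeriv_theta hSig h, hsum, ha, hb]
  linarith

section Band

variable (hT : T.Valid) (hB : M.InBand T R S)

include hT hB

lemma InBand.lam_nonneg : 0 ≤ R.lam :=
  (mul_nonneg (zero_le_one.trans hT.one_lt_cl.le) (maxNorm_nonneg _)).trans hB.lam_mem.1

lemma InBand.mu_nonneg : 0 ≤ R.mu :=
  (mul_nonneg (zero_le_one.trans hT.one_lt_cm.le) (maxNorm_nonneg _)).trans hB.mu_mem.1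

lemma InBand.penWeight_add_scoreBound_le (x : Index p q) :
    penWeight R x + M.scoreBound R S x ≤ M.alphaNum T R := by
  have hl : 0 < T.cl := zero_lt_one.trans hT.one_lt_cl
  have hm : 0 < T.cm := zero_lt_one.trans hT.one_lt_cm
  rcases x with x | x
  · refine le_trans ?_ (le_max_left _ _)
    have hle : M.ha S ≤ R.lam / T.cl := by rw [le_div_iff₀' hl]; exact hB.lam_mem.1
    have hw : penWeight R (.inl x : Index p q) ≤ R.lam := by
      simp only [penWeight, Sum.elim_inl]
      split_ifs <;> simp [hB.lam_nonneg hT]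
    rw [add_one_mul, add_div, mul_div_cancel_left₀ _ hl.ne', ← kap]
    simp only [scoreBound, Sum.elim_inl]
    linarith
  · refine le_trans ?_ (le_max_right _ _)
    have hle : M.hb S ≤ R.mu / T.cm := by rw [le_div_iff₀' hm]; exact hB.mu_mem.1
    rw [add_one_mul, add_div, mul_div_cancel_left₀ _ hm.ne', ← kap]
    simp only [penWeight, scoreBound, Sum.elim_inr]
    linarith

lemma InBand.alphaDen_le (h : M.Oyy.PosDef) {x : Index p q} (hx : x ∉ M.supp) :
    M.alphaDen T R ≤ penWeight R x - M.scoreBound R S x := by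
  have hl : 0 < T.cl := zero_lt_one.trans hT.one_lt_cl
  have hm : 0 < T.cm := zero_lt_one.trans hT.one_lt_cm
  rcases x with ⟨i, j⟩ | x
  · refine (min_le_left _ _).trans ?_
    have hle : M.ha S ≤ R.lam / T.cl := by rw [le_div_iff₀' hl]; exact hB.lam_mem.1
    have hij : i ≠ j := by
      rintro rfl
      exact hx (M.mem_supp.2 h.diag_pos.ne')
    rw [sub_one_mul, sub_div, mul_div_cancel_left₀ _ hl.ne', ← kap]
    simp only [penWeight, scoreBound, Sum.elim_inl, if_neg hij]
    linarith
  · refine (min_le_right _ _).trans ?_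
    have hle : M.hb S ≤ R.mu / T.cm := by rw [le_div_iff₀' hm]; exact hB.mu_mem.1
    rw [sub_one_mul, sub_div, mul_div_cancel_left₀ _ hm.ne', ← kap]
    simp only [penWeight, scoreBound, Sum.elim_inr]
    linarith

end Band

lemma le_objective_theta_add (hSig : M.Sig.PosDef) (hL : M.L.PosSemidef) (hβ : 1 ≤ M.β)
    (h : M.Oyy.PosDef) (hT : T.Valid) (hS : S.toBlocks₂₂.PosSemidef) (hB : M.InBand T R S)
    (hΔ : (M.Oyy + Δ.1).PosDef) :
    M.objective R S M.theta + M.smoothRem R S M.theta Δ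
        + (M.alphaDen T R * M.l1Compl Δ - M.alphaNum T R * M.l1On Δ)
      ≤ M.objective R S (M.theta + Δ) := by
  have hsmooth := le_smoothPart_add (θ := M.theta) hS hL hβ hB.eta_mem.1 h hΔ
  have hscore := neg_sum_scoreBound_le_smoothDeriv (S := S) (Δ := Δ) hSig h
    (kap_nonneg (sL_nonneg hL h) hβ hB.eta_mem.1)
  have hpen := mul_sum_compl_sub_le_sum_weight (a := entry M.theta)
    (fun x hx => not_not.1 fun hne => hx (M.mem_supp.2 hne))
    (penWeight_nonneg (hB.lam_nonneg hT) (hB.mu_nonneg hT))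
    (fun x _ => hB.penWeight_add_scoreBound_le hT x) (fun x hx => hB.alphaDen_le hT h hx) (entry Δ)
  rw [objective_eq_smoothPart_add, objective_eq_smoothPart_add, entry_add, l1Compl, l1On]
  simp only [Pi.add_apply]
  linarith

end Model

/-! ### Perturbation of a positive definite matrix -/

section Perturb

variable {k l : ℕ}

lemma frobInner_sq_le (A B : Matrix (Fin k) (Fin l) ℝ) :
    frobInner A B ^ 2 ≤ frobInner A A * frobInner B B := by
  have h := Finset.sum_mul_sq_le_sq_mul_sq (Finset.univ : Finset (Fin k × Fin l))
    (fun x => A x.1 x.2) (fun x => B x.1 x.2)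
  simp only [Fintype.sum_prod_type] at h
  simpa only [frobInner_eq_sum, ← sq] using h

lemma quad_eq_frobInner (U : Matrix (Fin k) (Fin k) ℝ) (x : Fin k → ℝ) :
    x ⬝ᵥ U *ᵥ x = frobInner U (vecMulVec x x) := by
  simp only [frobInner_eq_sum, dotProduct, mulVec, vecMulVec_apply, Finset.mul_sum]
  exact Finset.sum_congr rfl fun i _ => Finset.sum_congr rfl fun j _ => by ring

lemma frobInner_transpose_mul_self (S : Matrix (Fin l) (Fin l) ℝ) (V : Matrix (Fin k) (Fin l) ℝ) :
    frobInner S (Vᵀ * V) = ∑ i, V i ⬝ᵥ S *ᵥ V i := by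
  rw [frobInner_transpose_mul, frobInner_eq_sum]
  exact Finset.sum_congr rfl fun i _ => (dotProduct_mulVec _ _ _).symm

lemma mul_frobInner_self_le {L : Matrix (Fin l) (Fin l) ℝ} {c : ℝ}
    (h : c • (1 : Matrix (Fin l) (Fin l) ℝ) ≤ L) (V : Matrix (Fin k) (Fin l) ℝ) :
    c * frobInner V V ≤ frobInner L (Vᵀ * V) := by
  rw [frobInner_transpose_mul_self, frobInner_eq_sum, Finset.mul_sum]
  exact Finset.sum_le_sum fun i _ => (quad_smul_one c (V i)).symm.trans_le (quad_le_quad h (V i))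

lemma inv_mul_frobInner_le {S : Matrix (Fin l) (Fin l) ℝ} (hS : S.PosSemidef)
    {H : Matrix (Fin k) (Fin k) ℝ} (hH : H.PosDef) {c : ℝ}
    (h : H ≤ c • (1 : Matrix (Fin k) (Fin k) ℝ)) (V : Matrix (Fin k) (Fin l) ℝ) :
    c⁻¹ * frobInner S (Vᵀ * V) ≤ frobInner S (Vᵀ * H⁻¹ * V) := by
  have hnonneg := frobInner_conj_nonneg hS (inv_smul_one_le_inv hH h) V
  rw [Matrix.mul_sub, Matrix.sub_mul, frobInner_sub_right, Matrix.mul_smul, Matrix.mul_one,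
    Matrix.smul_mul, frobInner_smul_right] at hnonneg
  linarith

variable {A U : Matrix (Fin k) (Fin k) ℝ}

lemma le_smul_one_of_frobInner_le (hU : U.IsSymm) {r : ℝ} (hr : 0 ≤ r)
    (h : frobInner U U ≤ r ^ 2) : U ≤ r • (1 : Matrix (Fin k) (Fin k) ℝ) := by
  refine PosSemidef.of_dotProduct_mulVec_nonneg
    ((isHermitian_one.smul (IsSelfAdjoint.all r)).sub (isHermitian_iff_isSymm.2 hU)) fun x => ?_
  rw [star_trivial, sub_mulVec, dotProduct_sub, quad_smul_one, sub_nonneg, quad_eq_frobInner]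
  have hx : 0 ≤ x ⬝ᵥ x := by simpa using dotProduct_star_self_nonneg x
  have hxx : frobInner (vecMulVec x x) (vecMulVec x x) = (x ⬝ᵥ x) ^ 2 := by
    rw [← quad_eq_frobInner, vecMulVec_mulVec, dotProduct_smul, sq]
    rfl
  refine le_of_sq_le_sq ?_ (mul_nonneg hr hx)
  rw [mul_pow, ← hxx]
  exact (frobInner_sq_le _ _).trans (mul_le_mul_of_nonneg_right h (frobInner_self_nonneg _))

lemma neg_smul_one_le_of_frobInner_le (hU : U.IsSymm) {r : ℝ} (hr : 0 ≤ r)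
    (h : frobInner U U ≤ r ^ 2) : -(r • (1 : Matrix (Fin k) (Fin k) ℝ)) ≤ U := by
  rw [neg_le]
  exact le_smul_one_of_frobInner_le hU.neg hr (by simpa [frobInner] using h)

section Small

variable (hA : A.PosDef) (hk : 0 < k) (hU : U.IsSymm) (h : frobInner U U ≤ (lamMin A / 2) ^ 2)

include hA hk hU h

lemma neg_half_smul_le : (-(1 / 2) : ℝ) • A ≤ U := by
  have hmin := lamMin_pos hA hk
  calc (-(1 / 2) : ℝ) • A = -((1 / 2 : ℝ) • A) := neg_smul _ _
    _ ≤ -((1 / 2 : ℝ) • (lamMin A • (1 : Matrix (Fin k) (Fin k) ℝ))) :=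
      neg_le_neg (smul_le_smul_of_nonneg_left (lamMin_smul_one_le hA.1) (by norm_num))
    _ = -((lamMin A / 2) • (1 : Matrix (Fin k) (Fin k) ℝ)) := by rw [smul_smul]; ring_nf
    _ ≤ U := neg_smul_one_le_of_frobInner_le hU (by positivity) h

lemma posDef_add : (A + U).PosDef := by
  have hsplit : A + U = (U - (-(1 / 2) : ℝ) • A) + (1 / 2 : ℝ) • A := by module
  rw [hsplit]
  exact PosDef.posSemidef_add (neg_half_smul_le hA hk hU h) (hA.smul one_half_pos)

lemma add_le_smul_one : A + U ≤ (3 / 2 * lamMax A) • (1 : Matrix (Fin k) (Fin k) ℝ) := by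
  have hmin := lamMin_pos hA hk
  have hle := lamMin_le_lamMax hA.1 hk
  calc A + U ≤ lamMax A • (1 : Matrix (Fin k) (Fin k) ℝ) + (lamMax A / 2) • 1 :=
        add_le_add (le_lamMax_smul_one hA.1)
          (le_smul_one_of_frobInner_le hU (by linarith) (h.trans (by gcongr)))
    _ = (3 / 2 * lamMax A) • (1 : Matrix (Fin k) (Fin k) ℝ) := by module

lemma mul_frobInner_self_le_relTraceSq :
    2 / 3 / lamMax A ^ 2 * frobInner U U ≤ relTraceSq A U := by
  have hmax := lamMax_pos hA hk
  have htrace : frobInner A⁻¹ (Uᵀ * (A + U)⁻¹ * U) = relTraceSq A U := by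
    rw [frobInner, relTraceSq, isHermitian_iff_isSymm.1 hA.inv.1, hU.eq]
    simp only [Matrix.mul_assoc]
  calc 2 / 3 / lamMax A ^ 2 * frobInner U U
      = (3 / 2 * lamMax A)⁻¹ * ((lamMax A)⁻¹ * frobInner U U) := by field_simp
    _ ≤ (3 / 2 * lamMax A)⁻¹ * frobInner A⁻¹ (Uᵀ * U) := by
      gcongr
      exact mul_frobInner_self_le (inv_smul_one_le_inv hA (le_lamMax_smul_one hA.1)) U
    _ ≤ frobInner A⁻¹ (Uᵀ * (A + U)⁻¹ * U) :=
      inv_mul_frobInner_le hA.inv.posSemidef (posDef_add hA hk hU h)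
        (add_le_smul_one hA hk hU h) U
    _ = relTraceSq A U := htrace

end Small

lemma frobInner_conj_mul_inv_mul_le (hA : A.PosDef) (hU : U.IsSymm) (hAU : (A + U).PosDef)
    {S : Matrix (Fin l) (Fin l) ℝ} (hS : S.IsSymm) {B : Matrix (Fin k) (Fin l) ℝ} {c : ℝ}
    (h : B * S * Bᵀ ≤ c • A) :
    frobInner S ((U * A⁻¹ * B)ᵀ * (A + U)⁻¹ * (U * A⁻¹ * B)) ≤ c * relTraceSq A U := by
  have hAd : IsUnit A.det := (isUnit_iff_isUnit_det A).1 hA.isUnit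
  have hAinv : (A⁻¹)ᵀ = A⁻¹ := isHermitian_iff_isSymm.1 hA.inv.1
  have hQ : (U * (A + U)⁻¹ * U).PosSemidef := by
    simpa only [hU.eq] using posSemidef_conj' hAU.inv.posSemidef U
  have hconj := conj_le_conj h A⁻¹
  rw [hAinv, Matrix.mul_smul, nonsing_inv_mul _ hAd, Matrix.smul_mul, Matrix.one_mul] at hconj
  have htrace := trace_mul_le_trace_mul hconj hQ
  calc frobInner S ((U * A⁻¹ * B)ᵀ * (A + U)⁻¹ * (U * A⁻¹ * B))
      = ((S * Bᵀ * A⁻¹ * (U * (A + U)⁻¹ * U)) * (A⁻¹ * B)).trace := by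
        rw [frobInner, hS.eq, transpose_mul, transpose_mul, hAinv, hU.eq]
        simp only [Matrix.mul_assoc]
    _ = (A⁻¹ * (B * S * Bᵀ) * A⁻¹ * (U * (A + U)⁻¹ * U)).trace := by
        rw [trace_mul_comm]
        simp only [Matrix.mul_assoc]
    _ ≤ (c • A⁻¹ * (U * (A + U)⁻¹ * U)).trace := htrace
    _ = c * relTraceSq A U := by
        rw [Matrix.smul_mul, trace_smul, smul_eq_mul, relTraceSq]
        simp only [Matrix.mul_assoc]

lemma le_matFracRem {p q : ℕ} {S : Matrix (Fin p) (Fin p) ℝ} {θ Δ : Param p q} {c d ε : ℝ}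
    (hS : S.PosSemidef) (hθ : θ.1.PosDef) (hΔ : Δ.1.IsSymm) (hθΔ : (θ.1 + Δ.1).PosDef)
    (hc : θ.2 * S * θ.2ᵀ ≤ c • θ.1)
    (hd : θ.1 + Δ.1 ≤ d • (1 : Matrix (Fin q) (Fin q) ℝ)) (hε : 0 < ε) :
    (2 * ε / (2 + ε) * (d⁻¹ * frobInner S (Δ.2ᵀ * Δ.2)) - ε * (c * relTraceSq θ.1 Δ.1)) / 2
      ≤ matFracRem S θ Δ := by
  refine le_trans ?_ (young_frobInner_conj hS hθΔ.inv.posSemidef Δ.2 (Δ.1 * θ.1⁻¹ * θ.2) hε)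
  have hS' := isHermitian_iff_isSymm.1 hS.1
  gcongr
  · exact inv_mul_frobInner_le hS hθΔ hd Δ.2
  · exact frobInner_conj_mul_inv_mul_le hθ hΔ hθΔ hS' hc

end Perturb

section TraceMulInv

variable {k : ℕ} {A N : Matrix (Fin k) (Fin k) ℝ}

lemma le_div_lamMin_smul (hA : A.PosDef) (hk : 0 < k) {c : ℝ} (hc : 0 ≤ c)
    (hN : N ≤ c • (1 : Matrix (Fin k) (Fin k) ℝ)) : N ≤ (c / lamMin A) • A := by
  have hmin := lamMin_pos hA hk
  calc N ≤ (c / lamMin A) • (lamMin A • (1 : Matrix (Fin k) (Fin k) ℝ)) := by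
        rwa [smul_smul, div_mul_cancel₀ _ hmin.ne']
    _ ≤ (c / lamMin A) • A :=
      smul_le_smul_of_nonneg_left (lamMin_smul_one_le hA.1) (div_nonneg hc hmin.le)

lemma div_lamMax_smul_le (hA : A.PosDef) (hk : 0 < k) {c : ℝ} (hc : 0 ≤ c)
    (hN : c • (1 : Matrix (Fin k) (Fin k) ℝ) ≤ N) : (c / lamMax A) • A ≤ N := by
  have hmax := lamMax_pos hA hk
  calc (c / lamMax A) • A ≤ (c / lamMax A) • (lamMax A • (1 : Matrix (Fin k) (Fin k) ℝ)) :=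
        smul_le_smul_of_nonneg_left (le_lamMax_smul_one hA.1) (div_nonneg hc hmax.le)
    _ ≤ N := by rwa [smul_smul, div_mul_cancel₀ _ hmax.ne']

lemma trace_smul_mul_inv (hA : A.PosDef) (c : ℝ) : (c • A * A⁻¹).trace = k * c := by
  rw [Matrix.smul_mul, mul_nonsing_inv _ ((isUnit_iff_isUnit_det A).1 hA.isUnit), trace_smul,
    trace_one, Fintype.card_fin, smul_eq_mul, mul_comm]

lemma mul_lamMin_div_lamMax_le_trace_mul_inv (hA : A.PosDef) (hk : 0 < k) (hN : N.PosSemidef) :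
    k * (lamMin N / lamMax A) ≤ (N * A⁻¹).trace :=
  (trace_smul_mul_inv hA _).symm.trans_le <| trace_mul_le_trace_mul
    (div_lamMax_smul_le hA hk (lamMin_nonneg hN) (lamMin_smul_one_le hN.1)) hA.inv.posSemidef

lemma trace_mul_inv_le_mul_lamMax_div_lamMin (hA : A.PosDef) (hk : 0 < k) (hN : N.PosDef) :
    (N * A⁻¹).trace ≤ k * (lamMax N / lamMin A) :=
  (trace_mul_le_trace_mul (le_div_lamMin_smul hA hk (lamMax_pos hN hk).le
    (le_lamMax_smul_one hN.1)) hA.inv.posSemidef).trans_eq (trace_smul_mul_inv hA _)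

end TraceMulInv

namespace Model

variable {p q : ℕ} {M : Model p q} {R : Reg}

/-! ### Constants of the model -/

lemma H1.q_le_p (h : M.H1) : q ≤ p := by
  have hrank := rank_of_isUnit _ h.OLO_posDef.isUnit
  rw [Fintype.card_fin] at hrank
  rw [← hrank]
  exact (rank_mul_le_left _ _).trans ((rank_mul_le_left _ _).trans (by
    simpa using rank_le_width M.Oyx))

lemma H1.OSO_posDef (h : M.H1) : (M.Oyx * M.Sxx * M.Oyxᵀ).PosDef := by
  have hinj : Function.Injective M.Oyx.vecMul := by
    intro x y hxy
    by_contra hne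
    have hpos := h.OLO_posDef.dotProduct_mulVec_pos (sub_ne_zero.2 hne)
    have hker : M.Oyxᵀ *ᵥ (x - y) = 0 := by
      rw [mulVec_transpose, sub_vecMul, sub_eq_zero]; exact hxy
    rw [← mulVec_mulVec, hker, mulVec_zero, dotProduct_zero] at hpos
    exact lt_irrefl _ hpos
  simpa using h.Sxx_posDef.mul_mul_conjTranspose_same hinj

lemma omegaLLow_pos (h : M.H1) : 0 < M.omegaLLow := by
  have := lamMin_pos h.OLO_posDef h.q_pos
  have := lamMax_pos h.Oyy_posDef h.q_pos
  rw [omegaLLow]; positivity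

lemma omegaLUp_pos (h : M.H1) : 0 < M.omegaLUp := by
  have := lamMax_pos h.OLO_posDef h.q_pos
  have := lamMin_pos h.Oyy_posDef h.q_pos
  rw [omegaLUp]; positivity

lemma omegaSUp_pos (h : M.H1) : 0 < M.omegaSUp := by
  have := lamMax_pos h.OSO_posDef h.q_pos
  have := lamMin_pos h.Oyy_posDef h.q_pos
  rw [omegaSUp]; positivity

lemma sL_eq_trace (hL : M.L.IsSymm) : M.sL = (M.Oyx * M.L * M.Oyxᵀ * M.Oyy⁻¹).trace := by
  rw [sL, frobInner, hL.eq, ← Matrix.mul_assoc, trace_mul_comm]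
  simp only [Matrix.mul_assoc]

lemma mul_omegaLLow_le_sL (hL : M.L.IsSymm) (h : M.H1) : q * M.omegaLLow ≤ M.sL := by
  have := lamMin_pos h.OLO_posDef h.q_pos
  have := lamMax_pos h.Oyy_posDef h.q_pos
  rw [sL_eq_trace hL]
  refine le_trans ?_ (mul_lamMin_div_lamMax_le_trace_mul_inv h.Oyy_posDef h.q_pos
    h.OLO_posDef.posSemidef)
  rw [omegaLLow]
  gcongr
  linarith

lemma sL_le_mul_omegaLUp (hL : M.L.IsSymm) (h : M.H1) : M.sL ≤ p * M.omegaLUp := by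
  have := lamMax_pos h.OLO_posDef h.q_pos
  have := lamMin_pos h.Oyy_posDef h.q_pos
  rw [sL_eq_trace hL]
  refine (trace_mul_inv_le_mul_lamMax_div_lamMin h.Oyy_posDef h.q_pos h.OLO_posDef).trans ?_
  rw [omegaLUp]
  gcongr
  · exact h.q_le_p
  · linarith

lemma sL_pos (hL : M.L.IsSymm) (h : M.H1) : 0 < M.sL :=
  (mul_pos (Nat.cast_pos.2 h.q_pos) (omegaLLow_pos h)).trans_le (mul_omegaLLow_le_sL hL h)

lemma kap_mul_omegaLUp_le (hL : M.L.IsSymm) (hβ : 1 ≤ M.β) (h : M.H1) (hη : 0 ≤ R.eta) :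
    M.kap R * M.omegaLUp ≤ R.eta * M.β * (p : ℝ) ^ (M.β - 1) * M.omegaLUp ^ M.β := by
  have hω := omegaLUp_pos h
  have hsL := Real.rpow_le_rpow (sL_pos hL h).le (sL_le_mul_omegaLUp hL h) (sub_nonneg.2 hβ)
  rw [Real.mul_rpow (Nat.cast_nonneg _) hω.le] at hsL
  calc M.kap R * M.omegaLUp
      ≤ R.eta * M.β * ((p : ℝ) ^ (M.β - 1) * M.omegaLUp ^ (M.β - 1)) * M.omegaLUp := by
        rw [kap]; gcongr
    _ = R.eta * M.β * (p : ℝ) ^ (M.β - 1) * (M.omegaLUp ^ (M.β - 1) * M.omegaLUp) := by ring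
    _ = R.eta * M.β * (p : ℝ) ^ (M.β - 1) * M.omegaLUp ^ M.β := by
        rw [← Real.rpow_add_one hω.ne', sub_add_cancel]

lemma a2_pos {ε : ℝ} (hε : 0 < ε) : 0 < a2 ε := by rw [a2]; positivity

lemma a3_nonneg (hβ : 1 ≤ M.β) (h : M.H1) (hη : 0 ≤ R.eta) {ε : ℝ} (hε : 0 < ε) :
    0 ≤ M.a3 R ε := by
  have := omegaLLow_pos h
  rw [a3]; positivity

lemma a3_le_kap_mul (hL : M.L.IsSymm) (hβ : 1 ≤ M.β) (h : M.H1) (hη : 0 ≤ R.eta) {ε : ℝ}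
    (hε : 0 < ε) : M.a3 R ε ≤ M.kap R * (2 * ε / (2 + ε)) := by
  have hω := (omegaLLow_pos h).le
  have hsL := Real.rpow_le_rpow (by positivity) (mul_omegaLLow_le_sL hL h) (sub_nonneg.2 hβ)
  rw [a3, kap]
  gcongr

/-! ### Strong convexity in the directions where the sample covariance is well behaved -/

variable {S : Matrix (Fin q ⊕ Fin p) (Fin q ⊕ Fin p) ℝ} {Δ : Param p q} {εS εL : ℝ}

/-- The upper bound of the sample covariance of the predictors on the range of `Ω*_yxᵗ`. -/
def RangeBound (M : Model p q) (S : Matrix (Fin q ⊕ Fin p) (Fin q ⊕ Fin p) ℝ) : Prop :=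
  M.Oyx * S.toBlocks₂₂ * M.Oyxᵀ ≤
    (5 / 4 * lamMax (M.Oyx * M.Sxx * M.Oyxᵀ)) • (1 : Matrix (Fin q) (Fin q) ℝ)

lemma RangeBound.le_smul_Oyy (hR : M.RangeBound S) (h : M.H1) :
    M.Oyx * S.toBlocks₂₂ * M.Oyxᵀ ≤ (5 / 16 * M.omegaSUp) • M.Oyy := by
  have := lamMax_pos h.OSO_posDef h.q_pos
  convert le_div_lamMin_smul h.Oyy_posDef h.q_pos (by positivity) hR using 2
  rw [omegaSUp]
  ring

lemma OLO_le_smul_Oyy (h : M.H1) : M.Oyx * M.L * M.Oyxᵀ ≤ (1 / 4 * M.omegaLUp) • M.Oyy := by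
  convert le_div_lamMin_smul h.Oyy_posDef h.q_pos (lamMax_pos h.OLO_posDef h.q_pos).le
    (le_lamMax_smul_one h.OLO_posDef.1) using 2
  rw [omegaLUp]
  ring

section LocalConvexity

variable (hL : M.L.PosSemidef) (hβ : 1 ≤ M.β) (h : M.H1) (hη : 0 ≤ R.eta)
  (hS : S.toBlocks₂₂.PosSemidef) (hΔ : Δ.1.IsSymm) (hr : frobInner Δ.1 Δ.1 ≤ M.r1 ^ 2)

include h hΔ hr

lemma Oyy_add_posDef : (M.Oyy + Δ.1).PosDef :=
  posDef_add h.Oyy_posDef h.q_pos hΔ hr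

include hS in
lemma le_matFracRem_sample (hR : M.RangeBound S) (hεS : 0 < εS) :
    a2 εS / (3 * lamMax M.Oyy) * frobInner S.toBlocks₂₂ (Δ.2ᵀ * Δ.2)
        - 5 / 32 * (εS * M.omegaSUp * relTraceSq M.Oyy Δ.1)
      ≤ matFracRem S.toBlocks₂₂ M.theta Δ := by
  have := lamMax_pos h.Oyy_posDef h.q_pos
  refine le_of_eq_of_le ?_ (le_matFracRem (θ := M.theta) hS h.Oyy_posDef hΔ
    (Oyy_add_posDef h hΔ hr) (hR.le_smul_Oyy h) (add_le_smul_one h.Oyy_posDef h.q_pos hΔ hr) hεS)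
  rw [a2, theta]
  field_simp
  ring

include hL hβ hη

lemma le_kap_mul_matFracRem_L (hεL : 0 < εL) :
    M.a3 R εL * lamMin M.L / (3 * lamMax M.Oyy) * frobInner Δ.2 Δ.2
        - 1 / 8 * (R.eta * M.β * (p : ℝ) ^ (M.β - 1) * M.omegaLUp ^ M.β * εL
          * relTraceSq M.Oyy Δ.1)
      ≤ M.kap R * matFracRem M.L M.theta Δ := by
  have hLs := isHermitian_iff_isSymm.1 hL.1
  have hmax := lamMax_pos h.Oyy_posDef h.q_pos
  have hmin := lamMin_nonneg hL
  have hk := kap_nonneg (R := R) (sL_pos hLs h).le hβ hη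
  have hV := frobInner_self_nonneg Δ.2
  have hT : 0 ≤ relTraceSq M.Oyy Δ.1 :=
    (mul_nonneg (by positivity) (frobInner_self_nonneg _)).trans
      (mul_frobInner_self_le_relTraceSq h.Oyy_posDef h.q_pos hΔ hr)
  have hrem := le_matFracRem (θ := M.theta) hL h.Oyy_posDef hΔ (Oyy_add_posDef h hΔ hr)
    (OLO_le_smul_Oyy h) (add_le_smul_one h.Oyy_posDef h.q_pos hΔ hr) hεL
  calc _ ≤ M.kap R * (2 * εL / (2 + εL)) * lamMin M.L / (3 * lamMax M.Oyy) * frobInner Δ.2 Δ.2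
        - 1 / 8 * (M.kap R * M.omegaLUp * εL * relTraceSq M.Oyy Δ.1) := by
        refine sub_le_sub ?_ (mul_le_mul_of_nonneg_left (mul_le_mul_of_nonneg_right
          (mul_le_mul_of_nonneg_right (kap_mul_omegaLUp_le hLs hβ h hη) hεL.le) hT) (by norm_num))
        gcongr
        exact a3_le_kap_mul hLs hβ h hη hεL
    _ = M.kap R * ((2 * εL / (2 + εL) * ((3 / 2 * lamMax M.Oyy)⁻¹
        * (lamMin M.L * frobInner Δ.2 Δ.2))
          - εL * (1 / 4 * M.omegaLUp * relTraceSq M.Oyy Δ.1)) / 2) := by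
        field_simp
        ring
    _ ≤ M.kap R * ((2 * εL / (2 + εL) * ((3 / 2 * lamMax M.Oyy)⁻¹
        * frobInner M.L (Δ.2ᵀ * Δ.2))
          - εL * (1 / 4 * M.omegaLUp * relTraceSq M.Oyy Δ.1)) / 2) := by
        gcongr
        exact mul_frobInner_self_le (lamMin_smul_one_le hL.1) Δ.2
    _ ≤ M.kap R * matFracRem M.L M.theta Δ := by gcongr; exact hrem

include hS in
lemma le_smoothRem (hR : M.RangeBound S) (hεS : 0 < εS) (hεL : 0 < εL)
    (ha1 : 0 < M.a1 R εS εL) :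
    2 / 9 * M.a1 R εS εL / lamMax M.Oyy ^ 2 * frobInner Δ.1 Δ.1
        + a2 εS / (3 * lamMax M.Oyy) * frobInner S.toBlocks₂₂ (Δ.2ᵀ * Δ.2)
        + M.a3 R εL * lamMin M.L / (3 * lamMax M.Oyy) * frobInner Δ.2 Δ.2
      ≤ M.smoothRem R S M.theta Δ := by
  have hωS := omegaSUp_pos h
  have hωL := omegaLUp_pos h
  have hmax := lamMax_pos h.Oyy_posDef h.q_pos
  have hU : 2 / 3 / lamMax M.Oyy ^ 2 * frobInner Δ.1 Δ.1 ≤ relTraceSq M.Oyy Δ.1 :=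
    mul_frobInner_self_le_relTraceSq h.Oyy_posDef h.q_pos hΔ hr
  have hT : 0 ≤ relTraceSq M.Oyy Δ.1 :=
    (mul_nonneg (by positivity) (frobInner_self_nonneg _)).trans hU
  have hlog : relTraceSq M.Oyy Δ.1 / 3 ≤ logDetRem M.theta.1 Δ.1 :=
    relTraceSq_div_three_le_logDetRem h.Oyy_posDef (Oyy_add_posDef h hΔ hr)
      (neg_half_smul_le h.Oyy_posDef h.q_pos hΔ hr)
  have hsample := le_matFracRem_sample h hS hΔ hr hR hεS
  have hstruct := le_kap_mul_matFracRem_L hL hβ h hη hΔ hr hεL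
  have hquad : 2 / 9 * M.a1 R εS εL / lamMax M.Oyy ^ 2 * frobInner Δ.1 Δ.1
      ≤ M.a1 R εS εL * relTraceSq M.Oyy Δ.1 / 3 := by
    calc _ = M.a1 R εS εL * (2 / 3 / lamMax M.Oyy ^ 2 * frobInner Δ.1 Δ.1) / 3 := by ring
      _ ≤ _ := by gcongr
  have ha1T : M.a1 R εS εL * relTraceSq M.Oyy Δ.1 = relTraceSq M.Oyy Δ.1
      - εS * M.omegaSUp * relTraceSq M.Oyy Δ.1
      - R.eta * M.β * (p : ℝ) ^ (M.β - 1) * M.omegaLUp ^ M.β * εL * relTraceSq M.Oyy Δ.1 := by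
    rw [a1]; ring
  have : 0 ≤ εS * M.omegaSUp * relTraceSq M.Oyy Δ.1 := by positivity
  have : 0 ≤ R.eta * M.β * (p : ℝ) ^ (M.β - 1) * M.omegaLUp ^ M.β * εL
      * relTraceSq M.Oyy Δ.1 := by positivity
  rw [smoothRem, eta_mul_matFrac_theta]
  linarith

end LocalConvexity

end Model

namespace Model

/-! ### Strong convexity on the cone -/

variable {p q : ℕ} {M : Model p q} {T : Tuning} {R : Reg}
  {S : Matrix (Fin q ⊕ Fin p) (Fin q ⊕ Fin p) ℝ} {Δ : Param p q} {εS εL s H : ℝ}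

/-- The lower bound of the quadratic form of the sample covariance of the predictors by that of
`Σ*_xx`, up to an `ℓ¹` term which is small on vectors that are nearly `s`-sparse. -/
def SparseBound (M : Model p q) (S : Matrix (Fin q ⊕ Fin p) (Fin q ⊕ Fin p) ℝ) (s : ℝ) : Prop :=
  ∀ v : Fin p → ℝ, 3 / 4 * (v ⬝ᵥ M.Sxx *ᵥ v) - 1 / 2 * lamMax M.Sxx * (∑ j, |v j|) ^ 2 / (s - 1)
    ≤ v ⬝ᵥ S.toBlocks₂₂ *ᵥ v

lemma SparseBound.le_frobInner (hSB : M.SparseBound S s) (hs : 1 < s) (h : M.H1)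
    (V : Matrix (Fin q) (Fin p) ℝ) :
    3 / 4 * lamMin M.Sxx * frobInner V V - 1 / 2 * lamMax M.Sxx * l1Norm V ^ 2 / (s - 1)
      ≤ frobInner S.toBlocks₂₂ (Vᵀ * V) := by
  have hmax := lamMax_pos h.Sxx_posDef h.p_pos
  have := sub_pos.2 hs
  have hl1 : ∑ i, (∑ j, |V i j|) ^ 2 ≤ l1Norm V ^ 2 :=
    Finset.sum_sq_le_sq_sum_of_nonneg fun i _ => Finset.sum_nonneg fun j _ => abs_nonneg _
  have hquad := mul_frobInner_self_le (lamMin_smul_one_le h.Sxx_posDef.1) V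
  calc _ ≤ 3 / 4 * frobInner M.Sxx (Vᵀ * V)
        - 1 / 2 * lamMax M.Sxx * (∑ i, (∑ j, |V i j|) ^ 2) / (s - 1) := by
        rw [mul_assoc]; gcongr
    _ = ∑ i, (3 / 4 * (V i ⬝ᵥ M.Sxx *ᵥ V i)
        - 1 / 2 * lamMax M.Sxx * (∑ j, |V i j|) ^ 2 / (s - 1)) := by
        rw [frobInner_transpose_mul_self, Finset.sum_sub_distrib, Finset.mul_sum, Finset.mul_sum,
          Finset.sum_div]
    _ ≤ _ := by
        rw [frobInner_transpose_mul_self]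
        exact Finset.sum_le_sum fun i _ => hSB (V i)

lemma one_le_cardS (h : M.Oyx ≠ 0) : 1 ≤ M.cardS := by
  obtain ⟨i, j, hij⟩ : ∃ i j, M.Oyx i j ≠ 0 := by
    by_contra! hc
    exact h (Matrix.ext hc)
  rw [M.cardS_eq_card_supp, Nat.one_le_iff_ne_zero, ← Nat.pos_iff_ne_zero, Finset.card_pos]
  exact ⟨Sum.inr (i, j), M.mem_supp.2 hij⟩

lemma gam_pos (hL : M.L.PosSemidef) (hβ : 1 ≤ M.β) (h : M.H1) (hη : 0 ≤ R.eta) (hεS : 0 < εS)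
    (hεL : 0 < εL) (ha1 : 0 < M.a1 R εS εL) : 0 < M.gam R εS εL := by
  have hmax := lamMax_pos h.Oyy_posDef h.q_pos
  have hmin := lamMin_pos h.Sxx_posDef h.p_pos
  have hLmin := lamMin_nonneg hL
  have ha2 := a2_pos hεS
  have ha3 := a3_nonneg hβ h hη hεL
  rw [gam]
  refine lt_min ?_ ?_ <;> positivity

lemma one_le_alpha (hT : T.Valid) (hlam : 0 ≤ R.lam) (hκ : 0 ≤ M.kap R)
    (hd : 0 < M.alphaDen T R) : 1 ≤ M.alpha T R := by
  have hcl := zero_lt_one.trans hT.one_lt_cl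
  have hella : 0 ≤ M.ella := maxNorm_nonneg _
  rw [alpha, one_le_div hd]
  refine (min_le_left _ _).trans (le_trans ?_ (le_max_left _ _))
  calc _ ≤ (T.cl + 1) * R.lam / T.cl - 0 := by
        refine sub_le_sub ?_ (mul_nonneg hκ hella)
        gcongr
        linarith
    _ ≤ _ := by
        rw [sub_zero]
        exact le_add_of_nonneg_right (mul_nonneg hκ hella)

/-- The cone of the directions in which the penalties do not dominate. -/
def InCone (M : Model p q) (T : Tuning) (R : Reg) (Δ : Param p q) : Prop :=
  M.alphaDen T R * M.l1Compl Δ ≤ M.alphaNum T R * M.l1On Δ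

lemma l1Norm_snd_le (M : Model p q) (Δ : Param p q) :
    l1Norm Δ.2 ≤ M.l1On Δ + M.l1Compl Δ := by
  have hsnd : l1Norm Δ.2 = ∑ x, |entry Δ (Sum.inr x)| :=
    (Fintype.sum_prod_type' fun i j => |Δ.2 i j|).symm
  rw [l1On_add_l1Compl, Fintype.sum_sum_type, hsnd]
  exact le_add_of_nonneg_left (Finset.sum_nonneg fun _ _ => abs_nonneg _)

lemma InCone.l1Norm_snd_sq_le (hΔ : M.InCone T R Δ) (hd : 0 < M.alphaDen T R)
    (hα : 1 ≤ M.alpha T R) (hUV : frobInner Δ.1 Δ.1 ≤ 2 * frobInner Δ.2 Δ.2) :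
    l1Norm Δ.2 ^ 2 ≤ 12 * M.alpha T R ^ 2 * M.cardS * frobInner Δ.2 Δ.2 := by
  have hOn := M.l1On_nonneg Δ
  have hcompl : M.l1Compl Δ ≤ M.alpha T R * M.l1On Δ := by
    rw [alpha, div_mul_eq_mul_div, le_div_iff₀' hd]
    exact hΔ
  have hl1 : l1Norm Δ.2 ≤ 2 * M.alpha T R * M.l1On Δ := by
    linarith [M.l1Norm_snd_le Δ, le_mul_of_one_le_left hOn hα]
  calc l1Norm Δ.2 ^ 2 ≤ (2 * M.alpha T R * M.l1On Δ) ^ 2 :=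
        pow_le_pow_left₀ (Finset.sum_nonneg fun _ _ => Finset.sum_nonneg fun _ _ => abs_nonneg _)
          hl1 2
    _ = 4 * M.alpha T R ^ 2 * M.l1On Δ ^ 2 := by ring
    _ ≤ 4 * M.alpha T R ^ 2 * (M.cardS * (3 * frobInner Δ.2 Δ.2)) := by
        gcongr
        refine (M.l1On_sq_le Δ).trans ?_
        rw [normSq]
        gcongr
        linarith
    _ = 12 * M.alpha T R ^ 2 * M.cardS * frobInner Δ.2 Δ.2 := by ring

lemma InCone.lamMin_mul_frobInner_le (hΔ : M.InCone T R Δ) (h : M.H1)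
    (hd : 0 < M.alphaDen T R) (hα : 1 ≤ M.alpha T R) (hs : M.sAlpha T R ≤ s)
    (hSB : M.SparseBound S s) (hUV : frobInner Δ.1 Δ.1 ≤ 2 * frobInner Δ.2 Δ.2) :
    lamMin M.Sxx / 4 * frobInner Δ.2 Δ.2 ≤ frobInner S.toBlocks₂₂ (Δ.2ᵀ * Δ.2) := by
  have hmin := lamMin_pos h.Sxx_posDef h.p_pos
  have hmax := lamMax_pos h.Sxx_posDef h.p_pos
  have hV := frobInner_self_nonneg Δ.2
  have hcard : (1 : ℝ) ≤ M.cardS := mod_cast one_le_cardS h.Oyx_ne_zero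
  have hsα : 12 * M.alpha T R ^ 2 * M.cardS * lamMax M.Sxx / lamMin M.Sxx ≤ s - 1 := by
    have : M.sAlpha T R
        = M.cardS + 12 * M.alpha T R ^ 2 * M.cardS * lamMax M.Sxx / lamMin M.Sxx := by
      rw [sAlpha]; ring
    linarith
  have hs1 : 0 < s - 1 := lt_of_lt_of_le (by positivity) hsα
  have hl1 : 1 / 2 * lamMax M.Sxx * l1Norm Δ.2 ^ 2 / (s - 1)
      ≤ 1 / 2 * lamMin M.Sxx * frobInner Δ.2 Δ.2 := by
    rw [div_le_iff₀ hs1]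
    calc _ ≤ 1 / 2 * lamMax M.Sxx
          * (12 * M.alpha T R ^ 2 * M.cardS * frobInner Δ.2 Δ.2) := by
          gcongr
          exact hΔ.l1Norm_snd_sq_le hd hα hUV
      _ = 1 / 2 * frobInner Δ.2 Δ.2
          * (12 * M.alpha T R ^ 2 * M.cardS * lamMax M.Sxx) := by ring
      _ ≤ 1 / 2 * frobInner Δ.2 Δ.2 * ((s - 1) * lamMin M.Sxx) := by
          exact mul_le_mul_of_nonneg_left ((div_le_iff₀ hmin).1 hsα) (by positivity)
      _ = _ := by ring
  linarith [hSB.le_frobInner (by linarith) h Δ.2]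

section Cone

variable (hL : M.L.PosSemidef) (hβ : 1 ≤ M.β) (h : M.H1) (hS : S.toBlocks₂₂.PosSemidef)
  (hR : M.RangeBound S) (hs : M.sAlpha T R ≤ s) (hSB : M.SparseBound S s)
  (hd : 0 < M.alphaDen T R) (hεS : 0 < εS) (hεL : 0 < εL) (ha1 : 0 < M.a1 R εS εL)
  (hΔ : Δ.1.IsSymm)

include hL hβ h hS hR hs hSB hd hεS hεL ha1 hΔ

lemma InCone.gam_mul_normSq_le (hη : 0 ≤ R.eta) (hα : 1 ≤ M.alpha T R)
    (hr : frobInner Δ.1 Δ.1 ≤ M.r1 ^ 2) (hcone : M.InCone T R Δ) :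
    M.gam R εS εL * normSq Δ ≤ M.smoothRem R S M.theta Δ := by
  have hU := frobInner_self_nonneg Δ.1
  have hV := frobInner_self_nonneg Δ.2
  have hmax := lamMax_pos h.Oyy_posDef h.q_pos
  have ha2 := a2_pos hεS
  have hγ := gam_pos hL hβ h hη hεS hεL ha1
  have hγV := mul_nonneg hγ.le hV
  have hL3 := mul_nonneg (a3_nonneg hβ h hη hεL) (lamMin_nonneg hL)
  have hQ : 0 ≤ frobInner S.toBlocks₂₂ (Δ.2ᵀ * Δ.2) := by
    simpa using frobInner_conj_nonneg hS PosSemidef.one Δ.2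
  have hrem := le_smoothRem hL hβ h hη hS hΔ hr hR hεS hεL ha1
  have hUterm : 16 / 9 * (M.gam R εS εL * frobInner Δ.1 Δ.1)
      ≤ 2 / 9 * M.a1 R εS εL / lamMax M.Oyy ^ 2 * frobInner Δ.1 Δ.1 := by
    calc _ ≤ 16 / 9 * (M.a1 R εS εL / (8 * lamMax M.Oyy ^ 2) * frobInner Δ.1 Δ.1) := by
          gcongr; exact min_le_left _ _
      _ = _ := by field_simp; ring
  have hLterm : 0 ≤ M.a3 R εL * lamMin M.L / (3 * lamMax M.Oyy) * frobInner Δ.2 Δ.2 := by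
    positivity
  rw [normSq]
  rcases le_total (2 * frobInner Δ.2 Δ.2) (frobInner Δ.1 Δ.1) with hUV | hUV
  · have hsample : 0 ≤ a2 εS / (3 * lamMax M.Oyy) * frobInner S.toBlocks₂₂ (Δ.2ᵀ * Δ.2) := by
      positivity
    linarith [mul_le_mul_of_nonneg_left hUV hγ.le]
  · have hsample : a2 εS * lamMin M.Sxx / (40 * lamMax M.Oyy) * frobInner Δ.2 Δ.2
        ≤ a2 εS / (3 * lamMax M.Oyy) * frobInner S.toBlocks₂₂ (Δ.2ᵀ * Δ.2) := by
      have hmin := lamMin_pos h.Sxx_posDef h.p_pos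
      calc _ ≤ a2 εS * lamMin M.Sxx / (12 * lamMax M.Oyy) * frobInner Δ.2 Δ.2 := by
            gcongr; norm_num
        _ = a2 εS / (3 * lamMax M.Oyy) * (lamMin M.Sxx / 4 * frobInner Δ.2 Δ.2) := by
            field_simp; ring
        _ ≤ _ := by gcongr; exact hcone.lamMin_mul_frobInner_le h hd hα hs hSB hUV
    have hVterm : M.gam R εS εL * frobInner Δ.2 Δ.2
        ≤ a2 εS * lamMin M.Sxx / (40 * lamMax M.Oyy) * frobInner Δ.2 Δ.2
          + M.a3 R εL * lamMin M.L / (3 * lamMax M.Oyy) * frobInner Δ.2 Δ.2 := by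
      rw [← add_mul]
      refine mul_le_mul_of_nonneg_right ((min_le_right _ _).trans ?_) hV
      gcongr; norm_num
    linarith [mul_nonneg hγ.le hU]

end Cone

/-! ### The objective function on a small sphere -/

section Band

variable (hT : T.Valid) (hβ : 1 ≤ M.β) (hB : M.InBand T R S)

include hT

lemma cLamMu_pos : 0 < T.cLamMu := by
  have := hT.one_lt_cl
  have := hT.el_pos
  have : 0 < T.dl := by linarith [hT.cl_lt_dl]
  exact lt_max_of_lt_left (by positivity)

include hB hβ

lemma InBand.kap_mul_le (hsL : 0 < M.sL) :
    M.kap R * M.ella ≤ T.el * M.ha S ∧ M.kap R * M.ellb ≤ T.em * M.hb S := by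
  have hden : 0 < M.β * M.sL ^ (M.β - 1) := by positivity
  have hη := hB.eta_mem.2
  rw [etaBar, le_div_iff₀ hden, ← mul_assoc] at hη
  exact ⟨mul_le_of_le_div₀ (mul_nonneg hT.el_pos.le (maxNorm_nonneg _)) (maxNorm_nonneg _)
      (hη.trans ((min_le_right _ _).trans (min_le_left _ _))),
    mul_le_of_le_div₀ (mul_nonneg hT.em_pos.le (maxNorm_nonneg _))
      (mul_nonneg zero_le_two (maxNorm_nonneg _))
      (hη.trans ((min_le_right _ _).trans (min_le_right _ _)))⟩

lemma InBand.alphaNum_le (hsL : 0 < M.sL) (ha : M.ha S ≤ H) (hb : M.hb S ≤ H) :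
    M.alphaNum T R ≤ T.cLamMu * H := by
  have hH : 0 ≤ H := (maxNorm_nonneg _).trans ha
  have hbound {c d e lam k x : ℝ} (hc : 1 < c) (hcd : c < d) (he : 0 < e) (hl : lam ≤ d * x)
      (hk : k ≤ e * x) (hx : x ≤ H) (hle : (c + 1) * d / c + e ≤ T.cLamMu) :
      (c + 1) * lam / c + k ≤ T.cLamMu * H := by
    have hd : 0 < d := by linarith
    calc (c + 1) * lam / c + k ≤ (c + 1) * (d * x) / c + e * x := by gcongr
      _ = ((c + 1) * d / c + e) * x := by ring
      _ ≤ ((c + 1) * d / c + e) * H := by gcongr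
      _ ≤ _ := by gcongr
  obtain ⟨hκa, hκb⟩ := hB.kap_mul_le hT hβ hsL
  exact max_le
    (hbound hT.one_lt_cl hT.cl_lt_dl hT.el_pos hB.lam_mem.2 hκa ha (le_max_left _ _))
    (hbound hT.one_lt_cm hT.cm_lt_dm hT.em_pos hB.mu_mem.2 hκb hb (le_max_right _ _))

end Band

lemma mul_l1On_lt {K g : ℝ} (hK : 0 ≤ K) (hg : 0 < g)
    (hlt : K * √M.cardS / g < √(normSq Δ)) : K * M.l1On Δ < g * normSq Δ := by
  have hΔ : 0 < √(normSq Δ) := lt_of_le_of_lt (by positivity) hlt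
  rw [div_lt_iff₀ hg] at hlt
  calc K * M.l1On Δ ≤ K * (√M.cardS * √(normSq Δ)) := by
        rw [← Real.sqrt_mul (Nat.cast_nonneg _)]
        exact mul_le_mul_of_nonneg_left (Real.le_sqrt_of_sq_le (M.l1On_sq_le Δ)) hK
    _ = K * √M.cardS * √(normSq Δ) := by ring
    _ < √(normSq Δ) * g * √(normSq Δ) := by gcongr
    _ = g * (√(normSq Δ) * √(normSq Δ)) := by ring
    _ = g * normSq Δ := by rw [Real.mul_self_sqrt (normSq_nonneg Δ)]

/-- What is required of the sample covariance `S`: the sparsity level `s` and the bound `H` of the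
score are those reached by a sample of size `n`. -/
structure IsGood (M : Model p q) (S : Matrix (Fin q ⊕ Fin p) (Fin q ⊕ Fin p) ℝ) (s H : ℝ) :
    Prop where
  posSemidef : S.toBlocks₂₂.PosSemidef
  rangeBound : M.RangeBound S
  sparseBound : M.SparseBound S s
  ha_le : M.ha S ≤ H
  hb_le : M.hb S ≤ H

/-- The requirements on the regularization parameters and on the constants `ε_S` and `ε_L`, when
the sample covariance is `S` and vectors of sparsity `s` are controlled. -/
structure IsAdmissible (M : Model p q) (T : Tuning) (R : Reg)
    (S : Matrix (Fin q ⊕ Fin p) (Fin q ⊕ Fin p) ℝ) (s εS εL : ℝ) : Prop where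
  inBand : M.InBand T R S
  alphaDen_pos : 0 < M.alphaDen T R
  sAlpha_le : M.sAlpha T R ≤ s
  εS_pos : 0 < εS
  εL_pos : 0 < εL
  a1_pos : 0 < M.a1 R εS εL

section Sphere

variable (hSig : M.Sig.PosDef) (hL : M.L.PosSemidef) (hβ : 1 ≤ M.β) (h : M.H1) (hT : T.Valid)
  (hG : M.IsGood S s H) (hA : M.IsAdmissible T R S s εS εL)

include hL hβ h hA

lemma IsAdmissible.gam_pos : 0 < M.gam R εS εL :=
  Model.gam_pos hL hβ h hA.inBand.eta_mem.1 hA.εS_pos hA.εL_pos hA.a1_pos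

include hSig hT hG

lemma objective_theta_lt_objective_add (hΔ : Δ.1.IsSymm) (hr : normSq Δ ≤ M.r1 ^ 2)
    (hlt : T.cLamMu * H * √M.cardS / M.gam R εS εL < √(normSq Δ)) :
    M.objective R S M.theta < M.objective R S (M.theta + Δ) := by
  have hr₁ : frobInner Δ.1 Δ.1 ≤ M.r1 ^ 2 := by
    rw [normSq] at hr
    linarith [frobInner_self_nonneg Δ.2]
  have hH : 0 ≤ H := (maxNorm_nonneg _).trans hG.ha_le
  have hη := hA.inBand.eta_mem.1
  have hsL := sL_pos (isHermitian_iff_isSymm.1 hL.1) h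
  have hd := hA.alphaDen_pos
  have hΔP := Oyy_add_posDef h hΔ hr₁
  have hgrowth := le_objective_theta_add hSig hL hβ h.Oyy_posDef hT hG.posSemidef hA.inBand hΔP
  have hK : 0 ≤ T.cLamMu * H := mul_nonneg (cLamMu_pos hT).le hH
  have hnum : M.alphaNum T R * M.l1On Δ ≤ T.cLamMu * H * M.l1On Δ :=
    mul_le_mul_of_nonneg_right (hA.inBand.alphaNum_le hT hβ hsL hG.ha_le hG.hb_le)
      (M.l1On_nonneg Δ)
  by_cases hcone : M.InCone T R Δ
  · have hα := one_le_alpha hT (hA.inBand.lam_nonneg hT) (kap_nonneg hsL.le hβ hη) hd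
    linarith [hcone.gam_mul_normSq_le hL hβ h hG.posSemidef hG.rangeBound hA.sAlpha_le
        hG.sparseBound hd hA.εS_pos hA.εL_pos hA.a1_pos hΔ hη hα hr₁,
      mul_l1On_lt hK (hA.gam_pos hL hβ h) hlt, mul_nonneg hd.le (M.l1Compl_nonneg Δ)]
  · have hrem := smoothRem_nonneg (R := R) (θ := M.theta) hG.posSemidef hL hβ hη h.Oyy_posDef hΔP
    rw [InCone, not_le] at hcone
    linarith

end Sphere

end Model

/-! ### Existence and location of the minimizers -/

lemma lt_of_convexOn_of_lt_in_ball {E : Type*} [AddCommGroup E] [Module ℝ E] {D : Set E} {f : E → ℝ}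
    {x₀ : E} {N : E → ℝ} (hN : ∀ t : ℝ, 0 ≤ t → ∀ v, N (t • v) = t * N v) (hf : ConvexOn ℝ D f)
    (hx₀ : x₀ ∈ D) {e r : ℝ} (hr : 0 < r) (her : e < r)
    (hlt : ∀ x ∈ D, N (x - x₀) ≤ r → e < N (x - x₀) → f x₀ < f x) {x : E} (hx : x ∈ D)
    (hex : e < N (x - x₀)) : f x₀ < f x := by
  rcases le_or_gt (N (x - x₀)) r with hle | hgt
  · exact hlt x hx hle hex
  -- Otherwise the point of the segment from `x₀` to `x` at distance `r` of `x₀` is used.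
  have hN₀ : 0 < N (x - x₀) := hr.trans hgt
  set t := r / N (x - x₀)
  have ht : 0 < t := div_pos hr hN₀
  have ht' : 0 ≤ 1 - t := sub_nonneg.2 ((div_le_one hN₀).2 hgt.le)
  set y := (1 - t) • x₀ + t • x with hy
  have hsub : y - x₀ = t • (x - x₀) := by rw [hy]; module
  have hNy : N (y - x₀) = r := by rw [hsub, hN t ht.le, div_mul_cancel₀ _ hN₀.ne']
  have hlty := hlt y (hf.1 hx₀ hx ht' ht.le (by ring)) hNy.le (hNy ▸ her)
  have hconv : f y ≤ (1 - t) * f x₀ + t * f x := hf.2 hx₀ hx ht' ht.le (by ring)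
  have : t * f x₀ < t * f x := by linarith
  exact lt_of_mul_lt_mul_left this ht.le

lemma continuous_frobInner {X : Type*} [TopologicalSpace X] {k l : ℕ}
    {f g : X → Matrix (Fin k) (Fin l) ℝ} (hf : Continuous f) (hg : Continuous g) :
    Continuous fun x => frobInner (f x) (g x) := by
  unfold frobInner
  fun_prop

section Param

variable {p q : ℕ}

lemma continuous_normSq : Continuous (normSq : Param p q → ℝ) :=
  (continuous_frobInner continuous_fst continuous_fst).add
    (continuous_frobInner continuous_snd continuous_snd)

lemma continuous_entry (x : Index p q) : Continuous fun θ : Param p q => entry θ x := by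
  rcases x with x | x
  · exact continuous_fst.matrix_elem x.1 x.2
  · exact continuous_snd.matrix_elem x.1 x.2

lemma abs_entry_le {Δ : Param p q} {r : ℝ} (hr : √(normSq Δ) ≤ r) (x : Index p q) :
    |entry Δ x| ≤ r := by
  refine (Real.abs_le_sqrt ?_).trans hr
  rw [normSq_eq_sum]
  exact Finset.single_le_sum (f := fun x => entry Δ x ^ 2) (fun _ _ => sq_nonneg _)
    (Finset.mem_univ x)

open scoped Matrix.Norms.Elementwise in
lemma isCompact_frobDist_ball (θ₀ : Param p q) {r : ℝ} (hr : 0 ≤ r) :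
    IsCompact {θ : Param p q | frobDist θ θ₀ ≤ r} := by
  refine Metric.isCompact_of_isClosed_isBounded ?_
    ((Metric.isBounded_closedBall (x := θ₀) (r := r)).subset fun θ hθ => ?_)
  · simp only [frobDist_eq]
    exact isClosed_le
      (continuous_normSq.comp (continuous_id.sub continuous_const)).sqrt continuous_const
  · rw [Set.mem_ofPred, frobDist_eq] at hθ
    rw [mem_closedBall_iff_norm, Prod.norm_def]
    exact max_le ((Matrix.norm_le_iff hr).2 fun i j => abs_entry_le hθ (Sum.inl (i, j)))
      ((Matrix.norm_le_iff hr).2 fun i j => abs_entry_le hθ (Sum.inr (i, j)))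

lemma continuousOn_matFrac (K : Matrix (Fin p) (Fin p) ℝ) :
    ContinuousOn (matFrac K : Param p q → ℝ) {θ | θ.1.PosDef} := by
  have hinv : ContinuousOn (Inv.inv : Matrix (Fin q) (Fin q) ℝ → _) {X | X.PosDef} := fun X hX =>
    (continuousAt_matrix_inv X
      (Ring.inverse_eq_inv' (G₀ := ℝ) ▸ continuousAt_inv₀ hX.det_pos.ne')).continuousWithinAt
  have hfrob : Continuous fun θ : Param p q => frobInner K (θ.2ᵀ * θ.1 * θ.2) :=
    continuous_frobInner continuous_const
      ((continuous_snd.matrix_transpose.matrix_mul continuous_fst).matrix_mul continuous_snd)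
  have hpair : ContinuousOn (fun θ : Param p q => (θ.1⁻¹, θ.2)) {θ | θ.1.PosDef} :=
    (hinv.comp continuousOn_fst fun _ hθ => hθ).prodMk continuousOn_snd
  exact (hfrob.comp_continuousOn hpair).congr fun _ _ => rfl

end Param

namespace Model

variable {p q : ℕ} {M : Model p q} {T : Tuning} {R : Reg}
  {S : Matrix (Fin q ⊕ Fin p) (Fin q ⊕ Fin p) ℝ} {εS εL s H : ℝ}

lemma continuousOn_objective (hβ : 1 ≤ M.β) (R : Reg)
    (S : Matrix (Fin q ⊕ Fin p) (Fin q ⊕ Fin p) ℝ) :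
    ContinuousOn (M.objective R S) {θ | θ.1.PosDef} := by
  have hlog : ContinuousOn (fun θ : Param p q => Real.log θ.1.det) {θ | θ.1.PosDef} :=
    ContinuousOn.log continuous_fst.matrix_det.continuousOn fun θ hθ => hθ.det_pos.ne'
  have hyy := (continuous_frobInner (X := Param p q) (continuous_const (y := S.toBlocks₁₁))
    continuous_fst).continuousOn (s := {θ | θ.1.PosDef})
  have hyx := (continuous_frobInner (X := Param p q) (continuous_const (y := S.toBlocks₁₂))
    continuous_snd).continuousOn (s := {θ | θ.1.PosDef})
  have hpen : Continuous fun θ : Param p q => ∑ x, penWeight R x * |entry θ x| :=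
    continuous_finsetSum _ fun x _ => continuous_const.mul (continuous_entry x).abs
  have hstruct := (continuousOn_matFrac (q := q) M.L).rpow_const fun _ _ =>
    Or.inr (zero_le_one.trans hβ)
  refine ContinuousOn.congr ?_ fun θ _ => objective_eq_smoothPart_add
  exact ((((hlog.neg.add hyy).add (continuousOn_const.mul hyx)).add
    (continuousOn_matFrac S.toBlocks₂₂)).add (continuousOn_const.mul hstruct)).add
    hpen.continuousOn

lemma H1.r1_pos (h : M.H1) : 0 < M.r1 := half_pos (lamMin_pos h.Oyy_posDef h.q_pos)

lemma frobDist_self {p q : ℕ} (θ : Param p q) : frobDist θ θ = 0 := by simp [frobDist]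

lemma posDef_of_frobDist_le (h : M.H1) {θ : Param p q} (hθ : θ.1.IsSymm)
    (hr : frobDist θ M.theta ≤ M.r1) : θ.1.PosDef := by
  rw [frobDist_eq, Real.sqrt_le_left h.r1_pos.le, normSq] at hr
  have hΔ : (θ - M.theta).1.IsSymm := hθ.sub (isHermitian_iff_isSymm.1 h.Oyy_posDef.1)
  simpa [theta] using Oyy_add_posDef h hΔ (by linarith [frobInner_self_nonneg (θ - M.theta).2])

lemma exists_isMinOn_objective (hβ : 1 ≤ M.β) (h : M.H1) (R : Reg)
    (S : Matrix (Fin q ⊕ Fin p) (Fin q ⊕ Fin p) ℝ) :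
    ∃ θ : Param p q, θ.1.PosDef ∧ ∀ θ' : Param p q, θ'.1.PosDef → frobDist θ' M.theta ≤ M.r1 →
      M.objective R S θ ≤ M.objective R S θ' := by
  have hcomp : IsCompact {θ : Param p q | frobDist θ M.theta ≤ M.r1 ∧ θ.1.IsSymm} :=
    (isCompact_frobDist_ball M.theta h.r1_pos.le).inter_right
      (isClosed_eq continuous_fst.matrix_transpose continuous_fst)
  have hmem : M.theta ∈ {θ : Param p q | frobDist θ M.theta ≤ M.r1 ∧ θ.1.IsSymm} :=
    ⟨(frobDist_self _).trans_le h.r1_pos.le, isHermitian_iff_isSymm.1 h.Oyy_posDef.1⟩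
  obtain ⟨θ, hθ, hmin⟩ := hcomp.exists_isMinOn ⟨_, hmem⟩
    ((continuousOn_objective hβ R S).mono fun θ hθ => posDef_of_frobDist_le h hθ.2 hθ.1)
  exact ⟨θ, posDef_of_frobDist_le h hθ.2 hθ.1,
    fun θ' hθ' hr => hmin ⟨hr, isHermitian_iff_isSymm.1 hθ'.1⟩⟩

section Estimator

variable (hSig : M.Sig.PosDef) (hL : M.L.PosSemidef) (hβ : 1 ≤ M.β) (h : M.H1) (hT : T.Valid)
  (hG : M.IsGood S s H) (hA : M.IsAdmissible T R S s εS εL)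

include hSig hL hβ h hT hG hA

lemma objective_theta_lt (hr : T.cLamMu * H * √M.cardS / M.gam R εS εL < M.r1)
    {θ : Param p q} (hθ : θ.1.PosDef)
    (hlt : T.cLamMu * H * √M.cardS / M.gam R εS εL < frobDist θ M.theta) :
    M.objective R S M.theta < M.objective R S θ := by
  have hnorm (t : ℝ) (ht : 0 ≤ t) (Δ : Param p q) : √(normSq (t • Δ)) = t * √(normSq Δ) := by
    rw [normSq_smul, Real.sqrt_mul (sq_nonneg t), Real.sqrt_sq ht]
  have hconv := convexOn_objective hG.posSemidef hL hβ (hA.inBand.lam_nonneg hT)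
    (hA.inBand.mu_nonneg hT) hA.inBand.eta_mem.1
  rw [frobDist_eq] at hlt
  refine lt_of_convexOn_of_lt_in_ball (N := fun Δ => √(normSq Δ)) hnorm hconv h.Oyy_posDef
    h.r1_pos hr (fun θ' hθ' hball hout => ?_) hθ hlt
  have hsymm : (θ' - M.theta).1.IsSymm := isHermitian_iff_isSymm.1 (hθ'.1.sub h.Oyy_posDef.1)
  simpa only [add_sub_cancel] using objective_theta_lt_objective_add hSig hL hβ h hT hG hA hsymm
    ((Real.sqrt_le_left h.r1_pos.le).1 hball) hout

lemma exists_isEstimator_and_frobDist_le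
    (hr : T.cLamMu * H * √M.cardS / M.gam R εS εL < M.r1) :
    (∃ θ, M.IsEstimator R S θ) ∧ ∀ θ, M.IsEstimator R S θ →
      frobDist θ M.theta ≤ T.cLamMu * H * √M.cardS / M.gam R εS εL := by
  have hout {θ : Param p q} := objective_theta_lt hSig hL hβ h hT hG hA hr (θ := θ)
  obtain ⟨θ₀, hθ₀, hmin⟩ := exists_isMinOn_objective hβ h R S
  refine ⟨⟨θ₀, hθ₀, fun θ hθ => ?_⟩, fun θ hθ => ?_⟩
  · rcases le_or_gt (frobDist θ M.theta) M.r1 with hball | hball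
    · exact hmin θ hθ hball
    · exact (hmin _ h.Oyy_posDef ((frobDist_self _).trans_le h.r1_pos.le)).trans
        (hout hθ (hr.trans hball)).le
  · by_contra! hlt
    exact (hout hθ.1 hlt).not_ge (hθ.2 M.theta h.Oyy_posDef)

end Estimator

lemma lamMax_L_pos (h : M.H1) (hL : M.L.IsHermitian) : 0 < lamMax M.L := by
  have hdiag : 0 ≤ (M.Oyx * (lamMax M.L • (1 : Matrix (Fin p) (Fin p) ℝ)) * M.Oyxᵀ
      - M.Oyx * M.L * M.Oyxᵀ) ⟨0, h.q_pos⟩ ⟨0, h.q_pos⟩ :=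
    (Matrix.le_iff.1 (conj_le_conj (le_lamMax_smul_one hL) M.Oyx)).diag_nonneg
  have hOLO := h.OLO_posDef.diag_pos (i := ⟨0, h.q_pos⟩)
  have hOO := (posSemidef_conj (PosSemidef.one (n := Fin p) (R := ℝ)) M.Oyx).diag_nonneg
    (i := ⟨0, h.q_pos⟩)
  rw [Matrix.mul_smul, Matrix.smul_mul, Matrix.sub_apply, Matrix.smul_apply, smul_eq_mul,
    sub_nonneg] at hdiag
  exact pos_of_mul_pos_left (hOLO.trans_le hdiag) hOO

open scoped Matrix.Norms.L2Operator in
lemma specNorm_pos {k l : ℕ} {A : Matrix (Fin k) (Fin l) ℝ} (hA : A ≠ 0) : 0 < specNorm A :=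
  norm_pos_iff.2 hA

lemma rStar_pos (hL : M.L.IsHermitian) (h : M.H1) : 0 < M.rStar := by
  have hOyy := lamMin_pos h.Oyy_posDef h.q_pos
  have hOSO := lamMax_pos h.OSO_posDef h.q_pos
  have hSxx := lamMax_pos h.Sxx_posDef h.p_pos
  have hOLOmin := lamMin_pos h.OLO_posDef h.q_pos
  have hOLOmax := lamMax_pos h.OLO_posDef h.q_pos
  have hLmax := lamMax_L_pos h hL
  have : (0 : ℝ) < √10 - √7 := sub_pos.2 (Real.sqrt_lt_sqrt (by norm_num) (by norm_num))
  have : (0 : ℝ) < √2 - 1 := sub_pos.2 (Real.lt_sqrt_of_sq_lt (by norm_num))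
  have hLO : 0 < specNorm (M.L * M.Oyxᵀ) := by
    refine specNorm_pos fun h0 => ?_
    have := h.OLO_posDef.diag_pos (i := ⟨0, h.q_pos⟩)
    rw [Matrix.mul_assoc, h0, Matrix.mul_zero] at this
    exact lt_irrefl _ this
  rw [rStar, r1, r2, r3, r4]
  refine lt_min (lt_min ?_ ?_) (lt_min ?_ ?_) <;> positivity

lemma errorBound_lt_rStar {b₁ b₃ : ℝ} {n : ℕ} (hr : 0 < M.rStar) (hγ : 0 < M.gam R εS εL)
    (hlog : 0 ≤ logTerm p q b₃) (hn : M.nZero T R εS εL b₁ b₃ < n) :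
    M.errorBound T R εS εL b₃ n < M.rStar := by
  have hn₀ : (0 : ℝ) < n :=
    hlog.trans_lt (((le_max_right _ _).trans (le_max_right _ _)).trans_lt hn)
  have hmain := (le_max_left _ _).trans_lt hn
  rw [div_lt_iff₀ (by positivity)] at hmain
  refine lt_of_pow_lt_pow_left₀ 2 hr.le ?_
  rw [errorBound, mul_pow, div_pow, mul_pow, mul_pow, Real.sq_sqrt (Nat.cast_nonneg _),
    Real.sq_sqrt (by positivity), div_mul_div_comm, div_lt_iff₀ (by positivity)]
  linarith

lemma errorBound_eq (T : Tuning) (R : Reg) (εS εL b₃ : ℝ) (n : ℕ) :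
    M.errorBound T R εS εL b₃ n = T.cLamMu * (16 * M.mStar * √(logTerm p q b₃ / n)) * √M.cardS
      / M.gam R εS εL := by
  rw [errorBound]
  ring

lemma exists_isEstimator_and_frobDist_le_errorBound (hSig : M.Sig.PosDef) (hL : M.L.PosSemidef)
    (hβ : 1 ≤ M.β) (h : M.H1) (hT : T.Valid) {b₁ b₃ : ℝ} {n : ℕ} (hlog : 0 ≤ logTerm p q b₃)
    (hG : M.IsGood S s (16 * M.mStar * √(logTerm p q b₃ / n)))
    (hA : M.IsAdmissible T R S s εS εL) (hn : M.nZero T R εS εL b₁ b₃ < n) :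
    (∃ θ, M.IsEstimator R S θ) ∧
      ∀ θ, M.IsEstimator R S θ → frobDist θ M.theta ≤ M.errorBound T R εS εL b₃ n := by
  have hr := (errorBound_lt_rStar (rStar_pos hL.1 h) (hA.gam_pos hL hβ h) hlog hn).trans_le
    ((min_le_left _ _).trans (min_le_left _ _))
  rw [errorBound_eq] at hr ⊢
  exact exists_isEstimator_and_frobDist_le hSig hL hβ h hT hG hA hr

end Model

/-! ### Nets -/

section Net

open Metric Module NNReal

lemma card_le_of_isSeparated {E : Type*} [NormedAddCommGroup E] [NormedSpace ℝ E]
    [FiniteDimensional ℝ E] {s : Finset E} {δ : ℝ≥0} (hδ : 0 < δ)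
    (hs : (s : Set E) ⊆ closedBall 0 1) (hsep : IsSeparated δ (s : Set E)) :
    (s.card : ℝ) ≤ (1 + 2 / δ) ^ finrank ℝ E := by
  borelize E
  let μ : Measure E := Measure.addHaar
  have hdisj : (s : Set E).PairwiseDisjoint fun c => ball c (δ / 2 : ℝ) := fun c hc d hd hcd => by
    refine ball_disjoint_ball ?_
    have : (δ : ENNReal) < edist c d := hsep hc hd hcd
    rw [edist_nndist, ENNReal.coe_lt_coe] at this
    rw [add_halves]
    exact this.le
  have hsub : (⋃ c ∈ s, ball c (δ / 2 : ℝ)) ⊆ ball 0 (1 + δ / 2 : ℝ) :=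
    Set.iUnion₂_subset fun c hc => ball_subset_ball' <| by
      linarith [mem_closedBall.1 (hs hc)]
  have hvol : s.card * ENNReal.ofReal ((δ / 2 : ℝ) ^ finrank ℝ E) * μ (ball 0 1) ≤
      ENNReal.ofReal ((1 + δ / 2 : ℝ) ^ finrank ℝ E) * μ (ball 0 1) := by
    rw [← μ.addHaar_ball_of_pos _ (by positivity)]
    refine le_trans (le_of_eq ?_) (measure_mono hsub)
    rw [measure_biUnion_finset hdisj fun c _ => measurableSet_ball]
    simp only [μ.addHaar_ball_of_pos _ (show (0 : ℝ) < δ / 2 by positivity), Finset.sum_const,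
      nsmul_eq_mul, mul_assoc]
  have hcard := ENNReal.toReal_le_of_le_ofReal (by positivity)
    ((ENNReal.mul_le_mul_iff_left (measure_ball_pos _ _ zero_lt_one).ne'
      measure_ball_lt_top.ne).1 hvol)
  rw [ENNReal.toReal_mul, ENNReal.toReal_ofReal (by positivity), ENNReal.toReal_natCast,
    ← le_div_iff₀ (by positivity), ← div_pow] at hcard
  refine hcard.trans_eq (congrArg (· ^ _) ?_)
  have : (δ : ℝ) ≠ 0 := by positivity
  field_simp
  ring

lemma packingNumber_closedBall_le (E : Type*) [NormedAddCommGroup E] [NormedSpace ℝ E]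
    [FiniteDimensional ℝ E] {δ : ℝ≥0} (hδ : 0 < δ) :
    packingNumber δ (closedBall (0 : E) 1) ≤ ⌊(1 + 2 / δ : ℝ) ^ finrank ℝ E⌋₊ := by
  refine iSup₂_le fun C hC => iSup_le fun hsep => ?_
  by_contra! hlt
  obtain ⟨s, hsC, hcard⟩ := Set.exists_subset_encard_eq (Order.add_one_le_of_lt hlt)
  lift s to Finset E using Set.finite_of_encard_eq_coe hcard
  rw [Set.encard_coe_eq_coe_finsetCard] at hcard
  have := Nat.le_floor (card_le_of_isSeparated hδ (hsC.trans hC) (hsep.subset hsC))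
  have : s.card = ⌊(1 + 2 / δ : ℝ) ^ finrank ℝ E⌋₊ + 1 := by exact_mod_cast hcard
  omega

lemma exists_isCover_closedBall (E : Type*) [NormedAddCommGroup E] [NormedSpace ℝ E]
    [FiniteDimensional ℝ E] {δ : ℝ≥0} (hδ : 0 < δ) :
    ∃ N : Finset E, (N : Set E) ⊆ closedBall 0 1 ∧ IsCover δ (closedBall (0 : E) 1) N ∧
      (N.card : ℝ) ≤ (1 + 2 / δ) ^ finrank ℝ E := by
  have hpack := packingNumber_closedBall_le E hδ
  have hne : packingNumber δ (closedBall (0 : E) 1) ≠ ⊤ :=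
    ne_top_of_le_ne_top (ENat.natCast_ne_top _) hpack
  rw [← encard_maximalSeparatedSet hne] at hpack
  have hcover := isCover_maximalSeparatedSet hne
  have hsub := maximalSeparatedSet_subset (ε := δ) (A := closedBall (0 : E) 1)
  lift maximalSeparatedSet δ (closedBall (0 : E) 1) to Finset E using
    Set.finite_of_encard_le_coe hpack with N
  rw [Set.encard_coe_eq_coe_finsetCard, Nat.cast_le] at hpack
  exact ⟨N, hsub, hcover, (Nat.le_floor_iff (by positivity)).1 hpack⟩

variable {m : Type*} [Fintype m]

/-- The finite set `N` is a `δ`-net of the unit ball of `F` for the norm `x ↦ √(xᵀ A x)`. -/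
structure IsQuadNet (A : Matrix m m ℝ) (F : Submodule ℝ (m → ℝ)) (δ : ℝ)
    (N : Finset (m → ℝ)) : Prop where
  mem : ∀ y ∈ N, y ∈ F
  quad_le_one : ∀ y ∈ N, y ⬝ᵥ A *ᵥ y ≤ 1
  exists_quad_sub_le : ∀ x ∈ F, x ⬝ᵥ A *ᵥ x ≤ 1 → ∃ y ∈ N, (x - y) ⬝ᵥ A *ᵥ (x - y) ≤ δ ^ 2

lemma exists_isQuadNet {A : Matrix m m ℝ} (hA : A.PosSemidef) (F : Submodule ℝ (m → ℝ)) {δ : ℝ}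
    (hδ : 0 < δ) : ∃ N, IsQuadNet A F δ N ∧ (N.card : ℝ) ≤ (1 + 2 / δ) ^ finrank ℝ F := by
  classical
  lift δ to ℝ≥0 using hδ.le
  obtain ⟨C, rfl⟩ := CStarAlgebra.nonneg_iff_eq_star_mul_self.1 hA.nonneg
  let φ : (m → ℝ) →ₗ[ℝ] EuclideanSpace ℝ m :=
    (WithLp.linearEquiv 2 ℝ (m → ℝ)).symm.toLinearMap ∘ₗ C.mulVecLin
  have hφ (x) : ‖φ x‖ ^ 2 = x ⬝ᵥ (star C * C) *ᵥ x := by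
    rw [EuclideanSpace.real_norm_sq_eq, star_eq_conjTranspose,
      conjTranspose_eq_transpose_of_trivial, ← mulVec_mulVec, dotProduct_mulVec, vecMul_transpose]
    exact Finset.sum_congr rfl fun i _ => sq _
  obtain ⟨N, hsub, hcover, hcard⟩ :=
    exists_isCover_closedBall (F.map φ) (δ := δ) (by exact_mod_cast hδ)
  choose g hgF hg using fun y : F.map φ => Submodule.mem_map.1 y.2
  refine ⟨N.image g, ⟨?_, ?_, fun x hx hx1 => ?_⟩, ?_⟩
  · simpa only [Finset.forall_mem_image] using fun y _ => hgF y
  · simp only [Finset.forall_mem_image]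
    intro y hy
    rw [← hφ, hg]
    exact pow_le_one₀ (norm_nonneg _) (mem_closedBall_zero_iff.1 (hsub hy))
  · rw [← hφ] at hx1
    obtain ⟨y, hy, (hxy : edist _ _ ≤ _)⟩ := hcover (x := ⟨φ x, Submodule.mem_map_of_mem hx⟩)
      (mem_closedBall_zero_iff.2 ((pow_le_one_iff_of_nonneg (norm_nonneg _) two_ne_zero).1 hx1))
    refine ⟨g y, Finset.mem_image_of_mem g hy, ?_⟩
    rw [← hφ, map_sub, hg]
    refine pow_le_pow_left₀ (norm_nonneg _) ?_ 2
    rwa [edist_nndist, ENNReal.coe_le_coe, ← NNReal.coe_le_coe, coe_nndist, Subtype.dist_eq,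
      dist_eq_norm] at hxy
  · refine (Nat.cast_le.2 Finset.card_image_le).trans (hcard.trans ?_)
    exact pow_le_pow_right₀ (by linarith [show 0 ≤ 2 / (δ : ℝ) by positivity])
      (Submodule.finrank_map_le φ F)

end Net

/-! ### Quadratic forms on a net -/

section Quad

variable {m : Type*} [Fintype m]

lemma quad_add (D : Matrix m m ℝ) (x y : m → ℝ) :
    (x + y) ⬝ᵥ D *ᵥ (x + y) = x ⬝ᵥ D *ᵥ x + x ⬝ᵥ D *ᵥ y + y ⬝ᵥ D *ᵥ x + y ⬝ᵥ D *ᵥ y := by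
  simp only [mulVec_add, add_dotProduct, dotProduct_add]; ring

lemma quad_sub (D : Matrix m m ℝ) (x y : m → ℝ) :
    (x - y) ⬝ᵥ D *ᵥ (x - y) = x ⬝ᵥ D *ᵥ x - x ⬝ᵥ D *ᵥ y - y ⬝ᵥ D *ᵥ x + y ⬝ᵥ D *ᵥ y := by
  simp only [mulVec_sub, sub_dotProduct, dotProduct_sub]; ring

lemma quad_smul (D : Matrix m m ℝ) (c : ℝ) (x : m → ℝ) :
    (c • x) ⬝ᵥ D *ᵥ (c • x) = c ^ 2 * (x ⬝ᵥ D *ᵥ x) := by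
  simp only [mulVec_smul, smul_dotProduct, dotProduct_smul, smul_eq_mul]; ring

lemma bilin_comm {D : Matrix m m ℝ} (hD : D.IsSymm) (x y : m → ℝ) :
    x ⬝ᵥ D *ᵥ y = y ⬝ᵥ D *ᵥ x := by
  rw [← dotProduct_transpose_mulVec, hD.eq]

lemma bilin_sub_add {D : Matrix m m ℝ} (hD : D.IsSymm) (x y : m → ℝ) :
    (x - y) ⬝ᵥ D *ᵥ (x + y) = x ⬝ᵥ D *ᵥ x - y ⬝ᵥ D *ᵥ y := by
  rw [mulVec_add, sub_dotProduct, dotProduct_add, dotProduct_add, bilin_comm hD y x]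
  ring

lemma exists_abs_quad_le {A D : Matrix m m ℝ} (hA : A.PosDef) (hD : D.IsSymm) :
    ∃ K : ℝ, 0 ≤ K ∧ ∀ x : m → ℝ, |x ⬝ᵥ D *ᵥ x| ≤ K * (x ⬝ᵥ A *ᵥ x) := by
  classical
  obtain ⟨C, ν, h⟩ := exists_simulDiag hA (isHermitian_iff_isSymm.2 hD)
  have hquad (d : m → ℝ) (x : m → ℝ) :
      x ⬝ᵥ (Cᵀ * diagonal d * C) *ᵥ x = ∑ i, d i * (C *ᵥ x) i ^ 2 := by
    rw [Matrix.mul_assoc, ← mulVec_mulVec, dotProduct_transpose_mulVec, ← mulVec_mulVec,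
      dotProduct_comm, dotProduct]
    refine Finset.sum_congr rfl fun i _ => ?_
    rw [mulVec_diagonal]
    ring
  refine ⟨∑ i, |ν i|, Finset.sum_nonneg fun _ _ => abs_nonneg _, fun x => ?_⟩
  rw [h.left_eq, h.right_eq, ← diagonal_one, hquad, hquad, Finset.mul_sum]
  refine (Finset.abs_sum_le_sum_abs _ _).trans (Finset.sum_le_sum fun i _ => ?_)
  rw [abs_mul, abs_of_nonneg (sq_nonneg ((C *ᵥ x) i)), one_mul]
  gcongr
  exact Finset.single_le_sum (f := fun j => |ν j|) (fun _ _ => abs_nonneg _) (Finset.mem_univ i)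

variable {A D : Matrix m m ℝ} {F : Submodule ℝ (m → ℝ)} {K : ℝ}

lemma abs_bilin_le (hD : D.IsSymm) (hK0 : 0 ≤ K)
    (hK : ∀ x ∈ F, |x ⬝ᵥ D *ᵥ x| ≤ K * (x ⬝ᵥ A *ᵥ x)) {x y : m → ℝ} (hx : x ∈ F) (hy : y ∈ F)
    (hx1 : x ⬝ᵥ A *ᵥ x ≤ 1) (hy1 : y ⬝ᵥ A *ᵥ y ≤ 1) : |x ⬝ᵥ D *ᵥ y| ≤ K := by
  have hadd := abs_le.1 (hK _ (F.add_mem hx hy))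
  have hsub := abs_le.1 (hK _ (F.sub_mem hx hy))
  rw [quad_add, quad_add, bilin_comm hD y] at hadd
  rw [quad_sub, quad_sub, bilin_comm hD y] at hsub
  have := mul_le_mul_of_nonneg_left (add_le_add hx1 hy1) hK0
  rw [abs_le]
  constructor <;> linarith

lemma abs_quad_le_mul_quad (hA : A.PosDef) (hK : ∀ x ∈ F, x ⬝ᵥ A *ᵥ x ≤ 1 → |x ⬝ᵥ D *ᵥ x| ≤ K)
    {x : m → ℝ} (hx : x ∈ F) : |x ⬝ᵥ D *ᵥ x| ≤ K * (x ⬝ᵥ A *ᵥ x) := by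
  rcases eq_or_ne x 0 with rfl | hx0
  · simp
  have hpos : 0 < x ⬝ᵥ A *ᵥ x := by simpa using hA.dotProduct_mulVec_pos hx0
  have hnorm : (√(x ⬝ᵥ A *ᵥ x))⁻¹ ^ 2 = (x ⬝ᵥ A *ᵥ x)⁻¹ := by rw [inv_pow, Real.sq_sqrt hpos.le]
  have := hK _ (F.smul_mem (√(x ⬝ᵥ A *ᵥ x))⁻¹ hx) (by
    rw [quad_smul, hnorm, inv_mul_cancel₀ hpos.ne'])
  rwa [quad_smul, hnorm, abs_mul, abs_of_pos (inv_pos.2 hpos), inv_mul_le_iff₀ hpos,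
    mul_comm] at this

namespace IsQuadNet

variable {δ ε : ℝ} {N : Finset (m → ℝ)}

lemma abs_quad_le_add_mul (hN : IsQuadNet A F δ N) (hA : A.PosDef) (hD : D.IsSymm) (hδ : 0 < δ)
    (hDN : ∀ y ∈ N, |y ⬝ᵥ D *ᵥ y| ≤ ε) (hK0 : 0 ≤ K)
    (hK : ∀ x ∈ F, |x ⬝ᵥ D *ᵥ x| ≤ K * (x ⬝ᵥ A *ᵥ x)) {x : m → ℝ} (hx : x ∈ F) :
    |x ⬝ᵥ D *ᵥ x| ≤ (ε + 2 * δ * K) * (x ⬝ᵥ A *ᵥ x) := by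
  refine abs_quad_le_mul_quad hA (fun x hx hx1 => ?_) hx
  obtain ⟨y, hy, hxy⟩ := hN.exists_quad_sub_le x hx hx1
  have hyF := hN.mem y hy
  have hsum : (x + y) ⬝ᵥ A *ᵥ (x + y) ≤ 4 := by
    have := quad_nonneg hA.posSemidef (x - y)
    have := hN.quad_le_one y hy
    rw [quad_sub] at *
    rw [quad_add]
    linarith
  have hbil := abs_bilin_le hD hK0 hK (F.smul_mem δ⁻¹ (F.sub_mem hx hyF))
    (F.smul_mem 2⁻¹ (F.add_mem hx hyF))
    (by rwa [quad_smul, inv_pow, inv_mul_le_iff₀ (by positivity), mul_one])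
    (by rw [quad_smul]; linarith)
  rw [mulVec_smul, smul_dotProduct, dotProduct_smul, bilin_sub_add hD, smul_smul, smul_eq_mul,
    abs_mul, abs_of_pos (by positivity), ← mul_inv, inv_mul_le_iff₀ (by positivity)] at hbil
  calc |x ⬝ᵥ D *ᵥ x| = |y ⬝ᵥ D *ᵥ y + (x ⬝ᵥ D *ᵥ x - y ⬝ᵥ D *ᵥ y)| := by rw [add_sub_cancel]
    _ ≤ ε + δ * 2 * K := (abs_add_le _ _).trans (add_le_add (hDN y hy) hbil)
    _ = _ := by ring

lemma abs_quad_le (hN : IsQuadNet A F δ N) (hA : A.PosDef) (hD : D.IsSymm) (hδ : 0 < δ)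
    (hδ2 : δ < 1 / 2) (hε : 0 ≤ ε) (hDN : ∀ y ∈ N, |y ⬝ᵥ D *ᵥ y| ≤ ε) {x : m → ℝ} (hx : x ∈ F) :
    |x ⬝ᵥ D *ᵥ x| ≤ ε / (1 - 2 * δ) * (x ⬝ᵥ A *ᵥ x) := by
  have hδ' : 0 < 1 - 2 * δ := by linarith
  obtain ⟨K, hK0, hK⟩ := exists_abs_quad_le hA hD
  have hiter (n : ℕ) : ∀ x ∈ F,
      |x ⬝ᵥ D *ᵥ x| ≤ (ε / (1 - 2 * δ) + (2 * δ) ^ n * K) * (x ⬝ᵥ A *ᵥ x) := by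
    induction n with
    | zero =>
      refine fun x _ => (hK x).trans (mul_le_mul_of_nonneg_right ?_ (quad_nonneg hA.posSemidef x))
      have : 0 ≤ ε / (1 - 2 * δ) := by positivity
      linarith
    | succ n ih =>
      refine fun x hx => (hN.abs_quad_le_add_mul hA hD hδ hDN (by positivity) ih hx).trans_eq ?_
      field_simp
      ring
  have hpow := tendsto_pow_atTop_nhds_zero_of_lt_one (r := 2 * δ) (by positivity) (by linarith)
  have hlim := ((hpow.mul_const K).const_add (ε / (1 - 2 * δ))).mul_const (x ⬝ᵥ A *ᵥ x)
  rw [zero_mul, add_zero] at hlim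
  exact ge_of_tendsto' hlim fun n => hiter n x hx

end IsQuadNet

end Quad

/-! ### From sparse to arbitrary vectors -/

section Sparse

variable {m ι : Type*}

/-- The span of the coordinate vectors with index in the range of `f`; every `k`-sparse vector is in
one of these subspaces. -/
def coordSpan [DecidableEq m] {k : ℕ} (f : Fin k → m) : Submodule ℝ (m → ℝ) :=
  Submodule.span ℝ (Set.range fun i => Pi.single (f i) 1)

lemma finrank_coordSpan_le [DecidableEq m] {k : ℕ} (f : Fin k → m) :
    Module.finrank ℝ (coordSpan f) ≤ k :=
  (finrank_range_le_card _).trans_eq (Fintype.card_fin k)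

variable [Fintype m] [Fintype ι]

lemma sum_mul_quad_add (Q : Matrix m m ℝ) {w : ι → ℝ} (hw : ∑ i, w i = 1) (x : ι → m → ℝ)
    (y : m → ℝ) : ∑ i, w i * ((y + x i) ⬝ᵥ Q *ᵥ (y + x i)) =
      (y + ∑ i, w i • x i) ⬝ᵥ Q *ᵥ (y + ∑ i, w i • x i) +
        (∑ i, w i * (x i ⬝ᵥ Q *ᵥ x i) - (∑ i, w i • x i) ⬝ᵥ Q *ᵥ ∑ i, w i • x i) := by
  have hyx : y ⬝ᵥ Q *ᵥ (∑ i, w i • x i) = ∑ i, w i * (y ⬝ᵥ Q *ᵥ x i) := by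
    simp only [mulVec_sum, dotProduct_sum, mulVec_smul, dotProduct_smul, smul_eq_mul]
  have hxy : (∑ i, w i • x i) ⬝ᵥ Q *ᵥ y = ∑ i, w i * (x i ⬝ᵥ Q *ᵥ y) := by
    simp only [sum_dotProduct, smul_dotProduct, smul_eq_mul]
  have hyy : y ⬝ᵥ Q *ᵥ y = ∑ i, w i * (y ⬝ᵥ Q *ᵥ y) := by rw [← Finset.sum_mul, hw, one_mul]
  rw [quad_add Q y (∑ i, _), hyx, hxy, hyy]
  simp only [quad_add, mul_add, Finset.sum_add_distrib]
  ring

/- Maurey's empirical method: replace the `k` copies of the mean by independent samples of the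
atoms, one after the other; each replacement changes the mean value by the variance. -/
lemma quad_add_smul_sum_nonneg (Q : Matrix m m ℝ) {w : ι → ℝ} (hw0 : ∀ i, 0 ≤ w i)
    (hw1 : ∑ i, w i = 1) (x : ι → m → ℝ) (k : ℕ) (u : m → ℝ)
    (h : ∀ f : Fin k → ι, 0 ≤ (u + ∑ i, x (f i)) ⬝ᵥ Q *ᵥ (u + ∑ i, x (f i))) :
    0 ≤ (u + (k : ℝ) • ∑ i, w i • x i) ⬝ᵥ Q *ᵥ (u + (k : ℝ) • ∑ i, w i • x i) +
      k * (∑ i, w i * (x i ⬝ᵥ Q *ᵥ x i) - (∑ i, w i • x i) ⬝ᵥ Q *ᵥ ∑ i, w i • x i) := by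
  induction k generalizing u with
  | zero => simpa using h Fin.elim0
  | succ k ih =>
    set v := ∑ i, w i • x i
    set D := ∑ i, w i * (x i ⬝ᵥ Q *ᵥ x i) - v ⬝ᵥ Q *ᵥ v
    have hstep (i) : 0 ≤ (u + (k : ℝ) • v + x i) ⬝ᵥ Q *ᵥ (u + (k : ℝ) • v + x i) + k * D := by
      rw [add_right_comm]
      refine ih (u + x i) fun f => ?_
      simpa only [Fin.sum_univ_succ, Fin.cons_zero, Fin.cons_succ, ← add_assoc] using
        h (Fin.cons i f)
    calc 0 ≤ ∑ i, w i * ((u + (k : ℝ) • v + x i) ⬝ᵥ Q *ᵥ (u + (k : ℝ) • v + x i) + k * D) :=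
          Finset.sum_nonneg fun i _ => mul_nonneg (hw0 i) (hstep i)
      _ = _ := by
          simp only [mul_add (w _), Finset.sum_add_distrib, ← Finset.sum_mul, hw1,
            sum_mul_quad_add Q hw1]
          push_cast
          rw [add_smul, one_smul, add_assoc u]
          ring

variable [DecidableEq m]

/-- The atoms `± ‖v‖₁ eⱼ` of which `v` is an average with weights `|vⱼ| / ‖v‖₁`. -/
noncomputable def l1Atom (v : m → ℝ) (j : m) : m → ℝ :=
  Pi.single j ((∑ i, |v i|) * SignType.sign (v j))

lemma sum_smul_l1Atom {v : m → ℝ} (hv : ∑ i, |v i| ≠ 0) :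
    ∑ j, (|v j| / ∑ i, |v i|) • l1Atom v j = v := by
  refine Eq.trans (Finset.sum_congr rfl fun j _ => ?_) (Finset.univ_sum_single v)
  rw [l1Atom, ← Pi.single_smul, smul_eq_mul]
  congr 1
  calc _ = (SignType.sign (v j) : ℝ) * |v j| := by field_simp
    _ = v j := sign_mul_abs _

lemma quad_l1Atom_le {Q : Matrix m m ℝ} {c : ℝ} (hc : ∀ j, Q j j ≤ c) (v : m → ℝ) {j : m}
    (hj : v j ≠ 0) : l1Atom v j ⬝ᵥ Q *ᵥ l1Atom v j ≤ c * (∑ i, |v i|) ^ 2 := by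
  have hsign : (SignType.sign (v j) : ℝ) ^ 2 = 1 := by
    rcases hj.lt_or_gt with h | h <;> simp [h]
  calc _ = Q j j * (∑ i, |v i|) ^ 2 * (SignType.sign (v j) : ℝ) ^ 2 := by
        simp only [l1Atom, mulVec_single, single_dotProduct, Pi.smul_apply, col_apply,
          MulOpposite.smul_eq_mul_unop, MulOpposite.unop_op]
        ring
    _ ≤ _ := by
        rw [hsign, mul_one]
        exact mul_le_mul_of_nonneg_right (hc j) (sq_nonneg _)

lemma neg_div_le_quad_of_sparse {Q : Matrix m m ℝ} {k : ℕ} (hk : 2 ≤ k) {c : ℝ}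
    (hc : ∀ j, Q j j ≤ c) (h : ∀ f : Fin k → m, ∀ x ∈ coordSpan f, 0 ≤ x ⬝ᵥ Q *ᵥ x)
    (v : m → ℝ) : -(c * (∑ j, |v j|) ^ 2 / (k - 1)) ≤ v ⬝ᵥ Q *ᵥ v := by
  have hk1 : (0 : ℝ) < k - 1 := sub_pos.2 (by exact_mod_cast hk)
  set l := ∑ j, |v j| with hl
  rcases (Finset.sum_nonneg fun j _ => abs_nonneg (v j) : 0 ≤ l).eq_or_lt with h0 | h0
  · have hv : v = 0 := by
      funext j
      simpa using (Finset.sum_eq_zero_iff_of_nonneg fun j _ => abs_nonneg (v j)).1 h0.symm j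
        (Finset.mem_univ j)
    rw [hl, ← h0, hv]
    simp
  have hw1 : ∑ j, |v j| / l = 1 := by rw [← Finset.sum_div, ← hl, div_self h0.ne']
  have hmaurey := quad_add_smul_sum_nonneg Q (fun j => by positivity) hw1 (l1Atom v) k 0 fun f => by
    rw [zero_add]
    refine h f _ (Submodule.sum_mem _ fun i _ => ?_)
    have := (coordSpan f).smul_mem (l * SignType.sign (v (f i)))
      (Submodule.subset_span (Set.mem_range_self i))
    rwa [← Pi.single_smul, smul_eq_mul, mul_one] at this
  rw [sum_smul_l1Atom h0.ne', zero_add, quad_smul] at hmaurey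
  have hvar : ∑ j, |v j| / l * (l1Atom v j ⬝ᵥ Q *ᵥ l1Atom v j) ≤ c * l ^ 2 :=
    calc _ ≤ ∑ j, |v j| / l * (c * l ^ 2) := Finset.sum_le_sum fun j _ => by
          rcases eq_or_ne (v j) 0 with hj | hj
          · simp [hj]
          · exact mul_le_mul_of_nonneg_left (quad_l1Atom_le hc v hj) (by positivity)
      _ = c * l ^ 2 := by rw [← Finset.sum_mul, hw1, one_mul]
  rw [neg_le_iff_add_nonneg', div_add' _ _ _ hk1.ne']
  refine div_nonneg (nonneg_of_mul_nonneg_right (a := (k : ℝ)) ?_ (by linarith)) hk1.le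
  linarith [mul_le_mul_of_nonneg_left hvar (show (0 : ℝ) ≤ k by linarith)]

end Sparse

/-! ### Concentration of empirical variances -/

section ChiSquared

lemma integral_exp_mul_sq_gaussianReal {t : ℝ} (ht : t < 1 / 2) :
    ∫ x, Real.exp (t * x ^ 2) ∂(gaussianReal 0 1) = (√(1 - 2 * t))⁻¹ := by
  have hdensity : ∀ x : ℝ, gaussianPDFReal 0 1 x • Real.exp (t * x ^ 2)
      = (√(2 * Real.pi))⁻¹ * Real.exp (-(1 / 2 - t) * x ^ 2) := fun x => by
    rw [gaussianPDFReal, smul_eq_mul, mul_assoc, ← Real.exp_add]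
    simp only [NNReal.coe_one, mul_one, sub_zero]
    congr 2
    ring
  simp only [integral_gaussianReal_eq_integral_smul one_ne_zero, hdensity]
  rw [integral_const_mul, integral_gaussian, ← Real.sqrt_inv, ← Real.sqrt_mul (by positivity),
    ← Real.sqrt_inv]
  congr 1
  have : 1 / 2 - t ≠ 0 := by linarith
  have : 1 - 2 * t ≠ 0 := by linarith
  field_simp

lemma neg_log_one_sub_le {t : ℝ} (ht : |t| ≤ 1 / 3) :
    -Real.log (1 - 2 * t) ≤ 2 * (t + 3 * t ^ 2) := by
  obtain ⟨_, _⟩ := abs_le.1 ht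
  have hpos : 0 < 1 - 2 * t := by linarith
  rcases le_total 0 t with h0 | h0
  · have hlog := log_le_half_sub_inv (t := (1 - 2 * t)⁻¹) ((one_le_inv₀ hpos).2 (by linarith))
    rw [Real.log_inv, inv_inv] at hlog
    refine hlog.trans ?_
    rw [show (1 - 2 * t)⁻¹ - (1 - 2 * t) = 4 * t * (1 - t) / (1 - 2 * t) by field_simp; ring,
      div_div, div_le_iff₀ (by linarith)]
    nlinarith [mul_nonneg (sq_nonneg t) (by linarith : 0 ≤ 1 - 3 * t)]
  · have hlog := Real.le_log_one_add_of_nonneg (x := -(2 * t)) (by linarith)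
    rw [← sub_eq_add_neg] at hlog
    refine neg_le.1 (le_trans ?_ hlog)
    rw [le_div_iff₀ (by linarith)]
    nlinarith [mul_nonneg (sq_nonneg t) (by linarith : 0 ≤ -t)]

lemma inv_sqrt_one_sub_le_exp {t : ℝ} (ht : |t| ≤ 1 / 3) :
    (√(1 - 2 * t))⁻¹ ≤ Real.exp (t + 3 * t ^ 2) := by
  have hpos : 0 < 1 - 2 * t := by linarith [(abs_le.1 ht).2]
  rw [← Real.log_le_iff_le_exp (by positivity), Real.log_inv, Real.log_sqrt hpos.le]
  linarith [neg_log_one_sub_le ht]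

variable {Ω ι : Type*} [MeasurableSpace Ω] {P : Measure Ω} [Fintype ι] {X : ι → Ω → ℝ} {t u : ℝ}

local notation "N" => (Fintype.card ι : ℝ)

lemma mgf_sum_sq (hX : ∀ i, HasLaw (X i) (gaussianReal 0 1) P) (hi : iIndepFun X P)
    (ht : t < 1 / 2) :
    mgf (fun ω => ∑ i, X i ω ^ 2) P t = (√(1 - 2 * t))⁻¹ ^ Fintype.card ι := by
  have hi2 : iIndepFun (fun i ω => X i ω ^ 2) P :=
    hi.comp (fun _ x => x ^ 2) fun _ => measurable_id.pow_const 2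
  have hmgf : ∀ i, mgf (fun ω => X i ω ^ 2) P t = (√(1 - 2 * t))⁻¹ := fun i => by
    rw [mgf, ← integral_exp_mul_sq_gaussianReal ht]
    exact (hX i).integral_comp (f := fun x => Real.exp (t * x ^ 2))
      (by fun_prop : Measurable _).aestronglyMeasurable
  rw [← Finset.sum_fn, hi2.mgf_sum₀ fun i => (hX i).aemeasurable.pow_const 2]
  simp only [hmgf, Finset.prod_const, Finset.card_univ]

lemma integrable_exp_mul_sum_sq (hX : ∀ i, HasLaw (X i) (gaussianReal 0 1) P)
    (hi : iIndepFun X P) (ht : t < 1 / 2) :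
    Integrable (fun ω => Real.exp (t * ∑ i, X i ω ^ 2)) P := by
  by_contra hint
  have hmgf := mgf_sum_sq hX hi ht
  rw [mgf, integral_undef hint] at hmgf
  have : 0 < 1 - 2 * t := by linarith
  exact (by positivity : (√(1 - 2 * t))⁻¹ ^ Fintype.card ι ≠ 0) hmgf.symm

lemma mgf_sum_sq_le (hX : ∀ i, HasLaw (X i) (gaussianReal 0 1) P) (hi : iIndepFun X P)
    (ht : |t| ≤ 1 / 3) :
    mgf (fun ω => ∑ i, X i ω ^ 2) P t ≤ Real.exp (N * (t + 3 * t ^ 2)) := by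
  rw [mgf_sum_sq hX hi (by linarith [(abs_le.1 ht).2]), Real.exp_nat_mul]
  exact pow_le_pow_left₀ (by positivity) (inv_sqrt_one_sub_le_exp ht) _

variable [IsProbabilityMeasure P]

lemma measureReal_le_sum_sq_le (hX : ∀ i, HasLaw (X i) (gaussianReal 0 1) P)
    (hi : iIndepFun X P) (hu0 : 0 ≤ u) (hu1 : u ≤ 1) :
    P.real {ω | N + 4 * u * N ≤ ∑ i, X i ω ^ 2} ≤ Real.exp (-(N * u ^ 2)) := by
  have ht : |u / 3| ≤ 1 / 3 := by rw [abs_of_nonneg (by positivity)]; linarith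
  calc P.real {ω | N + 4 * u * N ≤ ∑ i, X i ω ^ 2}
      ≤ Real.exp (-(u / 3) * (N + 4 * u * N)) * mgf (fun ω => ∑ i, X i ω ^ 2) P (u / 3) :=
        measure_ge_le_exp_mul_mgf _ (by positivity)
          (integrable_exp_mul_sum_sq hX hi (by linarith))
    _ ≤ Real.exp (-(u / 3) * (N + 4 * u * N)) * Real.exp (N * (u / 3 + 3 * (u / 3) ^ 2)) := by
        gcongr
        exact mgf_sum_sq_le hX hi ht
    _ = Real.exp (-(N * u ^ 2)) := by
        rw [← Real.exp_add]
        congr 1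
        ring

lemma measureReal_sum_sq_le_le (hX : ∀ i, HasLaw (X i) (gaussianReal 0 1) P)
    (hi : iIndepFun X P) (hu0 : 0 ≤ u) (hu1 : u ≤ 1) :
    P.real {ω | ∑ i, X i ω ^ 2 ≤ N - 4 * u * N} ≤ Real.exp (-(N * u ^ 2)) := by
  have ht : |-(u / 3)| ≤ 1 / 3 := by rw [abs_neg, abs_of_nonneg (by positivity)]; linarith
  calc P.real {ω | ∑ i, X i ω ^ 2 ≤ N - 4 * u * N}
      ≤ Real.exp (- -(u / 3) * (N - 4 * u * N)) * mgf (fun ω => ∑ i, X i ω ^ 2) P (-(u / 3)) :=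
        measure_le_le_exp_mul_mgf _ (by linarith)
          (integrable_exp_mul_sum_sq hX hi (by linarith))
    _ ≤ Real.exp (- -(u / 3) * (N - 4 * u * N))
          * Real.exp (N * (-(u / 3) + 3 * (-(u / 3)) ^ 2)) := by
        gcongr
        exact mgf_sum_sq_le hX hi ht
    _ = Real.exp (-(N * u ^ 2)) := by
        rw [← Real.exp_add]
        congr 1
        ring

lemma measureReal_lt_abs_sum_sq_sub_le (hX : ∀ i, HasLaw (X i) (gaussianReal 0 1) P)
    (hi : iIndepFun X P) (hu0 : 0 ≤ u) (hu1 : u ≤ 1) :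
    P.real {ω | 4 * u * N < |∑ i, X i ω ^ 2 - N|} ≤ 2 * Real.exp (-(N * u ^ 2)) := by
  have hsub : {ω | 4 * u * N < |∑ i, X i ω ^ 2 - N|}
      ⊆ {ω | N + 4 * u * N ≤ ∑ i, X i ω ^ 2} ∪ {ω | ∑ i, X i ω ^ 2 ≤ N - 4 * u * N} := by
    intro ω hω
    rcases lt_abs.1 (Set.mem_ofPred.1 hω) with h | h
    · exact Or.inl (Set.mem_ofPred.2 (by linarith))
    · exact Or.inr (Set.mem_ofPred.2 (by linarith))
  rw [two_mul]
  exact (measureReal_mono hsub).trans ((measureReal_union_le _ _).trans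
    (add_le_add (measureReal_le_sum_sq_le hX hi hu0 hu1) (measureReal_sum_sq_le_le hX hi hu0 hu1)))

end ChiSquared

section Gaussian

variable {Ω m : Type*} [MeasurableSpace Ω] {P : Measure Ω} [Fintype m] [DecidableEq m]

lemma hasLaw_sum_mul {A : Matrix m m ℝ} (hA : A.PosSemidef) {Z : Ω → EuclideanSpace ℝ m}
    (hZ : HasLaw Z (multivariateGaussian 0 A) P) (w : m → ℝ) :
    HasLaw (fun ω => ∑ a, w a * Z ω a) (gaussianReal 0 (w ⬝ᵥ A *ᵥ w).toNNReal) P := by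
  set φ := innerSL ℝ (WithLp.toLp 2 w : EuclideanSpace ℝ m) with hφ
  have hφ_apply : ∀ z, φ z = ∑ a, w a * z a := fun z => by
    simp [hφ, innerSL_apply_apply, PiLp.inner_apply, mul_comm]
  have hvar : Var[φ; multivariateGaussian 0 A] = w ⬝ᵥ A *ᵥ w := by
    have hcov := covarianceBilin_self (μ := multivariateGaussian 0 A) IsGaussian.memLp_two_id
      (WithLp.toLp 2 w : EuclideanSpace ℝ m)
    rw [covarianceBilin_multivariateGaussian hA] at hcov
    exact hcov.symm
  have hlaw : HasLaw φ (gaussianReal 0 (w ⬝ᵥ A *ᵥ w).toNNReal) (multivariateGaussian 0 A) := by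
    refine ⟨by fun_prop, ?_⟩
    rw [IsGaussian.map_eq_gaussianReal, hvar,
      ContinuousLinearMap.integral_comp_id_comm IsGaussian.integrable_id]
    simp
  simpa only [Function.comp_def, hφ_apply] using hlaw.comp hZ

lemma hasLaw_sum_mul_div_sqrt {A : Matrix m m ℝ} (hA : A.PosDef) {Z : Ω → EuclideanSpace ℝ m}
    (hZ : HasLaw Z (multivariateGaussian 0 A) P) {w : m → ℝ} (hw : w ≠ 0) :
    HasLaw (fun ω => (∑ a, w a * Z ω a) / √(w ⬝ᵥ A *ᵥ w)) (gaussianReal 0 1) P := by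
  have hv : 0 < w ⬝ᵥ A *ᵥ w := by simpa using hA.dotProduct_mulVec_pos hw
  convert gaussianReal_div_const (hasLaw_sum_mul hA.posSemidef hZ w) (√(w ⬝ᵥ A *ᵥ w)) using 2
  · rw [zero_div]
  · exact NNReal.eq (by simp [Real.sq_sqrt hv.le, hv.le, hv.ne'])

end Gaussian

section SampleCov

variable {n p q : ℕ}

lemma sampleCov_isSymm (z : Fin n → EuclideanSpace ℝ (Fin q ⊕ Fin p)) :
    (sampleCov z).IsSymm :=
  IsSymm.ext fun a b => by simp only [sampleCov, Matrix.of_apply, mul_comm (z _ b)]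

lemma quad_sampleCov (z : Fin n → EuclideanSpace ℝ (Fin q ⊕ Fin p)) (w : Fin q ⊕ Fin p → ℝ) :
    w ⬝ᵥ sampleCov z *ᵥ w = 1 / n * ∑ i, (∑ a, w a * z i a) ^ 2 := by
  have hsum : sampleCov z = (1 / n : ℝ) • ∑ i, vecMulVec (z i) (z i) := by
    ext a b
    simp [sampleCov, Matrix.sum_apply, vecMulVec_apply]
  rw [hsum, Matrix.smul_mulVec, dotProduct_smul, Matrix.sum_mulVec, dotProduct_sum, smul_eq_mul]
  refine congrArg _ (Finset.sum_congr rfl fun i _ => ?_)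
  rw [vecMulVec_mulVec, dotProduct_smul, sq, dotProduct_comm _ w]
  rfl

lemma sampleCov_posSemidef (z : Fin n → EuclideanSpace ℝ (Fin q ⊕ Fin p)) :
    (sampleCov z).PosSemidef :=
  .of_dotProduct_mulVec_nonneg (isHermitian_iff_isSymm.2 (sampleCov_isSymm z)) fun w => by
    rw [star_trivial, quad_sampleCov]
    positivity

lemma sampleCov_toBlocks₂₂_posSemidef (z : Fin n → EuclideanSpace ℝ (Fin q ⊕ Fin p)) :
    (sampleCov z).toBlocks₂₂.PosSemidef :=
  (sampleCov_posSemidef z).submatrix Sum.inr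

variable {Ω : Type*} [MeasurableSpace Ω] {P : Measure Ω} [IsProbabilityMeasure P]
  {A : Matrix (Fin q ⊕ Fin p) (Fin q ⊕ Fin p) ℝ} {Z : Fin n → Ω → EuclideanSpace ℝ (Fin q ⊕ Fin p)}
  {u : ℝ}

lemma measureReal_lt_abs_quad_sampleCov_sub_le (hA : A.PosDef)
    (hZ : ∀ i, HasLaw (Z i) (multivariateGaussian 0 A) P) (hi : iIndepFun Z P)
    (hu0 : 0 ≤ u) (hu1 : u ≤ 1) (w : Fin q ⊕ Fin p → ℝ) :
    P.real {ω | 4 * u * (w ⬝ᵥ A *ᵥ w) < |w ⬝ᵥ (sampleCov (fun i => Z i ω) - A) *ᵥ w|}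
      ≤ 2 * Real.exp (-(n * u ^ 2)) := by
  rcases eq_or_ne w 0 with rfl | hw
  · simp [Real.exp_nonneg]
  rcases n.eq_zero_or_pos with rfl | hn
  · refine measureReal_le_one.trans ?_
    norm_num
  set v := w ⬝ᵥ A *ᵥ w with hv_def
  have hv : 0 < v := by simpa using hA.dotProduct_mulVec_pos hw
  have hind : iIndepFun (fun i ω => (∑ a, w a * Z i ω a) / √v) P :=
    hi.comp (fun _ z => (∑ a, w a * z a) / √v) fun _ => by fun_prop
  have htail := measureReal_lt_abs_sum_sq_sub_le
    (fun i => hasLaw_sum_mul_div_sqrt hA (hZ i) hw) hind hu0 hu1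
  rw [Fintype.card_fin] at htail
  refine le_trans (measureReal_mono fun ω hω => ?_) htail
  have hquad : w ⬝ᵥ (sampleCov (fun i => Z i ω) - A) *ᵥ w
      = v / n * (∑ i, ((∑ a, w a * Z i ω a) / √v) ^ 2 - n) := by
    simp only [sub_mulVec, dotProduct_sub, quad_sampleCov, ← hv_def, div_pow, Real.sq_sqrt hv.le,
      ← Finset.sum_div]
    field_simp
  rw [Set.mem_ofPred_eq, hquad, abs_mul, abs_of_pos (by positivity : 0 < v / n),
    div_mul_eq_mul_div, lt_div_iff₀ (by positivity)] at hω
  exact Set.mem_ofPred.2 (lt_of_mul_lt_mul_left (by linarith) hv.le)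

end SampleCov

/-! ### Concentration of the sample covariance -/

section Embedding

variable {p q : ℕ}

/-- The linear map extending a vector of predictor coordinates by zero on the response coordinates;
it identifies the block `S_xx` with a restriction of the quadratic form `S`. -/
def inrEmb (p q : ℕ) : (Fin p → ℝ) →ₗ[ℝ] (Fin q ⊕ Fin p → ℝ) where
  toFun v := Sum.elim 0 v
  map_add' v w := by ext (i | i) <;> simp
  map_smul' c v := by ext (i | i) <;> simp

lemma bilin_inrEmb (D : Matrix (Fin q ⊕ Fin p) (Fin q ⊕ Fin p) ℝ) (v w : Fin p → ℝ) :
    inrEmb p q v ⬝ᵥ D *ᵥ inrEmb p q w = v ⬝ᵥ D.toBlocks₂₂ *ᵥ w := by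
  simp [inrEmb, dotProduct, mulVec, toBlocks₂₂]

lemma inrEmb_single (j : Fin p) (c : ℝ) :
    inrEmb p q (Pi.single j c) = Pi.single (Sum.inr j) c :=
  Sum.elim_zero_single j c

lemma toBlocks₂₂_sub (A B : Matrix (Fin q ⊕ Fin p) (Fin q ⊕ Fin p) ℝ) :
    (A - B).toBlocks₂₂ = A.toBlocks₂₂ - B.toBlocks₂₂ := rfl

end Embedding

section Tails

variable {Ω : Type*} [MeasurableSpace Ω] {P : Measure Ω} [IsProbabilityMeasure P] {n p q : ℕ}
  {A : Matrix (Fin q ⊕ Fin p) (Fin q ⊕ Fin p) ℝ}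
  {Z : Fin n → Ω → EuclideanSpace ℝ (Fin q ⊕ Fin p)} {u : ℝ}
  (hA : A.PosDef) (hZ : ∀ i, HasLaw (Z i) (multivariateGaussian 0 A) P) (hi : iIndepFun Z P)

include hA hZ hi

lemma measureReal_exists_mem_lt_abs_quad_le (F : Submodule ℝ (Fin q ⊕ Fin p → ℝ)) :
    P.real {ω | ∃ x ∈ F, 1 / 4 * (x ⬝ᵥ A *ᵥ x)
        < |x ⬝ᵥ (sampleCov (fun i => Z i ω) - A) *ᵥ x|}
      ≤ 9 ^ Module.finrank ℝ F * (2 * Real.exp (-(n / 1024))) := by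
  obtain ⟨N, hN, hcard⟩ := exists_isQuadNet hA.posSemidef F (δ := 1 / 4) (by norm_num)
  have htail : ∀ y ∈ N, P.real {ω | 4 * (1 / 32) * (y ⬝ᵥ A *ᵥ y)
      < |y ⬝ᵥ (sampleCov (fun i => Z i ω) - A) *ᵥ y|} ≤ 2 * Real.exp (-(n / 1024)) := fun y _ => by
    convert measureReal_lt_abs_quad_sampleCov_sub_le hA hZ hi (u := 1 / 32) (by norm_num)
      (by norm_num) y using 4
    ring
  have hsub : {ω | ∃ x ∈ F, 1 / 4 * (x ⬝ᵥ A *ᵥ x)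
        < |x ⬝ᵥ (sampleCov (fun i => Z i ω) - A) *ᵥ x|}
      ⊆ ⋃ y ∈ N, {ω | 4 * (1 / 32) * (y ⬝ᵥ A *ᵥ y)
        < |y ⬝ᵥ (sampleCov (fun i => Z i ω) - A) *ᵥ y|} := by
    rintro ω ⟨x, hx, hlt⟩
    by_contra hω
    simp only [Set.mem_iUnion, Set.mem_ofPred_eq, not_exists, not_lt] at hω
    refine hlt.not_ge ((hN.abs_quad_le hA (ε := 1 / 8)
      ((sampleCov_isSymm _).sub (isHermitian_iff_isSymm.1 hA.1)) (by norm_num) (by norm_num)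
      (by norm_num) (fun y hy => (hω y hy).trans ?_) hx).trans_eq (by norm_num))
    linarith [hN.quad_le_one y hy]
  calc P.real _ ≤ ∑ y ∈ N, P.real {ω | 4 * (1 / 32) * (y ⬝ᵥ A *ᵥ y)
        < |y ⬝ᵥ (sampleCov (fun i => Z i ω) - A) *ᵥ y|} :=
        (measureReal_mono hsub (measure_ne_top _ _)).trans (measureReal_biUnion_finset_le _ _)
    _ ≤ N.card * (2 * Real.exp (-(n / 1024))) := by
        rw [← nsmul_eq_mul]
        exact Finset.sum_le_card_nsmul _ _ _ htail
    _ ≤ 9 ^ Module.finrank ℝ F * (2 * Real.exp (-(n / 1024))) := by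
        gcongr
        exact hcard.trans_eq (by norm_num)

lemma measureReal_exists_mem_lt_abs_quad_toBlocks₂₂_le {d : ℕ} (F : Submodule ℝ (Fin p → ℝ))
    (hF : Module.finrank ℝ F ≤ d) :
    P.real {ω | ∃ x ∈ F, 1 / 4 * (x ⬝ᵥ A.toBlocks₂₂ *ᵥ x)
        < |x ⬝ᵥ ((sampleCov fun i => Z i ω).toBlocks₂₂ - A.toBlocks₂₂) *ᵥ x|}
      ≤ 9 ^ d * (2 * Real.exp (-(n / 1024))) := by
  refine (measureReal_mono ?_).trans
    ((measureReal_exists_mem_lt_abs_quad_le hA hZ hi (F.map (inrEmb p q))).trans ?_)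
  · rintro ω ⟨x, hx, hlt⟩
    refine ⟨inrEmb p q x, Submodule.mem_map_of_mem hx, ?_⟩
    rwa [bilin_inrEmb, bilin_inrEmb, toBlocks₂₂_sub]
  · gcongr
    · norm_num
    · exact (Submodule.finrank_map_le _ _).trans hF

lemma measureReal_lt_abs_bilin_le (hu0 : 0 ≤ u) (hu1 : u ≤ 1) (v w : Fin q ⊕ Fin p → ℝ) :
    P.real {ω | 2 * u * (v ⬝ᵥ A *ᵥ v + w ⬝ᵥ A *ᵥ w)
        < |v ⬝ᵥ (sampleCov (fun i => Z i ω) - A) *ᵥ w|} ≤ 4 * Real.exp (-(n * u ^ 2)) := by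
  have hsub : {ω | 2 * u * (v ⬝ᵥ A *ᵥ v + w ⬝ᵥ A *ᵥ w)
        < |v ⬝ᵥ (sampleCov (fun i => Z i ω) - A) *ᵥ w|}
      ⊆ {ω | 4 * u * ((v + w) ⬝ᵥ A *ᵥ (v + w))
          < |(v + w) ⬝ᵥ (sampleCov (fun i => Z i ω) - A) *ᵥ (v + w)|}
        ∪ {ω | 4 * u * ((v - w) ⬝ᵥ A *ᵥ (v - w))
          < |(v - w) ⬝ᵥ (sampleCov (fun i => Z i ω) - A) *ᵥ (v - w)|} := by
    intro ω hlt
    by_contra hω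
    simp only [Set.mem_union, Set.mem_ofPred_eq, not_or, not_lt] at hω hlt
    have hD := (sampleCov_isSymm fun i => Z i ω).sub (isHermitian_iff_isSymm.1 hA.1)
    simp only [quad_add, quad_sub, bilin_comm hD w v, abs_le] at hω
    refine hlt.not_ge (abs_le.2 ⟨?_, ?_⟩) <;> linarith [hω.1.1, hω.1.2, hω.2.1, hω.2.2]
  refine (measureReal_mono hsub).trans ((measureReal_union_le _ _).trans ((add_le_add
    (measureReal_lt_abs_quad_sampleCov_sub_le hA hZ hi hu0 hu1 (v + w))
    (measureReal_lt_abs_quad_sampleCov_sub_le hA hZ hi hu0 hu1 (v - w))).trans_eq (by ring)))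

lemma measureReal_lt_abs_bilin_add_bilin_le (hu0 : 0 ≤ u) (hu1 : u ≤ 1)
    {v w v' w' : Fin q ⊕ Fin p → ℝ} {c : ℝ}
    (hc : 2 * u * (v ⬝ᵥ A *ᵥ v + w ⬝ᵥ A *ᵥ w) + 2 * u * (v' ⬝ᵥ A *ᵥ v' + w' ⬝ᵥ A *ᵥ w') ≤ c) :
    P.real {ω | c < |v ⬝ᵥ (sampleCov (fun i => Z i ω) - A) *ᵥ w
        + v' ⬝ᵥ (sampleCov (fun i => Z i ω) - A) *ᵥ w'|} ≤ 8 * Real.exp (-(n * u ^ 2)) := by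
  have hsub : {ω | c < |v ⬝ᵥ (sampleCov (fun i => Z i ω) - A) *ᵥ w
        + v' ⬝ᵥ (sampleCov (fun i => Z i ω) - A) *ᵥ w'|}
      ⊆ {ω | 2 * u * (v ⬝ᵥ A *ᵥ v + w ⬝ᵥ A *ᵥ w)
          < |v ⬝ᵥ (sampleCov (fun i => Z i ω) - A) *ᵥ w|}
        ∪ {ω | 2 * u * (v' ⬝ᵥ A *ᵥ v' + w' ⬝ᵥ A *ᵥ w')
          < |v' ⬝ᵥ (sampleCov (fun i => Z i ω) - A) *ᵥ w'|} := by
    intro ω hlt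
    by_contra hω
    simp only [Set.mem_union, Set.mem_ofPred_eq, not_or, not_lt] at hω hlt
    exact hlt.not_ge ((abs_add_le _ _).trans ((add_le_add hω.1 hω.2).trans hc))
  refine (measureReal_mono hsub).trans ((measureReal_union_le _ _).trans ((add_le_add
    (measureReal_lt_abs_bilin_le hA hZ hi hu0 hu1 v w)
    (measureReal_lt_abs_bilin_le hA hZ hi hu0 hu1 v' w')).trans_eq (by ring)))

end Tails

lemma measureReal_lt_maxNorm_le {Ω : Type*} [MeasurableSpace Ω] {P : Measure Ω}
    [IsFiniteMeasure P] {k l : ℕ} {B : Ω → Matrix (Fin k) (Fin l) ℝ} {c ε : ℝ} (hc : 0 ≤ c)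
    (h : ∀ i j, P.real {ω | c < |B ω i j|} ≤ ε) :
    P.real {ω | c < maxNorm (B ω)} ≤ k * l * ε := by
  have hsub : {ω | c < maxNorm (B ω)} ⊆ ⋃ ij : Fin k × Fin l, {ω | c < |B ω ij.1 ij.2|} := by
    intro ω hlt
    by_contra hω
    simp only [Set.mem_iUnion, Set.mem_ofPred_eq, not_exists, not_lt] at hω hlt
    exact hlt.not_ge (maxNorm_le hc fun i j => hω (i, j))
  refine (measureReal_mono hsub).trans ((measureReal_iUnion_fintype_le _).trans
    ((Finset.sum_le_card_nsmul _ _ ε fun ij _ => h ij.1 ij.2).trans_eq ?_))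
  simp

lemma quad_single_one_le_diagMax {m : Type*} [Fintype m] [DecidableEq m]
    (A : Matrix m m ℝ) (i : m) : Pi.single i 1 ⬝ᵥ A *ᵥ Pi.single i 1 ≤ diagMax A := by
  simpa using (le_abs_self _).trans (abs_le_diagMax A i)

/-! ### The favourable event -/

namespace Model

section Deterministic

variable {p q : ℕ} {M : Model p q} {S : Matrix (Fin q ⊕ Fin p) (Fin q ⊕ Fin p) ℝ}

lemma rangeBound_of_abs_quad_le (hS : S.IsSymm) (hSxx : M.Sxx.IsHermitian)
    (hquad : ∀ x ∈ LinearMap.range M.Oyxᵀ.mulVecLin,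
      |x ⬝ᵥ (S.toBlocks₂₂ - M.Sxx) *ᵥ x| ≤ 1 / 4 * (x ⬝ᵥ M.Sxx *ᵥ x)) :
    M.RangeBound S := by
  have hS₂₂ : S.toBlocks₂₂.IsHermitian := isHermitian_iff_isSymm.2 (hS.submatrix Sum.inr)
  have hconj : ∀ {D : Matrix (Fin p) (Fin p) ℝ}, D.IsHermitian →
      (M.Oyx * D * M.Oyxᵀ).IsHermitian := fun hD => by
    simpa using isHermitian_mul_mul_conjTranspose M.Oyx hD
  refine Matrix.le_iff.2 (.of_dotProduct_mulVec_nonneg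
    ((isHermitian_one.smul (IsSelfAdjoint.all _)).sub (hconj hS₂₂)) fun u => ?_)
  have hu := (abs_le.1 (hquad _ (LinearMap.mem_range_self _ u))).2
  have hmax := quad_le_lamMax (hconj hSxx) u
  have hpull : ∀ D : Matrix (Fin p) (Fin p) ℝ,
      (M.Oyxᵀ *ᵥ u) ⬝ᵥ D *ᵥ (M.Oyxᵀ *ᵥ u) = u ⬝ᵥ (M.Oyx * D * M.Oyxᵀ) *ᵥ u := fun D => by
    rw [mulVec_transpose, ← dotProduct_mulVec, ← mulVec_transpose, mulVec_mulVec, mulVec_mulVec]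
  rw [mulVecLin_apply, sub_mulVec, dotProduct_sub, hpull, hpull] at hu
  rw [star_trivial, sub_mulVec, dotProduct_sub, quad_smul_one]
  linarith

lemma sparseBound_of_abs_quad_le {s : ℕ} (hs : 2 ≤ s) (hSxx : M.Sxx.IsHermitian)
    (hquad : ∀ f : Fin s → Fin p, ∀ x ∈ coordSpan f,
      |x ⬝ᵥ (S.toBlocks₂₂ - M.Sxx) *ᵥ x| ≤ 1 / 4 * (x ⬝ᵥ M.Sxx *ᵥ x)) :
    M.SparseBound S s := by
  have hdiag : ∀ j, (S.toBlocks₂₂ - (3 / 4 : ℝ) • M.Sxx) j j ≤ 1 / 2 * lamMax M.Sxx := fun j => by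
    have hj := hquad (fun _ => j) (Pi.single j 1) (Submodule.subset_span ⟨⟨0, by omega⟩, rfl⟩)
    have hmax := diag_le_lamMax hSxx j
    simp only [mulVec_single_one, single_one_dotProduct, col_apply, Matrix.sub_apply] at hj
    simp only [Matrix.sub_apply, Matrix.smul_apply, smul_eq_mul]
    linarith [(abs_le.1 hj).2]
  intro v
  have hv := neg_div_le_quad_of_sparse hs hdiag (fun f x hx => by
    have hx := (abs_le.1 (hquad f x hx)).1
    rw [sub_mulVec, dotProduct_sub] at hx ⊢
    rw [smul_mulVec, dotProduct_smul, smul_eq_mul]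
    linarith) v
  rw [sub_mulVec, dotProduct_sub, smul_mulVec, dotProduct_smul, smul_eq_mul] at hv
  linarith

lemma conj_regression_apply (h : M.Oyy.IsHermitian) (D : Matrix (Fin p) (Fin p) ℝ) (i j : Fin q) :
    (M.Oyy⁻¹ * M.Oyx * D * M.Oyxᵀ * M.Oyy⁻¹) i j
      = (M.Oyy⁻¹ * M.Oyx) i ⬝ᵥ D *ᵥ (M.Oyy⁻¹ * M.Oyx) j := by
  have hT : M.Oyxᵀ * M.Oyy⁻¹ = (M.Oyy⁻¹ * M.Oyx)ᵀ := by
    rw [transpose_mul, transpose_nonsing_inv, isHermitian_iff_isSymm.1 h]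
  rw [Matrix.mul_assoc _ M.Oyxᵀ, hT, Matrix.mul_assoc (M.Oyy⁻¹ * M.Oyx)]
  rfl

lemma matA_apply (h : M.Oyy.IsHermitian) (i j : Fin q) :
    M.matA S i j = Pi.single (Sum.inl i) 1 ⬝ᵥ (S - M.Sig) *ᵥ Pi.single (Sum.inl j) 1
      + -inrEmb p q ((M.Oyy⁻¹ * M.Oyx) i) ⬝ᵥ (S - M.Sig) *ᵥ inrEmb p q ((M.Oyy⁻¹ * M.Oyx) j) := by
  rw [matA, Matrix.sub_apply, conj_regression_apply h, neg_dotProduct, bilin_inrEmb,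
    toBlocks₂₂_sub, ← sub_eq_add_neg]
  simp [toBlocks₁₁, Syy, Sxx]

lemma matB_apply (i : Fin q) (j : Fin p) :
    M.matB S i j = 2 * (Pi.single (Sum.inl i) 1 ⬝ᵥ (S - M.Sig) *ᵥ Pi.single (Sum.inr j) 1
      + inrEmb p q ((M.Oyy⁻¹ * M.Oyx) i) ⬝ᵥ (S - M.Sig) *ᵥ Pi.single (Sum.inr j) 1) := by
  rw [← inrEmb_single, bilin_inrEmb, inrEmb_single, toBlocks₂₂_sub, mulVec_single_one,
    mulVec_single_one, single_one_dotProduct]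
  rfl

lemma mStar_nonneg : 0 ≤ M.mStar :=
  add_nonneg (diagMax_nonneg _) (diagMax_nonneg _)

end Deterministic

section Tails

variable {Ω : Type*} [MeasurableSpace Ω] {P : Measure Ω} [IsProbabilityMeasure P] {n p q : ℕ}
  {M : Model p q} {Z : Fin n → Ω → EuclideanSpace ℝ (Fin q ⊕ Fin p)} {u : ℝ}
  (hSig : M.Sig.PosDef) (hZ : ∀ i, HasLaw (Z i) (multivariateGaussian 0 M.Sig) P)
  (hi : iIndepFun Z P)

include hSig hZ hi

lemma measureReal_not_rangeBound_le :
    P.real {ω | ¬M.RangeBound (sampleCov fun i => Z i ω)}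
      ≤ 9 ^ q * (2 * Real.exp (-(n / 1024))) := by
  refine (measureReal_mono fun ω => ?_).trans
    (measureReal_exists_mem_lt_abs_quad_toBlocks₂₂_le hSig hZ hi
      (LinearMap.range M.Oyxᵀ.mulVecLin) ((LinearMap.finrank_range_le _).trans_eq (by simp)))
  contrapose!
  intro hω
  simp only [Set.mem_ofPred_eq, not_exists, not_and, not_lt, not_not] at hω ⊢
  exact rangeBound_of_abs_quad_le (sampleCov_isSymm _) (Sxx_isHermitian hSig.1) hω

lemma measureReal_not_sparseBound_le {s : ℕ} (hs : 2 ≤ s) :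
    P.real {ω | ¬M.SparseBound (sampleCov fun i => Z i ω) s}
      ≤ (9 * p) ^ s * (2 * Real.exp (-(n / 1024))) := by
  have hsub : {ω | ¬M.SparseBound (sampleCov fun i => Z i ω) s}
      ⊆ ⋃ f : Fin s → Fin p, {ω | ∃ x ∈ coordSpan f, 1 / 4 * (x ⬝ᵥ M.Sxx *ᵥ x)
        < |x ⬝ᵥ ((sampleCov fun i => Z i ω).toBlocks₂₂ - M.Sxx) *ᵥ x|} := by
    intro ω
    contrapose!
    intro hω
    simp only [Set.mem_iUnion, Set.mem_ofPred_eq, not_exists, not_and, not_lt, not_not] at hω ⊢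
    exact sparseBound_of_abs_quad_le hs (Sxx_isHermitian hSig.1) hω
  refine (measureReal_mono hsub).trans ((measureReal_iUnion_fintype_le _).trans
    ((Finset.sum_le_card_nsmul _ _ _ fun f _ => measureReal_exists_mem_lt_abs_quad_toBlocks₂₂_le
      hSig hZ hi (coordSpan f) (finrank_coordSpan_le f)).trans_eq ?_))
  rw [Finset.card_univ, Fintype.card_fun, Fintype.card_fin, Fintype.card_fin, nsmul_eq_mul,
    mul_pow]
  push_cast
  ring

omit hSig hZ hi in
lemma quad_inrEmb_le_diagMax (h : M.Oyy.IsHermitian) (i : Fin q) :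
    inrEmb p q ((M.Oyy⁻¹ * M.Oyx) i) ⬝ᵥ M.Sig *ᵥ inrEmb p q ((M.Oyy⁻¹ * M.Oyx) i)
      ≤ diagMax (M.Oyy⁻¹ * M.Oyx * M.Sxx * M.Oyxᵀ * M.Oyy⁻¹) := by
  refine le_of_eq_of_le ?_ ((le_abs_self _).trans (abs_le_diagMax _ i))
  rw [bilin_inrEmb, conj_regression_apply h]
  rfl

variable (h : M.H1) (hu0 : 0 ≤ u) (hu1 : u ≤ 1)

include h hu0 hu1

lemma measureReal_lt_ha_le :
    P.real {ω | 16 * M.mStar * u < M.ha (sampleCov fun i => Z i ω)}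
      ≤ q * q * (8 * Real.exp (-(n * u ^ 2))) := by
  refine measureReal_lt_maxNorm_le (mul_nonneg (mul_nonneg (by norm_num) mStar_nonneg) hu0)
    fun i j => ?_
  simp only [matA_apply h.Oyy_posDef.1]
  refine measureReal_lt_abs_bilin_add_bilin_le hSig hZ hi hu0 hu1 ?_
  have hsum := mul_le_mul_of_nonneg_left (add_le_add
    (add_le_add (quad_single_one_le_diagMax M.Sig (Sum.inl i))
      (quad_single_one_le_diagMax M.Sig (Sum.inl j)))
    (add_le_add (quad_inrEmb_le_diagMax h.Oyy_posDef.1 i)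
      (quad_inrEmb_le_diagMax h.Oyy_posDef.1 j))) hu0
  have := mul_nonneg hu0 (mStar_nonneg (M := M))
  rw [mulVec_neg, neg_dotProduct_neg]
  rw [mStar] at *
  linarith

lemma measureReal_lt_hb_le :
    P.real {ω | 16 * M.mStar * u < M.hb (sampleCov fun i => Z i ω)}
      ≤ q * p * (8 * Real.exp (-(n * u ^ 2))) := by
  refine measureReal_lt_maxNorm_le (mul_nonneg (mul_nonneg (by norm_num) mStar_nonneg) hu0)
    fun i j => ?_
  have hdiv : ∀ c : ℝ, 16 * M.mStar * u < |2 * c| ↔ 8 * M.mStar * u < |c| := fun c => by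
    rw [abs_mul, abs_two]
    constructor <;> intro <;> linarith
  simp only [matB_apply, hdiv]
  refine measureReal_lt_abs_bilin_add_bilin_le hSig hZ hi hu0 hu1 ?_
  have hj := quad_single_one_le_diagMax M.Sig (Sum.inr j)
  have hsum := mul_le_mul_of_nonneg_left (add_le_add
    (add_le_add (quad_single_one_le_diagMax M.Sig (Sum.inl i)) hj)
    (add_le_add (quad_inrEmb_le_diagMax h.Oyy_posDef.1 i) hj)) hu0
  have := mul_nonneg hu0 (diagMax_nonneg M.Sig)
  have := mul_nonneg hu0
    (diagMax_nonneg (M.Oyy⁻¹ * M.Oyx * M.Sxx * M.Oyxᵀ * M.Oyy⁻¹))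
  rw [mStar]
  linarith

end Tails

end Model

/-! ### The total probability -/

section Budget

variable {p q s n : ℕ} {b₃ x : ℝ}

lemma two_le_add_of_pos (hp : 0 < p) (hq : 0 < q) : (2 : ℝ) ≤ (p : ℝ) + q := by
  exact_mod_cast (by omega : 2 ≤ p + q)

lemma nine_pow_le_exp (hx : q * 3 ≤ x) : (9 : ℝ) ^ q ≤ Real.exp x := by
  have h : (9 : ℝ) ≤ Real.exp 3 := calc
    (9 : ℝ) ≤ 2.1 ^ 3 := by norm_num
    _ ≤ Real.exp 1 ^ 3 := by gcongr; linarith [Real.exp_one_gt_d9]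
    _ = Real.exp 3 := by rw [← Real.exp_nat_mul]; norm_num
  calc (9 : ℝ) ^ q ≤ Real.exp 3 ^ q := by gcongr
    _ = Real.exp (q * 3) := (Real.exp_nat_mul _ _).symm
    _ ≤ Real.exp x := Real.exp_le_exp.2 hx

lemma nine_mul_pow_le_exp (hp : 0 < p) (hq : 0 < q) (hx : s * (5 * Real.log ((p : ℝ) + q)) ≤ x) :
    (9 * p : ℝ) ^ s ≤ Real.exp x := by
  have hm := two_le_add_of_pos hp hq
  have h : (9 * p : ℝ) ≤ ((p : ℝ) + q) ^ 5 := calc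
    (9 * p : ℝ) ≤ 2 ^ 4 * ((p : ℝ) + q) := by linarith [(p.cast_nonneg : (0 : ℝ) ≤ p)]
    _ ≤ ((p : ℝ) + q) ^ 4 * ((p : ℝ) + q) := by gcongr
    _ = ((p : ℝ) + q) ^ 5 := (pow_succ _ 4).symm
  calc (9 * p : ℝ) ^ s ≤ (((p : ℝ) + q) ^ 5) ^ s := by gcongr
    _ = Real.exp (s * (5 * Real.log ((p : ℝ) + q))) := by
      rw [Real.exp_nat_mul, ← Nat.cast_ofNat (R := ℝ), Real.exp_nat_mul,
        Real.exp_log (by linarith)]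
    _ ≤ Real.exp x := Real.exp_le_exp.2 hx

lemma log_add_pos (hp : 0 < p) (hq : 0 < q) : 0 < Real.log ((p : ℝ) + q) :=
  Real.log_pos (by linarith [two_le_add_of_pos hp hq])

/-- The largest sparsity that a sample of size `n` controls uniformly, with `q` responses and `p`
predictors. The constant is such that the cardinality `(9 p) ^ s` of the union of the nets is
absorbed by the tail probability `exp (-n / 1024)`. -/
noncomputable def sparsityLevel (p q n : ℕ) : ℕ :=
  ⌊((n : ℝ) / 20480 - q) / Real.log ((p : ℝ) + q)⌋₊

lemma mul_add_sparsityLevel_mul_log_le (hp : 0 < p) (hq : 0 < q) (hs : sparsityLevel p q n ≠ 0) :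
    20480 * (q + sparsityLevel p q n * Real.log ((p : ℝ) + q)) ≤ n := by
  have hfloor := (Nat.le_floor_iff' hs).1 le_rfl
  rw [le_div_iff₀ (log_add_pos hp hq)] at hfloor
  linarith

lemma net_budget (hp : 0 < p) (hq : 0 < q) (h : 20480 * (q + s * Real.log ((p : ℝ) + q)) ≤ n) :
    9 ^ q * (2 * Real.exp (-(n / 1024))) + (9 * p) ^ s * (2 * Real.exp (-(n / 1024)))
      ≤ Real.exp (-(1 / 2048 * n)) := by
  have hq1 : (1 : ℝ) ≤ q := by exact_mod_cast hq
  have hsl : 0 ≤ s * Real.log ((p : ℝ) + q) := mul_nonneg s.cast_nonneg (log_add_pos hp hq).le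
  have h4 : (4 : ℝ) ≤ Real.exp (n / 4096) := by
    linarith [Real.add_one_le_exp ((n : ℝ) / 4096)]
  calc (9 : ℝ) ^ q * (2 * Real.exp (-(n / 1024))) + (9 * p) ^ s * (2 * Real.exp (-(n / 1024)))
      ≤ Real.exp (n / 4096) * (2 * Real.exp (-(n / 1024)))
        + Real.exp (n / 4096) * (2 * Real.exp (-(n / 1024))) := by
        gcongr
        · exact nine_pow_le_exp (by linarith)
        · exact nine_mul_pow_le_exp hp hq (by linarith)
    _ = 4 * (Real.exp (n / 4096) * Real.exp (-(n / 1024))) := by ring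
    _ ≤ Real.exp (n / 4096) * (Real.exp (n / 4096) * Real.exp (-(n / 1024))) := by gcongr
    _ = Real.exp (-(1 / 2048 * n)) := by
        rw [← Real.exp_add, ← Real.exp_add]
        ring_nf

lemma logTerm_nonneg (hp : 0 < p) (hq : 0 < q) (h0 : 0 < b₃) (h1 : b₃ ≤ 1) :
    0 ≤ logTerm p q b₃ := by
  have hm := two_le_add_of_pos hp hq
  exact sub_nonneg.2 ((Real.log_nonpos h0.le h1).trans (Real.log_nonneg (by nlinarith)))

lemma score_budget (hp : 0 < p) (hq : 0 < q) (h0 : 0 < b₃) :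
    q * q * (8 * Real.exp (-logTerm p q b₃)) + q * p * (8 * Real.exp (-logTerm p q b₃)) ≤ b₃ := by
  have hpq : (0 : ℝ) ≤ p * q := by positivity
  have hpos : 0 < 10 * ((p : ℝ) + q) ^ 2 := by positivity
  have hexp : Real.exp (-logTerm p q b₃) = b₃ / (10 * ((p : ℝ) + q) ^ 2) := by
    rw [logTerm, neg_sub, Real.exp_sub, Real.exp_log h0, Real.exp_log hpos]
  calc _ = 8 * (q * (q + p)) / (10 * ((p : ℝ) + q) ^ 2) * b₃ := by rw [hexp]; ring
    _ ≤ 1 * b₃ := by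
        gcongr
        rw [div_le_one hpos]
        nlinarith
    _ = b₃ := one_mul _

end Budget

namespace Model

section Sparsity

variable {p q n : ℕ} {M : Model p q} {T : Tuning} {R : Reg} {b₃ εS εL : ℝ}

lemma two_le_ceil_sAlpha (hL : M.L.PosSemidef) (hβ : 1 ≤ M.β) (h : M.H1) (hT : T.Valid)
    {S : Matrix (Fin q ⊕ Fin p) (Fin q ⊕ Fin p) ℝ} (hB : M.InBand T R S)
    (hd : 0 < M.alphaDen T R) : 2 ≤ ⌈M.sAlpha T R⌉₊ := by
  have hα := one_le_alpha hT (hB.lam_nonneg hT)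
    (kap_nonneg (sL_pos (isHermitian_iff_isSymm.1 hL.1) h).le hβ hB.eta_mem.1) hd
  have hcard : (1 : ℝ) ≤ M.cardS := mod_cast one_le_cardS h.Oyx_ne_zero
  have hmin := lamMin_pos h.Sxx_posDef h.p_pos
  have hmax := lamMax_pos h.Sxx_posDef h.p_pos
  have hratio : 0 < 12 * M.alpha T R ^ 2 * lamMax M.Sxx / lamMin M.Sxx := by positivity
  rw [Nat.succ_le_iff, Nat.lt_ceil, Nat.cast_one, sAlpha]
  nlinarith

lemma ceil_sAlpha_le_sparsityLevel (hp : 0 < p) (hq : 0 < q)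
    (hn : M.nZero T R εS εL 20480 b₃ < n) : ⌈M.sAlpha T R⌉₊ ≤ sparsityLevel p q n := by
  rw [nZero, max_lt_iff, max_lt_iff] at hn
  refine Nat.le_floor ?_
  rw [le_div_iff₀ (log_add_pos hp hq)]
  linarith [hn.2.1]

end Sparsity

section Event

variable {Ω : Type*} [MeasurableSpace Ω] {P : Measure Ω} [IsProbabilityMeasure P] {n p q s : ℕ}
  {M : Model p q} {Z : Fin n → Ω → EuclideanSpace ℝ (Fin q ⊕ Fin p)} {b₃ : ℝ}
  (hSig : M.Sig.PosDef) (h : M.H1) (hZ : ∀ i, HasLaw (Z i) (multivariateGaussian 0 M.Sig) P)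
  (hi : iIndepFun Z P) (h0 : 0 < b₃) (h1 : b₃ ≤ 1) (hlog : logTerm p q b₃ < n) (hs : 2 ≤ s)
  (hsn : 20480 * (q + s * Real.log ((p : ℝ) + q)) ≤ n)

include hSig h hZ hi h0 h1 hlog hs hsn

lemma measureReal_not_isGood_le :
    P.real {ω | ¬M.IsGood (sampleCov fun i => Z i ω) s (16 * M.mStar * √(logTerm p q b₃ / n))}
      ≤ Real.exp (-(1 / 2048 * n)) + b₃ := by
  have hl := logTerm_nonneg h.p_pos h.q_pos h0 h1
  have hn := hl.trans_lt hlog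
  set u := √(logTerm p q b₃ / n) with hu
  have hu0 : 0 ≤ u := Real.sqrt_nonneg _
  have hu1 : u ≤ 1 := Real.sqrt_le_one.2 ((div_le_one hn).2 hlog.le)
  have hnu : (n : ℝ) * u ^ 2 = logTerm p q b₃ := by
    rw [hu, Real.sq_sqrt (by positivity)]
    field_simp
  have hsub : {ω | ¬M.IsGood (sampleCov fun i => Z i ω) s (16 * M.mStar * u)}
      ⊆ ({ω | ¬M.RangeBound (sampleCov fun i => Z i ω)}
          ∪ {ω | ¬M.SparseBound (sampleCov fun i => Z i ω) s})
        ∪ ({ω | 16 * M.mStar * u < M.ha (sampleCov fun i => Z i ω)}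
          ∪ {ω | 16 * M.mStar * u < M.hb (sampleCov fun i => Z i ω)}) := by
    intro ω
    contrapose!
    simp only [Set.mem_union, Set.mem_ofPred_eq, not_or, not_not, not_lt]
    exact fun hω => ⟨sampleCov_toBlocks₂₂_posSemidef _, hω.1.1, hω.1.2, hω.2.1, hω.2.2⟩
  calc P.real _ ≤ _ := measureReal_mono hsub
    _ ≤ _ := (measureReal_union_le _ _).trans
        (add_le_add (measureReal_union_le _ _) (measureReal_union_le _ _))
    _ ≤ 9 ^ q * (2 * Real.exp (-(n / 1024))) + (9 * p) ^ s * (2 * Real.exp (-(n / 1024)))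
        + (q * q * (8 * Real.exp (-(n * u ^ 2))) + q * p * (8 * Real.exp (-(n * u ^ 2)))) := by
        gcongr
        · exact measureReal_not_rangeBound_le hSig hZ hi
        · exact measureReal_not_sparseBound_le hSig hZ hi hs
        · exact measureReal_lt_ha_le hSig hZ hi h hu0 hu1
        · exact measureReal_lt_hb_le hSig hZ hi h hu0 hu1
    _ ≤ Real.exp (-(1 / 2048 * n)) + b₃ := by
        rw [hnu]
        exact add_le_add (net_budget h.p_pos h.q_pos hsn) (score_budget h.p_pos h.q_pos h0)

lemma exists_measurableSet_isGood :
    ∃ E : Set Ω, MeasurableSet E ∧ 1 - Real.exp (-(1 / 2048 * n)) - b₃ ≤ P.real E ∧ ∀ ω ∈ E,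
      M.IsGood (sampleCov fun i => Z i ω) s (16 * M.mStar * √(logTerm p q b₃ / n)) := by
  have hbad := measureReal_not_isGood_le hSig h hZ hi h0 h1 hlog hs hsn
  refine ⟨(toMeasurable P {ω | ¬M.IsGood (sampleCov fun i => Z i ω) s
    (16 * M.mStar * √(logTerm p q b₃ / n))})ᶜ, (measurableSet_toMeasurable _ _).compl, ?_,
    fun ω hω => not_not.1 fun hc => hω (subset_toMeasurable _ _ hc)⟩
  rw [probReal_compl_eq_one_sub (measurableSet_toMeasurable _ _), measureReal_def,
    measure_toMeasurable, ← measureReal_def]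
  linarith

end Event

end Model

end PGGM

open PGGM in
theorem theorem2p1_general :
    ∃ b₁ : ℝ, 0 < b₁ ∧ ∃ b₂ : ℝ, 0 < b₂ ∧
      ∀ (p q n : ℕ) (M : Model p q) (T : Tuning),
        M.Sig.PosDef → M.L.PosSemidef → 1 ≤ M.β → M.H1 → T.Valid →
      ∀ (Ω : Type*) [MeasurableSpace Ω] (P : Measure Ω) [IsProbabilityMeasure P]
        (Z : Fin n → Ω → EuclideanSpace ℝ (Fin q ⊕ Fin p)),
        (∀ i, HasLaw (Z i) (multivariateGaussian 0 M.Sig) P) → iIndepFun Z P →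
      ∀ b₃ : ℝ, 0 < b₃ → b₃ < 1 →
        ∃ E : Set Ω, MeasurableSet E ∧ 1 - Real.exp (-(b₂ * n)) - b₃ ≤ P.real E ∧
          ∀ ω ∈ E, ∀ (R : Reg) (εS εL : ℝ),
            M.InBand T R (sampleCov fun i => Z i ω) →
            0 < M.alphaDen T R →
            0 < εS → 0 < εL →
            εS * M.omegaSUp + R.eta * M.β * (p : ℝ) ^ (M.β - 1) * M.omegaLUp ^ M.β * εL < 1 →
            M.nZero T R εS εL b₁ b₃ < n →
              (∃ θ, M.IsEstimator R (sampleCov fun i => Z i ω) θ) ∧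
              ∀ θ, M.IsEstimator R (sampleCov fun i => Z i ω) θ →
                frobDist θ M.theta ≤ M.errorBound T R εS εL b₃ n := by
  refine ⟨20480, by norm_num, 1 / 2048, by norm_num, ?_⟩
  intro p q n M T hSig hL hβ h hT Ω _ P _ Z hZ hi b₃ h0 h1
  have hnZero : ∀ {R : Reg} {εS εL : ℝ}, M.nZero T R εS εL 20480 b₃ < n →
      logTerm p q b₃ < n ∧ ⌈M.sAlpha T R⌉₊ ≤ sparsityLevel p q n := fun hn =>
    ⟨(max_lt_iff.1 (max_lt_iff.1 hn).2).2, Model.ceil_sAlpha_le_sparsityLevel h.p_pos h.q_pos hn⟩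
  by_cases hc : logTerm p q b₃ < n ∧ 2 ≤ sparsityLevel p q n
  · have hsn := mul_add_sparsityLevel_mul_log_le h.p_pos h.q_pos (Nat.ne_zero_of_lt hc.2)
    obtain ⟨E, hE, hPE, hgood⟩ :=
      Model.exists_measurableSet_isGood hSig h hZ hi h0 h1.le hc.1 hc.2 hsn
    refine ⟨E, hE, hPE, fun ω hω R εS εL hB hd hεS hεL hε hn => ?_⟩
    refine Model.exists_isEstimator_and_frobDist_le_errorBound hSig hL hβ h hT
      (logTerm_nonneg h.p_pos h.q_pos h0 h1.le) (hgood ω hω)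
      ⟨hB, hd, (Nat.le_ceil _).trans (Nat.cast_le.2 (hnZero hn).2), hεS, hεL, ?_⟩ hn
    rw [Model.a1]
    linarith
  · refine ⟨Set.univ, .univ, ?_, fun ω _ R εS εL hB hd _ _ _ hn => absurd
      ⟨(hnZero hn).1, (Model.two_le_ceil_sAlpha hL hβ h hT hB hd).trans (hnZero hn).2⟩ hc⟩
    rw [probReal_univ]
    linarith [Real.exp_pos (-(1 / 2048 * (n : ℝ)))]

open PGGM in
theorem theorem2p1 :
    ∃ b₁ : ℝ, 0 < b₁ ∧ ∃ b₂ : ℝ, 0 < b₂ ∧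
      ∀ (p q n : ℕ) (M : Model p q) (T : Tuning),
        M.Sig.PosDef → M.L.PosDef → 1 ≤ M.β → M.H1 → T.Valid →
      ∀ (Ω : Type*) [MeasurableSpace Ω] (P : Measure Ω) [IsProbabilityMeasure P]
        (Z : Fin n → Ω → EuclideanSpace ℝ (Fin q ⊕ Fin p)),
        (∀ i, HasLaw (Z i) (multivariateGaussian 0 M.Sig) P) → iIndepFun Z P →
      ∀ b₃ : ℝ, 0 < b₃ → b₃ < 1 →
        ∃ E : Set Ω, MeasurableSet E ∧ 1 - Real.exp (-(b₂ * n)) - b₃ ≤ P.real E ∧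
          ∀ ω ∈ E, ∀ (R : Reg) (εS εL : ℝ),
            M.InBand T R (sampleCov fun i => Z i ω) →
            0 < M.alphaDen T R →
            0 < εS → 0 < εL →
            εS * M.omegaSUp + R.eta * M.β * (p : ℝ) ^ (M.β - 1) * M.omegaLUp ^ M.β * εL < 1 →
            M.nZero T R εS εL b₁ b₃ < n →
              (∃ θ, M.IsEstimator R (sampleCov fun i => Z i ω) θ) ∧
              ∀ θ, M.IsEstimator R (sampleCov fun i => Z i ω) θ →
                frobDist θ M.theta ≤ M.errorBound T R εS εL b₃ n := by
  obtain ⟨b₁, hb₁, b₂, hb₂, hmain⟩ := theorem2p1_general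
  exact ⟨b₁, hb₁, b₂, hb₂, fun p q n M T hSig hL => hmain p q n M T hSig hL.posSemidef⟩
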